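/- **Theorem (Duality transformation formula of type $BC$).** Let $\Omega=\mathbb{Z}\omega_1\oplus\mathbb{Z}\omega_2$ with $\omega_1,\omega_2\in\mathbb{C}$ linearly independent over $\mathbb{R}$, let $g\in\mathbb{C}$, $e(u)=\exp(2\pi\sqrt{-1}\,u)$, and $$[u]=e(gu^2)\,\sigma(u;\Omega),\qquad \sigma(u;\Omega)=u\prod_{\omega\in\Omega\setminus\{0\}}\Bigl(1-\frac u\omega\Bigr)e^{\frac u\omega+\frac{u^2}{2\omega^2}},\qquad [x\pm y]=[x+y][x-y].$$ Put $\omega_0=0$, $\omega_3=-\omega_1-\omega_2$; let $\epsilon_\omega=1$ for $\omega\in2\Omega$ and $\epsilon_\omega=-1$ for $\omega\in\Omega\setminus 2\Omega$, let $\eta_\omega\in\mathbb{C}$ be the constant with $[u+\omega]=\epsilon_\omega e(\eta_\omega(u+\frac\omega2))[u]$ for all $u$, and $\epsilon_r=\epsilon_{\omega_r}$, $\eta_r=\eta_{\omega_r}$ $(0\le r\le 3)$. Fix $\delta\in\mathbb{C}^*$ with $\mathbb{Z}\delta\cap\Omega=\{0\}$. For a function $f$ and $k\in\mathbb{N}=\{0,1,2,\dots\}$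 write $f(u)_k=\prod_{i=0}^{k-1}f(u+i\delta)$; in particular $[u]_k=\prod_{i=0}^{k-1}[u+i\delta]$. For $a=(a_0,\dots,a_7)\in\mathbb{C}^8$ and $c=(c_0,\dots,c_3)\in\mathbb{C}^4$ set $$A^+(x;a)=\frac{\prod_{p=0}^7[x+a_p]}{[2x][2x+\delta]},\qquad A^-(x;a)=\frac{\prod_{p=0}^7[x-a_p]}{[2x][2x-\delta]},$$ $$A^0(x;a|c)=\sum_{r=0}^3\epsilon_r\,e\Bigl(\bigl(\delta-\tfrac{\omega_r}2-\tfrac12\textstyle\sum_{p=0}^7a_p\bigr)\eta_r\Bigr)\frac{[x\pm c_r]\prod_{p=0}^7[\frac12(\omega_r-\delta)+a_p]}{2[\frac12(\omega_r-\delta)\pm x][\frac12(\omega_r-\delta)\pm c_r]},$$ and, for $\sigma\in\mathbb{N}$, $$C_\sigma(z;a|c)=\sum_{0\le r\le\sigma/2}(-1)^r\sum_{(\xi_p)}\ \prod_{p=1}^rA^+(z+(\xi_p-1)\delta;a)\,A^-(z+\xi_p\delta;a)\prod_{\substack{0\le k\le\sigma-1\\ k\ne\xi_p-1,\,\xi_p\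 (1\le p\le r)}}A^0(z+k\delta;a|c),$$ where the inner sum is over integers $0<\xi_1<\dots<\xi_r<\sigma$ with $\xi_{p+1}-\xi_p\ge2$ $(1\le p\le r-1)$. For $\alpha\in\mathbb{N}^m$, $\beta\in\mathbb{N}^n$, $x\in\mathbb{C}^m$, $y\in\mathbb{C}^n$ define, with $|\nu|=\sum_i\nu_i$ and $\le$ the componentwise order, \begin{align*} \Phi_{\alpha,\beta}(x;y;a|c)=&\sum_{0\le\nu\le\mu\le\alpha}(-1)^{|\nu|+|\alpha-\mu|}\prod_{i=1}^mA^-(x_i;a)_{\nu_i}\,A^+(x_i+\mu_i\delta;a)_{\alpha_i-\mu_i}\,C_{\mu_i-\nu_i}(x_i+\nu_i\delta;a|c)\\ &\cdot\prod_{i=1}^m\frac{[2x_i+2(\nu_i-1)\delta]}{[2x_i-2\delta]}\frac{[2x_i+2\mu_i\delta]}{[2x_i+2\alpha_i\delta]}\\ &\cdot\prod_{1\le i<j\le m}\frac{[(x_i+\nu_i\delta-\delta)\pm(x_j+\nu_j\delta-\delta)]}{[(x_i-\delta)\pm(x_j-\delta)]}\frac{[(x_i+\mu_i\delta)\pm(x_j+\mu_j\delta)]}{[(x_i+\alpha_i\delta)\pm(x_j+\alpha_j\delta)]}\\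 &\cdot\prod_{1\le i,j\le m}\frac{[(x_i-\delta)\pm(x_j+\alpha_j\delta)]}{[(x_i-\delta)\pm(x_j+\mu_j\delta)]}\frac{[(x_i+\nu_i\delta-\delta)\pm(x_j+\mu_j\delta)]}{[(x_i+\nu_i\delta-\delta)\pm(x_j+\alpha_j\delta)]}\frac{[x_i+x_j-2\delta]_{\nu_i}}{[x_i+x_j+(\alpha_j-1)\delta]_{\nu_i}}\frac{[x_i-x_j-\alpha_j\delta]_{\nu_i}}{[x_i-x_j+\delta]_{\nu_i}}\\ &\cdot\prod_{1\le i,j\le m}\frac{[-x_i-x_j-(\alpha_i+\alpha_j)\delta]_{\alpha_i-\mu_i}}{[-x_i-x_j-(\alpha_i-1)\delta]_{\alpha_i-\mu_i}}\frac{[-x_i+x_j-\alpha_i\delta]_{\alpha_i-\mu_i}}{[-x_i+x_j+(\alpha_j-\alpha_i+1)\delta]_{\alpha_i-\mu_i}}\\ &\cdot\prod_{\substack{1\le i\le m\\1\le k\le n}}\frac{[x_i+y_k+(\beta_k-1)\delta]_{\nu_i}}{[x_i+y_k-\delta]_{\nu_i}}\frac{[x_i-y_k]_{\nu_i}}{[x_i-y_k-\beta_k\delta]_{\nu_i}}\\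 &\cdot\prod_{\substack{1\le i\le m\\1\le k\le n}}\frac{[-x_i-y_k-(\alpha_i-1)\delta]_{\alpha_i-\mu_i}}{[-x_i-y_k-(\alpha_i+\beta_k-1)\delta]_{\alpha_i-\mu_i}}\frac{[-x_i+y_k-(\alpha_i-\beta_k)\delta]_{\alpha_i-\mu_i}}{[-x_i+y_k-\alpha_i\delta]_{\alpha_i-\mu_i}}. \end{align*} Let $a\in\mathbb{C}^8$ satisfy the balancing condition $\sum_{p=0}^7a_p=4\delta$, let $b_p=\delta-a_p$ $(0\le p\le7)$, let $c\in\mathbb{C}^4$ with $[\frac12(\omega_r-\delta)\pm c_r]\ne0$ for $0\le r\le3$, and let $\alpha\in\mathbb{N}^m$, $\beta\in\mathbb{N}^n$ with $|\alpha|=|\beta|$. Then $$\Phi_{\alpha,\beta}(x;y;a|c)=\Phi_{\beta,\alpha}(y;x;b|c)$$ for all $x\in\mathbb{C}^m$ and $y\in\mathbb{C}^n$ for which no denominator in the terms of the two sides vanishes. -/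

import Mathlib

noncomputable section

namespace EllipticBC

/-- The function `e(u) = exp(2πiu)`. -/
def e (u : ℂ) : ℂ := Complex.exp (2 * Real.pi * Complex.I * u)

/-- The Weierstrass sigma function of the period lattice `Ω = ℤ ω₁ ⊕ ℤ ω₂`:
`σ(u; Ω) = u ∏_{ω ∈ Ω, ω ≠ 0} (1 - u/ω) exp(u/ω + u²/(2ω²))`. -/
def sigma (L : PeriodPair) (u : ℂ) : ℂ :=
  u * ∏' w : {w : L.lattice // w ≠ 0},
    (1 - u / ((w : L.lattice) : ℂ)) *
      Complex.exp (u / ((w : L.lattice) : ℂ) + u ^ 2 / (2 * ((w : L.lattice) : ℂ) ^ 2))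

section

variable (L : PeriodPair) (g δ : ℂ)

/-- The odd entire function `[u] = e(g u²) σ(u; Ω)`, for a constant `g`. -/
def br (u : ℂ) : ℂ := e (g * u ^ 2) * sigma L u

/-- The abbreviation `[x ± y] = [x + y][x - y]`. -/
def brpm (x y : ℂ) : ℂ := br L g (x + y) * br L g (x - y)

/-- `ω_0 = 0`, `ω_1`, `ω_2`, `ω_3 = -ω_1 - ω_2`. -/
def om : Fin 4 → ℂ := ![0, L.ω₁, L.ω₂, -L.ω₁ - L.ω₂]

open Classical in
/-- The sign `ε_ω`: equal to `1` if `ω ∈ 2Ω`, and to `-1` otherwise. -/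
def eps (w : ℂ) : ℂ := if ∃ l ∈ L.lattice, w = 2 * l then 1 else -1

/-- The (unique) number `η_ω` with `[u + ω] = ε_ω e(η_ω (u + ω/2)) [u]` for all `u`. -/
def eta (w : ℂ) : ℂ :=
  Classical.epsilon fun h : ℂ => ∀ u : ℂ, br L g (u + w) = eps L w * e (h * (u + w / 2)) * br L g u

/-- `A⁺(x; a) = ∏_p [x + a_p] / ([2x][2x + δ])`. -/
def Aplus (a : Fin 8 → ℂ) (x : ℂ) : ℂ :=
  (∏ p, br L g (x + a p)) / (br L g (2 * x) * br L g (2 * x + δ))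

/-- `A⁻(x; a) = ∏_p [x - a_p] / ([2x][2x - δ])`. -/
def Aminus (a : Fin 8 → ℂ) (x : ℂ) : ℂ :=
  (∏ p, br L g (x - a p)) / (br L g (2 * x) * br L g (2 * x - δ))

/-- The term `A⁰_r(x; a | c)`. -/
def AzeroTerm (r : Fin 4) (a : Fin 8 → ℂ) (c : ℂ) (x : ℂ) : ℂ :=
  eps L (om L r) * e ((δ - om L r / 2 - (∑ p, a p) / 2) * eta L g (om L r)) *
    (brpm L g x c * ∏ p, br L g ((om L r - δ) / 2 + a p)) /
    (2 * brpm L g ((om L r - δ) / 2) x * brpm L g ((om L r - δ) / 2) c)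

/-- `A⁰(x; a | c) = ∑_r A⁰_r(x; a | c_r)`. -/
def Azero (a : Fin 8 → ℂ) (c : Fin 4 → ℂ) (x : ℂ) : ℂ :=
  ∑ r, AzeroTerm L g δ r a (c r) x

/-- The shifted product `f(u)_k = ∏_{i=0}^{k-1} f(u + iδ)`. -/
def shifted (f : ℂ → ℂ) (u : ℂ) (k : ℕ) : ℂ := ∏ i ∈ Finset.range k, f (u + i * δ)

/-- The coefficient `C_s(z; a | c)`. A sequence `0 < ξ_1 < ⋯ < ξ_r < s` with
`ξ_{p+1} - ξ_p ≥ 2` is encoded as the `r`-element set `S = {ξ_1, …, ξ_r}`. -/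
def C (a : Fin 8 → ℂ) (c : Fin 4 → ℂ) (s : ℕ) (z : ℂ) : ℂ :=
  ∑ r ∈ Finset.range (s / 2 + 1), (-1) ^ r *
    ∑ S ∈ ((Finset.Ioo 0 s).powersetCard r).filter (fun S => ∀ ξ ∈ S, ξ + 1 ∉ S),
      (∏ ξ ∈ S, Aplus L g δ a (z + ((ξ : ℂ) - 1) * δ) * Aminus L g δ a (z + ξ * δ)) *
      ∏ k ∈ (Finset.range s).filter (fun k => k ∉ S ∧ k + 1 ∉ S), Azero L g δ a c (z + k * δ)

/-- The summand, indexed by `0 ≤ ν ≤ μ ≤ α`, of the `BC_m`-type multiple sum in the variables `x`,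
with auxiliary multi-index `β` and variables `y`. -/
def bcTerm (a : Fin 8 → ℂ) (c : Fin 4 → ℂ) {m n : ℕ} (α : Fin m → ℕ) (β : Fin n → ℕ)
    (x : Fin m → ℂ) (y : Fin n → ℂ) (ν μ : Fin m → ℕ) : ℂ :=
  (-1) ^ ((∑ i, ν i) + ∑ i, (α i - μ i)) *
  (∏ i, shifted δ (Aminus L g δ a) (x i) (ν i) *
      shifted δ (Aplus L g δ a) (x i + μ i * δ) (α i - μ i) *
      C L g δ a c (μ i - ν i) (x i + ν i * δ)) *
  (∏ i, br L g (2 * x i + 2 * ((ν i : ℂ) - 1) * δ) / br L g (2 * x i - 2 * δ) *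
      (br L g (2 * x i + 2 * μ i * δ) / br L g (2 * x i + 2 * α i * δ))) *
  (∏ i, ∏ j ∈ Finset.Ioi i,
      brpm L g (x i + ν i * δ - δ) (x j + ν j * δ - δ) / brpm L g (x i - δ) (x j - δ) *
      (brpm L g (x i + μ i * δ) (x j + μ j * δ) / brpm L g (x i + α i * δ) (x j + α j * δ))) *
  (∏ i, ∏ j,
      brpm L g (x i - δ) (x j + α j * δ) / brpm L g (x i - δ) (x j + μ j * δ) *
      (brpm L g (x i + ν i * δ - δ) (x j + μ j * δ) /
        brpm L g (x i + ν i * δ - δ) (x j + α j * δ)) *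
      (shifted δ (br L g) (x i + x j - 2 * δ) (ν i) /
        shifted δ (br L g) (x i + x j + ((α j : ℂ) - 1) * δ) (ν i)) *
      (shifted δ (br L g) (x i - x j - α j * δ) (ν i) /
        shifted δ (br L g) (x i - x j + δ) (ν i))) *
  (∏ i, ∏ j,
      shifted δ (br L g) (-x i - x j - ((α i : ℂ) + α j) * δ) (α i - μ i) /
        shifted δ (br L g) (-x i - x j - ((α i : ℂ) - 1) * δ) (α i - μ i) *
      (shifted δ (br L g) (-x i + x j - α i * δ) (α i - μ i) /
        shifted δ (br L g) (-x i + x j + ((α j : ℂ) - α i + 1) * δ) (α i - μ i))) *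
  (∏ i, ∏ k,
      shifted δ (br L g) (x i + y k + ((β k : ℂ) - 1) * δ) (ν i) /
        shifted δ (br L g) (x i + y k - δ) (ν i) *
      (shifted δ (br L g) (x i - y k) (ν i) /
        shifted δ (br L g) (x i - y k - β k * δ) (ν i))) *
  (∏ i, ∏ k,
      shifted δ (br L g) (-x i - y k - ((α i : ℂ) - 1) * δ) (α i - μ i) /
        shifted δ (br L g) (-x i - y k - ((α i : ℂ) + β k - 1) * δ) (α i - μ i) *
      (shifted δ (br L g) (-x i + y k - ((α i : ℂ) - β k) * δ) (α i - μ i) /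
        shifted δ (br L g) (-x i + y k - α i * δ) (α i - μ i)))

/-- The `BC_m`-type multiple sum over all pairs of multi-indices `0 ≤ ν ≤ μ ≤ α`. -/
def bcSum (a : Fin 8 → ℂ) (c : Fin 4 → ℂ) {m n : ℕ} (α : Fin m → ℕ) (β : Fin n → ℕ)
    (x : Fin m → ℂ) (y : Fin n → ℂ) : ℂ :=
  ∑ μ ∈ Finset.Icc 0 α, ∑ ν ∈ Finset.Icc 0 μ, bcTerm L g δ a c α β x y ν μ

/-- No denominator depending on the variables vanishes in any of the terms of
`bcSum L g δ a c α β x y`. The field `add` (with `i = j` allowed) covers all the denominators of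
the form `[±(x_i + x_j) + …]`, in particular those of `A⁺`, `A⁻`, and it covers
`[(ω_r - δ)/2 ± (x_i + kδ)]`, for `0 ≤ k < α_i`, since twice the argument is, up to sign and
modulo `Ω`, equal to `2 x_i + (2k ± 1)δ`. -/
structure Regular {m n : ℕ} (α : Fin m → ℕ) (β : Fin n → ℕ)
    (x : Fin m → ℂ) (y : Fin n → ℂ) : Prop where
  add : ∀ i j, ∀ k : ℤ, -2 ≤ k → k ≤ α i + α j → br L g (x i + x j + k * δ) ≠ 0
  sub : ∀ i j, i ≠ j → ∀ k : ℤ, -(α j + 1 : ℤ) ≤ k → k ≤ α i + 1 →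
    br L g (x i - x j + k * δ) ≠ 0
  cross_add : ∀ i k, ∀ s : ℕ, s < α i →
    br L g (x i + y k + ((s : ℂ) - 1) * δ) ≠ 0 ∧ br L g (x i + y k + ((β k : ℂ) + s) * δ) ≠ 0
  cross_sub : ∀ i k, ∀ s : ℕ, s < α i →
    br L g (x i - y k + ((s : ℂ) - β k) * δ) ≠ 0 ∧ br L g (x i - y k + ((s : ℂ) + 1) * δ) ≠ 0

end

end EllipticBC

end

/-! Write `D_a = A⁻(x) T⁻¹ + A⁰(x) + A⁺(x) T`, where `T` shifts `x` by `δ`. The theorem follows from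
a single kernel identity, `kernelSum_eq`: applying `D_a` in `x` to `1/[x ± y]` gives the same
function as applying `D_b` in `y`, where `b_p = δ - a_p`. For fixed generic `y` the difference of
the two sides, multiplied by `[x ± y]`, is elliptic in `x`: the balancing condition makes all
multipliers cancel. All its residues vanish, so it is constant by Liouville. It is zero because at
`x = y` the shifted terms disappear and `A⁰` does not change when `a` is replaced by `b`.

Now put `N = |α| = |β|`. Let the points `X` be the union of the strings `x_i, x_i + δ, …, x_i + (α_i
- 1)δ`, and build `Y` from `y` and `β` in the same way. Applying the operator to the rows or to the
columns of the Cauchy matrix `1/[X_i ± Y_j]` gives the same matrix, hence the same determinant. It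
remains to see that either determinant is the Cauchy determinant times the corresponding multiple
sum (`exists_det_diffRow`).

For this the rows are treated as anticommuting vectors in an exterior algebra. Along a string of
length `n` the operator produces a product of `n` three-term combinations of the `n + 2` rows at `x
- δ, …, x + nδ`. A product with a repeated row vanishes, so each surviving monomial omits exactly
two rows, `x + (ν - 1)δ` and `x + μδ` with `ν ≤ μ`. Its coefficient is a product of `A⁻` over the
first `ν` places, a product of `A⁺` over the last `n - μ` places, and a continuant in between
(`prod_three_term`). The continuant is `C_{μ-ν}`, a sum over domino tilings, in which each domino
carries a minus sign from one transposition.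

Each remaining determinant is again of Cauchy type and is evaluated by `exists_det_inv_brpm`.
Relative to the determinant of the unbroken strings, the change amounts to exchanging two omitted
points per string, and this produces the products of brackets in the summand
(`strCoeff_mul_winAll`).

The argument needs all relevant brackets to be nonzero. The general case follows by continuity along
a complex line through `(x, y)` on which generic parameters are dense. -/

open Filter Topology

/-! ### Convergence, zeros and quasi-periodicity of the sigma function. -/

namespace EllipticBC

/-- The quadratic Weierstrass primary factor, equal to `1` at `w = 0`. -/
noncomputable def primaryFactor (w u : ℂ) : ℂ := (1 - u / w) * Complex.exp (u / w + u ^ 2 / (2 * w ^ 2))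

/-- The exponential cancels the Taylor terms of degree one and two. The remaining cubic decay is
what makes a product over a lattice of rank two converge. -/
lemma norm_one_sub_mul_exp_sub_one_le {t : ℂ} (ht : ‖t‖ ≤ 1 / 2) :
    ‖(1 - t) * Complex.exp (t + t ^ 2 / 2) - 1‖ ≤ 2 * ‖t‖ ^ 3 := by
  have h0 := norm_nonneg t
  -- Since `‖t‖ ≤ 1/2`, the quadratic term is at most `‖t‖ / 4`.
  have hs : ‖t + t ^ 2 / 2‖ ≤ 5 / 4 * ‖t‖ := by
    refine (norm_add_le _ _).trans ?_
    simp only [norm_div, norm_pow, Complex.norm_ofNat]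
    nlinarith
  have hE := Complex.exp_bound' (x := t + t ^ 2 / 2) (n := 3) (by
    norm_num; linarith)
  simp only [Finset.sum_range_succ, Finset.range_zero, Finset.sum_empty, pow_zero, pow_one,
    Nat.factorial, Nat.cast_one] at hE
  have hE2 : ‖Complex.exp (t + t ^ 2 / 2) - (1 + (t + t ^ 2 / 2) + (t + t ^ 2 / 2) ^ 2 / 2)‖
      ≤ (5 / 4 * ‖t‖) ^ 3 / 3 := by
    refine le_trans (le_of_eq ?_) (hE.trans ?_)
    · congr 1; push_cast; ring
    · have : ‖t + t ^ 2 / 2‖ ^ 3 ≤ (5 / 4 * ‖t‖) ^ 3 := by gcongr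
      norm_num; linarith
  set R := Complex.exp (t + t ^ 2 / 2) - (1 + (t + t ^ 2 / 2) + (t + t ^ 2 / 2) ^ 2 / 2)
  have hR : Complex.exp (t + t ^ 2 / 2) = R + (1 + (t + t ^ 2 / 2) + (t + t ^ 2 / 2) ^ 2 / 2) := by
    simp [R]
  rw [hR, show (1 - t) * (R + (1 + (t + t ^ 2 / 2) + (t + t ^ 2 / 2) ^ 2 / 2)) - 1 =
    (1 - t) * R - t ^ 3 * (1 / 2 + 3 / 8 * t + t ^ 2 / 8) by ring]
  have h1 : ‖1 - t‖ ≤ 3 / 2 := (norm_sub_le _ _).trans (by simp; linarith)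
  have h2 : ‖1 / 2 + 3 / 8 * t + t ^ 2 / 8‖ ≤ 3 / 4 := by
    refine (norm_add₃_le).trans ?_
    simp only [norm_div, norm_mul, norm_pow, Complex.norm_ofNat, norm_one]
    nlinarith
  calc _ ≤ ‖(1 - t) * R‖ + ‖t ^ 3 * (1 / 2 + 3 / 8 * t + t ^ 2 / 8)‖ := norm_sub_le _ _
    _ ≤ 3 / 2 * ((5 / 4 * ‖t‖) ^ 3 / 3) + ‖t‖ ^ 3 * (3 / 4) := by
        rw [norm_mul, norm_mul, norm_pow]; gcongr
    _ ≤ _ := by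
        have : 0 ≤ ‖t‖ ^ 3 := by positivity
        nlinarith

lemma norm_primaryFactor_sub_one_le {r : ℝ} (hr : 0 < r) {w u : ℂ} (hu : ‖u‖ ≤ r)
    (hw : 2 * r ≤ ‖w‖) : ‖primaryFactor w u - 1‖ ≤ 2 * r ^ 3 * ‖w‖ ^ (-3 : ℝ) := by
  have hw0 : 0 < ‖w‖ := by linarith
  have ht : ‖u / w‖ ≤ r / ‖w‖ := by rw [norm_div]; gcongr
  have h := norm_one_sub_mul_exp_sub_one_le (t := u / w)
    (ht.trans (by rw [div_le_iff₀ hw0]; linarith))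
  have e1 : primaryFactor w u = (1 - u / w) * Complex.exp (u / w + (u / w) ^ 2 / 2) := by
    rw [primaryFactor, div_pow, div_div, mul_comm (2 : ℂ)]
  rw [e1]
  refine h.trans ?_
  calc 2 * ‖u / w‖ ^ 3 ≤ 2 * (r / ‖w‖) ^ 3 := by gcongr
    _ = 2 * r ^ 3 * (‖w‖ ^ 3)⁻¹ := by ring
    _ = _ := by norm_cast

variable (L : PeriodPair)

lemma differentiable_primaryFactor (w : ℂ) : Differentiable ℂ (primaryFactor w) := by
  unfold primaryFactor; fun_prop

lemma eventually_norm_primaryFactor_sub_one_le {r : ℝ} (hr : 0 < r) :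
    ∀ᶠ w : L.lattice in cofinite, ∀ u ∈ Metric.ball (0 : ℂ) r,
      ‖primaryFactor w u - 1‖ ≤ 2 * r ^ 3 * ‖w‖ ^ (-3 : ℝ) := by
  refine (isCompact_iff_finite.mp (isCompact_closedBall (0 : L.lattice) (2 * r))).subset ?_
  intro w hw
  by_contra hc
  refine hw fun u hu => norm_primaryFactor_sub_one_le hr (mem_ball_zero_iff.mp hu).le ?_
  simp only [Metric.mem_closedBall, dist_zero_right, not_le] at hc
  exact hc.le

lemma summable_lattice_bound (r : ℝ) :
    Summable fun w : L.lattice => 2 * r ^ 3 * ‖w‖ ^ (-3 : ℝ) :=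
  (ZLattice.summable_norm_rpow _ _ (by simp; norm_num)).mul_left _

lemma hasProdLocallyUniformlyOn_primaryFactor {r : ℝ} (hr : 0 < r) :
    HasProdLocallyUniformlyOn (fun (w : L.lattice) u => primaryFactor w u)
      (fun u => ∏' w : L.lattice, primaryFactor w u) (Metric.ball 0 r) := by
  have := (summable_lattice_bound L r).hasProdLocallyUniformlyOn_one_add Metric.isOpen_ball
    (eventually_norm_primaryFactor_sub_one_le L hr)
    (fun w => ((differentiable_primaryFactor (w : ℂ)).continuous.sub
      continuous_const).continuousOn)
  simpa using this

lemma sigma_eq (u : ℂ) : sigma L u = u * ∏' w : L.lattice, primaryFactor w u := by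
  have h := tprod_subtype_eq_of_mulSupport_subset
    (f := fun w : L.lattice => primaryFactor (w : ℂ) u) (s := {w | w ≠ 0}) (by
      intro w hw h0
      apply hw
      simp [h0, primaryFactor])
  rw [← h]
  rfl

lemma differentiable_tprod_primaryFactor :
    Differentiable ℂ (fun u => ∏' w : L.lattice, primaryFactor w u) := by
  intro u
  have hr : 0 < ‖u‖ + 1 := by positivity
  refine ((hasProdLocallyUniformlyOn_primaryFactor L hr).differentiableOn
    (.of_forall fun _ ↦ ?_) Metric.isOpen_ball).differentiableAt
    (Metric.isOpen_ball.mem_nhds (by simp))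
  simpa [Finset.prod_fn] using DifferentiableOn.finsetProd
    (fun (w : L.lattice) _ ↦ (differentiable_primaryFactor (w : ℂ)).differentiableOn)

lemma differentiable_sigma : Differentiable ℂ (sigma L) := by
  rw [funext (sigma_eq L)]
  exact differentiable_id.mul (differentiable_tprod_primaryFactor L)

lemma sigma_zero : sigma L 0 = 0 := by simp [sigma]

lemma primaryFactor_zero (w : ℂ) : primaryFactor w 0 = 1 := by simp [primaryFactor]

lemma hasDerivAt_sigma_zero : HasDerivAt (sigma L) 1 0 := by
  rw [funext (sigma_eq L)]
  have := (hasDerivAt_id (0 : ℂ)).mul (differentiable_tprod_primaryFactor L 0).hasDerivAt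
  simp only [primaryFactor_zero, tprod_one, id_eq, mul_one, zero_mul, add_zero] at this
  exact this

lemma sigma_neg (u : ℂ) : sigma L (-u) = -sigma L u := by
  rw [sigma_eq, sigma_eq, neg_mul, ← (Equiv.neg L.lattice).tprod_eq]
  congr 3
  funext w
  simp [primaryFactor]

lemma primaryFactor_ne_zero {w u : ℂ} (h : u ≠ w) : primaryFactor w u ≠ 0 := by
  refine mul_ne_zero ?_ (Complex.exp_ne_zero _)
  by_cases hw : w = 0
  · simp [hw]
  rw [sub_ne_zero, ne_comm, Ne, div_eq_one_iff_eq hw]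
  exact h

lemma tprod_primaryFactor_ne_zero {u : ℂ} (hu : u ∉ L.lattice) :
    ∏' w : L.lattice, primaryFactor w u ≠ 0 := by
  have := tprod_one_add_ne_zero_of_summable (f := fun w : L.lattice => primaryFactor w u - 1)
    (fun w => by
      simpa using primaryFactor_ne_zero (u := u) (w := w) (fun h => hu (by rw [h]; exact w.2)))
    (by
      have hr : 0 < ‖u‖ + 1 := by positivity
      refine (summable_lattice_bound L (‖u‖ + 1)).of_norm_bounded_eventually ?_
      filter_upwards [eventually_norm_primaryFactor_sub_one_le L hr] with w hw
      simpa using hw u (by simp))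
  simpa using this

lemma sigma_ne_zero {u : ℂ} (hu : u ∉ L.lattice) : sigma L u ≠ 0 := by
  rw [sigma_eq]
  refine mul_ne_zero ?_ (tprod_primaryFactor_ne_zero L hu)
  rintro rfl
  exact hu (zero_mem _)

/-- The regular part at `0` of the Weierstrass zeta function. -/
noncomputable def zetaTerm (w u : ℂ) : ℂ :=
  if w = 0 then 0 else 1 / (u - w) + 1 / w + u / w ^ 2

lemma logDeriv_primaryFactor {w u : ℂ} (h : u ≠ w) :
    logDeriv (primaryFactor w) u = zetaTerm w u := by
  unfold zetaTerm
  split_ifs with hw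
  · subst hw
    rw [show primaryFactor 0 = fun _ => (1 : ℂ) by funext u; simp [primaryFactor]]
    simp [logDeriv]
  have h1 : 1 - u / w ≠ 0 := by
    rw [sub_ne_zero, ne_comm, Ne, div_eq_one_iff_eq hw]; exact h
  have hd : HasDerivAt (primaryFactor w) ((-(1 / w)) * Complex.exp (u / w + u ^ 2 / (2 * w ^ 2)) +
      (1 - u / w) * (Complex.exp (u / w + u ^ 2 / (2 * w ^ 2)) *
        (1 / w + (2 * u) / (2 * w ^ 2)))) u := by
    have a1 : HasDerivAt (fun u => 1 - u / w) (-(1 / w)) u :=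
      ((hasDerivAt_id u).div_const w).const_sub 1
    have a2 : HasDerivAt (fun u => u / w + u ^ 2 / (2 * w ^ 2))
        (1 / w + (2 * u) / (2 * w ^ 2)) u := by
      have := ((hasDerivAt_id u).div_const w).add ((hasDerivAt_pow 2 u).div_const (2 * w ^ 2))
      exact this.congr_deriv (by simp)
    exact a1.mul a2.cexp
  have hsub : u - w ≠ 0 := sub_ne_zero.mpr h
  have hsub' : w - u ≠ 0 := sub_ne_zero.mpr h.symm
  rw [logDeriv_apply, hd.deriv, primaryFactor]
  have hE := Complex.exp_ne_zero (u / w + u ^ 2 / (2 * w ^ 2))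
  generalize Complex.exp (u / w + u ^ 2 / (2 * w ^ 2)) = E at *
  rw [show 1 - u / w = -(u - w) / w by field_simp; ring]
  field_simp
  ring

lemma norm_zetaTerm_le {r : ℝ} (hr : 0 < r) {w u : ℂ} (hu : ‖u‖ < r) (hw : 2 * r ≤ ‖w‖) :
    ‖zetaTerm w u‖ ≤ 2 * r ^ 2 * ‖w‖ ^ (-3 : ℝ) := by
  have hw0 : 0 < ‖w‖ := by linarith
  have hwne : w ≠ 0 := norm_pos_iff.mp hw0
  have h2 : ‖w‖ / 2 ≤ ‖u - w‖ := by
    have := norm_sub_norm_le w u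
    rw [norm_sub_rev] at this
    linarith
  have hne : u - w ≠ 0 := norm_pos_iff.mp (by linarith)
  rw [zetaTerm, if_neg hwne,
    show 1 / (u - w) + 1 / w + u / w ^ 2 = u ^ 2 / (w ^ 2 * (u - w)) by field_simp; ring]
  rw [norm_div, norm_mul, norm_pow, norm_pow]
  calc _ ≤ r ^ 2 / (‖w‖ ^ 2 * (‖w‖ / 2)) := by gcongr
    _ = 2 * r ^ 2 * (‖w‖ ^ 3)⁻¹ := by field
    _ = _ := by norm_cast

lemma hasSumLocallyUniformly_zetaTerm :
    HasSumLocallyUniformly (fun (w : L.lattice) u => zetaTerm w u)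
      (fun u => ∑' w : L.lattice, zetaTerm w u) := by
  refine L.hasSumLocallyUniformly_aux (u := (2 * · ^ 2 * ‖·‖ ^ (-3 : ℝ))) _
    (fun _ _ ↦ (ZLattice.summable_norm_rpow _ _ (by simp; norm_num)).mul_left _) fun r hr ↦
    Filter.eventually_atTop.mpr ⟨2 * r, ?_⟩
  rintro _ h s hs l rfl
  exact norm_zetaTerm_le hr hs h

lemma hasDerivAt_zetaTerm {w u : ℂ} (h : u ≠ w) :
    HasDerivAt (zetaTerm w) (-(if w = 0 then 0 else 1 / (u - w) ^ 2 - 1 / w ^ 2)) u := by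
  unfold zetaTerm
  split_ifs with hw
  · simpa using hasDerivAt_const u (0 : ℂ)
  have hsub : u - w ≠ 0 := sub_ne_zero.mpr h
  have := ((((hasDerivAt_id u).sub_const w).inv hsub).add_const (1 / w)).add
    ((hasDerivAt_id u).div_const (w ^ 2))
  refine (this.congr_deriv ?_).congr_of_eventuallyEq (.of_forall fun v => ?_)
  · simp only [id]; ring
  · simp only [Pi.add_apply, id, one_div]; rfl

lemma isOpen_compl_lattice : IsOpen ((L.lattice : Set ℂ)ᶜ) := L.isClosed_lattice.isOpen_compl

lemma ne_coe_of_notMem {u : ℂ} (hu : u ∈ (L.lattice : Set ℂ)ᶜ) (w : L.lattice) : u ≠ w := by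
  rintro rfl
  exact hu w.2

/-- Locally uniform convergence off the lattice permits termwise differentiation, and the terms
become those of `-℘` without the pole at `0`. -/
lemma deriv_tsum_zetaTerm {u : ℂ} (hu : u ∉ L.lattice) :
    HasDerivAt (fun u => ∑' w : L.lattice, zetaTerm w u) (-L.weierstrassPExcept 0 u) u := by
  have hT := (hasSumLocallyUniformly_zetaTerm L).hasSumLocallyUniformlyOn
    (s := (L.lattice : Set ℂ)ᶜ)
  have hdiff : ∀ s : Finset L.lattice, DifferentiableOn ℂ
      (fun u => ∑ w ∈ s, zetaTerm w u) (L.lattice : Set ℂ)ᶜ := fun s =>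
    .fun_sum fun w _ v hv => (hasDerivAt_zetaTerm
      (ne_coe_of_notMem L hv w)).differentiableAt.differentiableWithinAt
  have hD := (hasSumLocallyUniformly_zetaTerm L).tendstoLocallyUniformlyOn
    (s := (L.lattice : Set ℂ)ᶜ) |>.deriv (.of_forall hdiff) (isOpen_compl_lattice L)
  have hder : deriv (fun u => ∑' w : L.lattice, zetaTerm w u) u = -L.weierstrassPExcept 0 u := by
    refine tendsto_nhds_unique (hD.tendsto_at hu) ?_
    have := (L.hasSum_weierstrassPExcept 0 u).neg
    refine Tendsto.congr (fun s => ?_) this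
    simp only [Function.comp_apply]
    rw [deriv_fun_sum fun w _ => (hasDerivAt_zetaTerm (ne_coe_of_notMem L hu w)).differentiableAt]
    refine Finset.sum_congr rfl fun w _ => ?_
    rw [(hasDerivAt_zetaTerm (ne_coe_of_notMem L hu w)).deriv]
  rw [← hder]
  exact ((hT.differentiableOn (.of_forall hdiff) (isOpen_compl_lattice L)).differentiableAt
    ((isOpen_compl_lattice L).mem_nhds hu)).hasDerivAt

lemma logDeriv_sigma {u : ℂ} (hu : u ∉ L.lattice) :
    logDeriv (sigma L) u = 1 / u + ∑' w : L.lattice, zetaTerm w u := by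
  have hu0 : u ≠ 0 := by rintro rfl; exact hu (zero_mem _)
  rw [funext (sigma_eq L), logDeriv_mul (f := fun u => u) u hu0 (tprod_primaryFactor_ne_zero L hu)
    differentiableAt_fun_id (differentiable_tprod_primaryFactor L u), logDeriv_id']
  congr 1
  have hr : 0 < ‖u‖ + 1 := by positivity
  have hlog : ∀ w : L.lattice, logDeriv (primaryFactor (w : ℂ)) u = zetaTerm w u := fun w =>
    logDeriv_primaryFactor (ne_coe_of_notMem L hu w)
  rw [logDeriv_tprod_eq_tsum (f := fun w : L.lattice => primaryFactor (w : ℂ))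
    Metric.isOpen_ball (s := Metric.ball 0 (‖u‖ + 1)) (by simp)
    (fun w => primaryFactor_ne_zero (ne_coe_of_notMem L hu w))
    (fun w => (differentiable_primaryFactor _).differentiableOn) ?_
    (hasProdLocallyUniformlyOn_primaryFactor L hr).multipliableLocallyUniformlyOn
    (tprod_primaryFactor_ne_zero L hu)]
  · exact tsum_congr hlog
  · exact ((hasSumLocallyUniformly_zetaTerm L).hasSum (x := u)).summable.congr
      fun w => (hlog w).symm

/-- The link `(log σ)'' = -℘`. The periodicity of `℘`, integrated twice, yields the
quasi-periodicity of `σ`. -/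
lemma hasDerivAt_logDeriv_sigma {u : ℂ} (hu : u ∉ L.lattice) :
    HasDerivAt (logDeriv (sigma L)) (-L.weierstrassP u) u := by
  have hu0 : u ≠ 0 := by rintro rfl; exact hu (zero_mem _)
  have h1 := (hasDerivAt_inv hu0).add (deriv_tsum_zetaTerm L hu)
  have h2 := L.weierstrassPExcept_add 0 u
  refine (h1.congr_deriv ?_).congr_of_eventuallyEq ?_
  · rw [← h2]; simp
  · filter_upwards [(isOpen_compl_lattice L).mem_nhds hu] with v hv
    simpa using logDeriv_sigma L hv

lemma isPreconnected_compl_lattice : IsPreconnected ((L.lattice : Set ℂ)ᶜ) := by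
  have hc : (L.lattice : Set ℂ).Countable :=
    Set.countable_coe_iff.mp (inferInstanceAs (Countable L.lattice))
  exact (hc.isPathConnected_compl_of_one_lt_rank (by simp)).isConnected.isPreconnected

lemma add_notMem_lattice {u w : ℂ} (hw : w ∈ L.lattice) (hu : u ∉ L.lattice) :
    u + w ∉ L.lattice := fun h => hu (by simpa using L.lattice.sub_mem h hw)

/-- First integration: the difference has derivative zero on the complement of the lattice, which is
connected because the lattice is countable. -/
lemma exists_logDeriv_sigma_add {w : ℂ} (hw : w ∈ L.lattice) :
    ∃ k : ℂ, ∀ u ∉ L.lattice, logDeriv (sigma L) (u + w) = logDeriv (sigma L) u + k := by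
  have hd : ∀ u ∈ (L.lattice : Set ℂ)ᶜ, HasDerivAt
      (fun u => logDeriv (sigma L) (u + w) - logDeriv (sigma L) u) 0 u := fun u hu => by
    have := ((hasDerivAt_logDeriv_sigma L (add_notMem_lattice L hw hu)).comp_add_const u w).sub
      (hasDerivAt_logDeriv_sigma L hu)
    refine this.congr_deriv ?_
    rw [L.weierstrassP_add_coe u ⟨w, hw⟩, sub_self]
  obtain ⟨k, hk⟩ := (isOpen_compl_lattice L).exists_is_const_of_deriv_eq_zero
    (isPreconnected_compl_lattice L) (fun u hu => (hd u hu).differentiableAt.differentiableWithinAt)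
    (fun u hu => (hd u hu).deriv)
  exact ⟨k, fun u hu => by rw [← hk u hu]; ring⟩

/-- Second integration: `σ(u + w) exp(-ku) / σ(u)` has derivative zero off the lattice. -/
lemma exists_sigma_add_eq_of_notMem {w : ℂ} (hw : w ∈ L.lattice) :
    ∃ k C : ℂ, ∀ u ∉ L.lattice, sigma L (u + w) = C * Complex.exp (k * u) * sigma L u := by
  obtain ⟨k, hk⟩ := exists_logDeriv_sigma_add L hw
  have hd : ∀ u ∈ (L.lattice : Set ℂ)ᶜ, HasDerivAt
      (fun u => sigma L (u + w) * Complex.exp (-(k * u)) / sigma L u) 0 u := fun u hu => by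
    have h0 := sigma_ne_zero L hu
    have h0' := sigma_ne_zero L (add_notMem_lattice L hw hu)
    have h1 := (differentiable_sigma L (u + w)).hasDerivAt.comp_add_const u w
    have h2 : HasDerivAt (fun u => Complex.exp (-(k * u))) (Complex.exp (-(k * u)) * -k) u := by
      have := ((hasDerivAt_id u).const_mul k).neg.cexp
      simpa using this
    refine ((h1.mul h2).div (differentiable_sigma L u).hasDerivAt h0).congr_deriv ?_
    have h3 := hk u hu
    rw [logDeriv_apply, logDeriv_apply] at h3
    have h4 : deriv (sigma L) (u + w) =
        (deriv (sigma L) u / sigma L u + k) * sigma L (u + w) := by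
      rw [← h3]; field_simp
    rw [h4, div_eq_zero_iff]
    left
    simp only [Pi.mul_apply]
    field_simp
    ring
  obtain ⟨C, hC⟩ := (isOpen_compl_lattice L).exists_is_const_of_deriv_eq_zero
    (isPreconnected_compl_lattice L) (fun u hu => (hd u hu).differentiableAt.differentiableWithinAt)
    (fun u hu => (hd u hu).deriv)
  refine ⟨k, C, fun u hu => ?_⟩
  have h0 := sigma_ne_zero L hu
  rw [← hC u hu, Complex.exp_neg]
  field_simp

lemma dense_compl_lattice : Dense ((L.lattice : Set ℂ)ᶜ) :=
  (Set.countable_coe_iff.mp (inferInstanceAs (Countable L.lattice))).dense_compl ℝ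

lemma exists_sigma_add_eq {w : ℂ} (hw : w ∈ L.lattice) :
    ∃ k C : ℂ, C ≠ 0 ∧ ∀ u, sigma L (u + w) = C * Complex.exp (k * u) * sigma L u := by
  obtain ⟨k, C, h⟩ := exists_sigma_add_eq_of_notMem L hw
  have hc := (differentiable_sigma L).continuous
  have h' := Continuous.ext_on (dense_compl_lattice L)
    (f := fun u => sigma L (u + w)) (g := fun u => C * Complex.exp (k * u) * sigma L u)
    (by fun_prop) (by fun_prop) h
  refine ⟨k, C, ?_, fun u => congrFun h' u⟩
  rintro rfl
  have hm := L.ω₁_div_two_notMem_lattice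
  have := h _ hm
  rw [zero_mul, zero_mul] at this
  exact sigma_ne_zero L (add_notMem_lattice L hw hm) this

lemma sigma_eq_zero_of_mem {w : ℂ} (hw : w ∈ L.lattice) : sigma L w = 0 := by
  obtain ⟨k, C, -, h⟩ := exists_sigma_add_eq L hw
  simpa [sigma_zero] using h 0

/-- The zero at `0` is simple, and quasi-periodicity carries this to every lattice point. -/
lemma deriv_sigma_ne_zero {w : ℂ} (hw : w ∈ L.lattice) : deriv (sigma L) w ≠ 0 := by
  obtain ⟨k, C, hC, h⟩ := exists_sigma_add_eq L hw
  have h1 : HasDerivAt (fun u => sigma L (u + w)) (deriv (sigma L) w) 0 := by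
    have := (differentiable_sigma L (0 + w)).hasDerivAt.comp_add_const 0 w
    simpa using this
  have h2 : HasDerivAt (fun u => C * Complex.exp (k * u)) (C * (Complex.exp (k * 0) * k)) 0 := by
    have := (((hasDerivAt_id (0 : ℂ)).const_mul k).cexp).const_mul C
    simpa using this
  rw [funext h] at h1
  have := h1.unique (h2.mul (hasDerivAt_sigma_zero L))
  rw [this]
  simpa [sigma_zero] using hC

lemma deriv_sigma_neg (u : ℂ) : deriv (sigma L) (-u) = deriv (sigma L) u := by
  have h := (differentiable_sigma L (-u)).hasDerivAt.scomp u (hasDerivAt_neg u)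
  rw [show sigma L ∘ Neg.neg = fun u => sigma L (-u) from rfl] at h
  rw [funext (sigma_neg L)] at h
  have := h.unique (differentiable_sigma L u).hasDerivAt.neg
  simpa using this

open Classical in
-- The constant is found at `u = -w/2`, where oddness compares `σ(w/2)` with itself. If `w/2` is a
-- lattice point both values vanish and derivatives are compared instead; `σ'` is even, so the sign
-- changes from `-1` to `1`.
lemma exists_sigma_quasi {w : ℂ} (hw : w ∈ L.lattice) :
    ∃ k : ℂ, ∀ u, sigma L (u + w) = eps L w * Complex.exp (k * (u + w / 2)) * sigma L u := by
  obtain ⟨k, C, hC, h⟩ := exists_sigma_add_eq L hw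
  refine ⟨k, fun u => ?_⟩
  suffices hCe : C = eps L w * Complex.exp (k * (w / 2)) by
    rw [h, hCe, mul_add, Complex.exp_add]; ring
  have hexp : Complex.exp (k * (w / 2)) * Complex.exp (k * -(w / 2)) = 1 := by
    rw [← Complex.exp_add]; simp
  by_cases hw2 : w / 2 ∈ L.lattice
  · have he : eps L w = 1 := if_pos ⟨w / 2, hw2, by ring⟩
    have h1 : HasDerivAt (fun u => sigma L (u + w)) (deriv (sigma L) (w / 2)) (-(w / 2)) := by
      have := (differentiable_sigma L (-(w / 2) + w)).hasDerivAt.comp_add_const (-(w / 2)) w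
      rwa [show -(w / 2) + w = w / 2 by ring] at this
    have h2 : HasDerivAt (fun u => C * Complex.exp (k * u))
        (C * (Complex.exp (k * -(w / 2)) * k)) (-(w / 2)) := by
      have := (((hasDerivAt_id (-(w / 2))).const_mul k).cexp).const_mul C
      simpa using this
    rw [funext h] at h1
    have h3 := h1.unique (h2.mul (differentiable_sigma L (-(w / 2))).hasDerivAt)
    rw [sigma_neg, sigma_eq_zero_of_mem L hw2, deriv_sigma_neg, neg_zero, mul_zero, zero_add] at h3
    have h4 : C * Complex.exp (k * -(w / 2)) = 1 :=
      mul_right_cancel₀ (deriv_sigma_ne_zero L hw2) (by rw [← h3, one_mul])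
    rw [he]
    linear_combination Complex.exp (k * (w / 2)) * h4 - C * hexp
  · have he : eps L w = -1 := if_neg (by
      rintro ⟨l, hl, rfl⟩
      exact hw2 (by simpa using hl))
    have h3 := h (-(w / 2))
    rw [show -(w / 2) + w = w / 2 by ring, sigma_neg] at h3
    have h4 : C * Complex.exp (k * -(w / 2)) = -1 :=
      mul_right_cancel₀ (sigma_ne_zero L hw2) (by linear_combination h3)
    rw [he]
    linear_combination Complex.exp (k * (w / 2)) * h4 - C * hexp

/-! ### The bracket `[u]`: multipliers and simple zeros. -/

variable (g : ℂ)

lemma e_add (u v : ℂ) : e (u + v) = e u * e v := by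
  simp only [e, mul_add, Complex.exp_add]

lemma e_neg (u : ℂ) : e (-u) = (e u)⁻¹ := by simp only [e, mul_neg, Complex.exp_neg]

lemma e_ne_zero (u : ℂ) : e u ≠ 0 := Complex.exp_ne_zero _

lemma e_zero : e 0 = 1 := by simp [e]

lemma differentiable_e : Differentiable ℂ e := by unfold e; fun_prop

lemma eps_sq (w : ℂ) : eps L w * eps L w = 1 := by unfold eps; split_ifs <;> norm_num

lemma eps_ne_zero (w : ℂ) : eps L w ≠ 0 := by unfold eps; split_ifs <;> norm_num

/-- `eta` is a choice that means something only once a suitable number is known to exist; the proof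
supplies one. -/
lemma br_add {w : ℂ} (hw : w ∈ L.lattice) (u : ℂ) :
    br L g (u + w) = eps L w * e (eta L g w * (u + w / 2)) * br L g u := by
  have hex : ∃ h : ℂ, ∀ u : ℂ, br L g (u + w) = eps L w * e (h * (u + w / 2)) * br L g u := by
    obtain ⟨k, hk⟩ := exists_sigma_quasi L hw
    -- The first summand is the contribution of `e(g u²)`, by `(u + w)² = u² + 2w(u + w/2)`; the
    -- second rewrites `exp` in terms of `e`.
    refine ⟨2 * g * w + k / (2 * Real.pi * Complex.I), fun u => ?_⟩
    have h1 : Complex.exp (k * (u + w / 2)) = e (k / (2 * Real.pi * Complex.I) * (u + w / 2)) := by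
      unfold e
      congr 1
      have : (Real.pi : ℂ) ≠ 0 := by exact_mod_cast Real.pi_ne_zero
      field_simp [Complex.I_ne_zero]
    rw [br, br, hk, h1, add_mul, e_add, show g * (u + w) ^ 2 = g * u ^ 2 + 2 * g * w * (u + w / 2) by
      ring, e_add]
    ring
  exact Classical.epsilon_spec hex u

lemma br_neg (u : ℂ) : br L g (-u) = -br L g u := by
  rw [br, br, sigma_neg, neg_sq, mul_neg]

lemma br_zero : br L g 0 = 0 := by simp [br, sigma_zero]

lemma br_eq_zero_iff {u : ℂ} : br L g u = 0 ↔ u ∈ L.lattice := by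
  constructor
  · intro h
    by_contra hu
    exact mul_ne_zero (e_ne_zero _) (sigma_ne_zero L hu) h
  · intro h
    rw [br, sigma_eq_zero_of_mem L h, mul_zero]

lemma differentiable_br : Differentiable ℂ (br L g) := by
  unfold br
  exact (differentiable_e.comp (by fun_prop)).mul (differentiable_sigma L)

@[fun_prop]
lemma continuous_br : Continuous (br L g) := (differentiable_br L g).continuous

lemma hasDerivAt_br_zero : HasDerivAt (br L g) 1 0 := by
  have h1 : DifferentiableAt ℂ (fun u => e (g * u ^ 2)) 0 :=
    (differentiable_e.comp (by fun_prop)).differentiableAt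
  have := h1.hasDerivAt.mul (hasDerivAt_sigma_zero L)
  refine this.congr_deriv ?_
  simp [sigma_zero, e_zero]

lemma deriv_br_ne_zero {w : ℂ} (hw : w ∈ L.lattice) : deriv (br L g) w ≠ 0 := by
  have h1 : DifferentiableAt ℂ (fun u => e (g * u ^ 2)) w :=
    (differentiable_e.comp (by fun_prop)).differentiableAt
  have := h1.hasDerivAt.mul (differentiable_sigma L w).hasDerivAt
  have h2 : deriv (br L g) w = _ := this.deriv
  rw [h2, sigma_eq_zero_of_mem L hw, mul_zero, zero_add]
  exact mul_ne_zero (e_ne_zero _) (deriv_sigma_ne_zero L hw)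

end EllipticBC

/-! ### Simple poles, Liouville's theorem and the three-term relation. -/

namespace EllipticBC

/-- `f` has at worst a simple pole at `x`, with residue `ρ`. -/
def HasRes (f : ℂ → ℂ) (x ρ : ℂ) : Prop :=
  Tendsto (fun u => (u - x) * f u) (𝓝[≠] x) (𝓝 ρ)

namespace HasRes

variable {f φ : ℂ → ℂ} {x ρ τ : ℂ}

lemma add (hf : HasRes f x ρ) (hg : HasRes φ x τ) : HasRes (fun u => f u + φ u) x (ρ + τ) := by
  refine (Tendsto.add hf hg).congr fun u => ?_
  ring

lemma neg (hf : HasRes f x ρ) : HasRes (fun u => -f u) x (-ρ) := by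
  refine (Tendsto.neg hf).congr fun u => ?_
  ring

lemma sub (hf : HasRes f x ρ) (hg : HasRes φ x τ) : HasRes (fun u => f u - φ u) x (ρ - τ) := by
  simpa only [sub_eq_add_neg] using hf.add hg.neg

lemma mul_continuousAt (hf : HasRes f x ρ) (hφ : ContinuousAt φ x) :
    HasRes (fun u => f u * φ u) x (ρ * φ x) := by
  refine (Tendsto.mul hf (hφ.tendsto.mono_left nhdsWithin_le_nhds)).congr fun u => ?_
  ring

lemma of_continuousAt (hφ : ContinuousAt φ x) : HasRes φ x 0 := by
  have : Tendsto (fun u => (u - x) * φ u) (𝓝 x) (𝓝 ((x - x) * φ x)) :=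
    (tendsto_id.sub tendsto_const_nhds).mul hφ.tendsto
  rw [sub_self, zero_mul] at this
  exact this.mono_left nhdsWithin_le_nhds

lemma inv_of_hasDerivAt (hf : HasDerivAt f ρ x) (h0 : f x = 0) (hρ : ρ ≠ 0) :
    HasRes (fun u => (f u)⁻¹) x ρ⁻¹ := by
  have := (hasDerivAt_iff_tendsto_slope.mp hf).inv₀ hρ
  refine this.congr fun u => ?_
  simp [slope, h0, mul_comm]

lemma congr (hf : HasRes f x ρ) (h : ∀ u, f u = φ u) : HasRes φ x ρ :=
  (funext h : f = φ) ▸ hf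

lemma comp_add {w : ℂ} (hf : HasRes f x ρ) (hp : ∀ u, f (u + w) = f u) : HasRes f (x + w) ρ := by
  have h : Tendsto (fun u => u - w) (𝓝[≠] (x + w)) (𝓝[≠] x) := by
    refine tendsto_nhdsWithin_iff.mpr ⟨?_, ?_⟩
    · have : Tendsto (fun u => u - w) (𝓝 (x + w)) (𝓝 (x + w - w)) := tendsto_id.sub_const w
      rw [add_sub_cancel_right] at this
      exact this.mono_left nhdsWithin_le_nhds
    · filter_upwards [self_mem_nhdsWithin] with u hu h
      exact hu (by simpa [sub_eq_iff_eq_add] using h)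
  refine (Tendsto.comp hf h).congr fun u => ?_
  have := hp (u - w)
  rw [sub_add_cancel] at this
  simp only [Function.comp_apply, this]
  ring

lemma comp_neg (hf : HasRes f x ρ) (hp : ∀ u, f (-u) = f u) : HasRes f (-x) (-ρ) := by
  have h : Tendsto (fun u => -u) (𝓝[≠] (-x)) (𝓝[≠] x) := by
    refine tendsto_nhdsWithin_iff.mpr ⟨?_, ?_⟩
    · have : Tendsto (fun u => -u) (𝓝 (-x)) (𝓝 (- -x)) := tendsto_id.neg
      rw [neg_neg] at this
      exact this.mono_left nhdsWithin_le_nhds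
    · filter_upwards [self_mem_nhdsWithin] with u hu h
      exact hu (by simpa [neg_eq_iff_eq_neg] using h)
  refine (Tendsto.comp (Tendsto.neg hf) h).congr fun u => ?_
  simp only [Function.comp_apply, hp]
  ring

lemma unique (hf : HasRes f x ρ) (hg : HasRes f x τ) : ρ = τ := tendsto_nhds_unique hf hg

end HasRes

variable (L : PeriodPair)

lemma exists_add_mem_closedBall :
    ∃ R : ℝ, ∀ u : ℂ, ∃ w ∈ L.lattice, u + w ∈ Metric.closedBall (0 : ℂ) R := by
  obtain ⟨R, hR⟩ := (ZSpan.fundamentalDomain_isBounded L.basis).subset_closedBall 0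
  refine ⟨R, fun u => ⟨-(ZSpan.floor L.basis u : ℂ), ?_, ?_⟩⟩
  · rw [L.lattice_eq_span_range_basis]
    exact neg_mem (ZSpan.floor L.basis u).2
  · have := ZSpan.fract_mem_fundamentalDomain L.basis u
    rw [ZSpan.fract_apply] at this
    exact hR (by simpa [sub_eq_add_neg] using this)

/-- A meromorphic doubly periodic function all of whose singularities are removable is constant. -/
lemma exists_const_of_periodic {f : ℂ → ℂ} (hm : ∀ x, MeromorphicAt f x)
    (hp : ∀ w ∈ L.lattice, ∀ u, f (u + w) = f u) (hr : ∀ x, HasRes f x 0) :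
    ∃ c, ∀ x, ContinuousAt f x → f x = c := by
  have hmo : MeromorphicOn f Set.univ := fun x _ => hm x
  -- At a removable singularity the value of `f` is arbitrary. The normal form `F` has the correct
  -- values there, so it is entire, and Liouville's theorem applies to `F`.
  set F := toMeromorphicNFOn f Set.univ with hF
  have hne : ∀ x, f =ᶠ[𝓝[≠] x] F := fun x => (hmo.toMeromorphicNFOn_eq_self_on_nhdsNE (Set.mem_univ x)).symm
  have hord : ∀ x, 0 ≤ meromorphicOrderAt f x := fun x => by
    have h1 : MeromorphicAt (fun u : ℂ => u - x) x := by fun_prop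
    have h2 : meromorphicOrderAt (fun u : ℂ => u - x) x = 1 := by
      rw [show (1 : WithTop ℤ) = ((1 : ℤ) : WithTop ℤ) from rfl, meromorphicOrderAt_eq_int_iff h1]
      exact ⟨fun _ => 1, analyticAt_const, one_ne_zero, by simp⟩
    -- A vanishing residue says that `(u - x) f(u)` has positive order, so `f` has order greater
    -- than `-1`, hence at least `0`.
    have h3 := (tendsto_zero_iff_meromorphicOrderAt_pos (h1.mul (hm x))).mp (hr x)
    rw [meromorphicOrderAt_mul h1 (hm x), h2] at h3
    cases h4 : meromorphicOrderAt f x with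
    | top => exact le_top
    | coe n =>
      rw [h4] at h3
      have h5 : (0 : ℤ) < 1 + n := by exact_mod_cast h3
      have h6 : (0 : ℤ) ≤ n := by omega
      exact_mod_cast h6
  have han : ∀ x, AnalyticAt ℂ F x := fun x => by
    refine ((meromorphicNFOn_toMeromorphicNFOn f Set.univ
      (Set.mem_univ x)).meromorphicOrderAt_nonneg_iff_analyticAt).mp ?_
    rw [← meromorphicOrderAt_congr (hne x)]
    exact hord x
  have hd : Differentiable ℂ F := fun x => (han x).differentiableAt
  have hlim : ∀ x, Tendsto f (𝓝[≠] x) (𝓝 (F x)) := fun x =>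
    ((hd x).continuousAt.tendsto.mono_left nhdsWithin_le_nhds).congr' (hne x).symm
  have hper : ∀ w ∈ L.lattice, ∀ u, F (u + w) = F u := fun w hw u => by
    refine tendsto_nhds_unique ?_ (hlim u)
    have h : Tendsto (fun u => u + w) (𝓝[≠] u) (𝓝[≠] (u + w)) := by
      refine tendsto_nhdsWithin_iff.mpr ⟨?_, ?_⟩
      · have : Tendsto (fun u => u + w) (𝓝 u) (𝓝 (u + w)) := tendsto_id.add_const w
        exact this.mono_left nhdsWithin_le_nhds
      · filter_upwards [self_mem_nhdsWithin] with v hv h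
        exact hv (by simpa using h)
    exact ((hlim (u + w)).comp h).congr fun v => hp w hw v
  obtain ⟨R, hR⟩ := exists_add_mem_closedBall L
  have hb : Bornology.IsBounded (Set.range F) := by
    refine ((isCompact_closedBall (0 : ℂ) R).image hd.continuous).isBounded.subset ?_
    rintro _ ⟨u, rfl⟩
    obtain ⟨w, hw, hu⟩ := hR u
    exact ⟨u + w, hu, hper w hw u⟩
  obtain ⟨c, hc⟩ := hd.exists_const_forall_eq_of_bounded hb
  refine ⟨c, fun x hx => ?_⟩
  rw [← hc x]
  exact tendsto_nhds_unique (hx.tendsto.mono_left nhdsWithin_le_nhds) (hlim x)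

lemma countable_affine_mem_lattice {ι : Type*} [Countable ι] (p q : ι → ℂ) (hq : ∀ i, q i ≠ 0) :
    {t : ℂ | ∃ i, p i + q i * t ∈ L.lattice}.Countable := by
  rw [Set.ofPred_exists]
  refine Set.countable_iUnion fun i => ?_
  have hc : (L.lattice : Set ℂ).Countable :=
    Set.countable_coe_iff.mp (inferInstanceAs (Countable L.lattice))
  refine Set.Countable.preimage_of_injOn (f := fun t => p i + q i * t) hc ?_
  intro s _ t _ h
  simpa [hq i] using h

lemma dense_affine_notMem_lattice {ι : Type*} [Countable ι] (p q : ι → ℂ) (hq : ∀ i, q i ≠ 0) :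
    Dense {t : ℂ | ∀ i, p i + q i * t ∉ L.lattice} := by
  have := (countable_affine_mem_lattice L p q hq).dense_compl ℝ
  convert this using 1
  ext t
  simp

variable (g : ℂ)

lemma br_ne_zero {u : ℂ} (hu : u ∉ L.lattice) : br L g u ≠ 0 := fun h =>
  hu ((br_eq_zero_iff L g).mp h)

@[fun_prop]
lemma meromorphicAt_br_comp {φ : ℂ → ℂ} (hφ : Differentiable ℂ φ) (x : ℂ) :
    MeromorphicAt (fun u => br L g (φ u)) x :=
  (((differentiable_br L g).comp hφ).analyticAt x).meromorphicAt

lemma meromorphicAt_brpm_comp {φ ψ : ℂ → ℂ} (hφ : Differentiable ℂ φ) (hψ : Differentiable ℂ ψ)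
    (x : ℂ) : MeromorphicAt (fun u => brpm L g (φ u) (ψ u)) x :=
  (meromorphicAt_br_comp L g (hφ.add hψ) x).mul (meromorphicAt_br_comp L g (hφ.sub hψ) x)

lemma brpm_ne_zero {u v : ℂ} (h1 : u + v ∉ L.lattice) (h2 : u - v ∉ L.lattice) :
    brpm L g u v ≠ 0 := mul_ne_zero (br_ne_zero L g h1) (br_ne_zero L g h2)

lemma brpm_neg_left (u v : ℂ) : brpm L g (-u) v = brpm L g u v := by
  rw [brpm, brpm, show -u + v = -(u - v) by ring, show -u - v = -(u + v) by ring, br_neg, br_neg]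
  ring

lemma brpm_neg_right (u v : ℂ) : brpm L g u (-v) = brpm L g u v := by
  rw [brpm, brpm, sub_neg_eq_add, ← sub_eq_add_neg, mul_comm]

lemma brpm_swap (u v : ℂ) : brpm L g v u = -brpm L g u v := by
  rw [brpm, brpm, show v - u = -(u - v) by ring, br_neg, add_comm]
  ring

lemma brpm_self (u : ℂ) : brpm L g u u = 0 := by simp [brpm, br_zero]

lemma differentiable_brpm_left (v : ℂ) : Differentiable ℂ (fun u => brpm L g u v) :=
  ((differentiable_br L g).comp (by fun_prop)).mul ((differentiable_br L g).comp (by fun_prop))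

lemma brpm_add_left {w : ℂ} (hw : w ∈ L.lattice) (u v : ℂ) :
    brpm L g (u + w) v = e (2 * eta L g w * (u + w / 2)) * brpm L g u v := by
  rw [brpm, brpm, add_right_comm, add_sub_right_comm, br_add L g hw, br_add L g hw,
    show 2 * eta L g w * (u + w / 2) = eta L g w * (u + v + w / 2) + eta L g w * (u - v + w / 2) by
      ring, e_add]
  linear_combination (e (eta L g w * (u + v + w / 2)) * e (eta L g w * (u - v + w / 2)) *
    br L g (u + v) * br L g (u - v)) * eps_sq L w

lemma brpm_add_right {w : ℂ} (hw : w ∈ L.lattice) (u v : ℂ) :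
    brpm L g u (v + w) = e (2 * eta L g w * (v + w / 2)) * brpm L g u v := by
  rw [brpm_swap, brpm_add_left L g hw, brpm_swap L g u v]
  ring

/-- The quotient of `f` by `[u ± v]` is elliptic. The zeros of `[u ± v]` are the points of `±v + Ω`;
they are simple because `2v ∉ Ω`, and `f` vanishes at all of them. -/
lemma exists_eq_mul_brpm {f : ℂ → ℂ} (hf : Differentiable ℂ f)
    (hq : ∀ w ∈ L.lattice, ∀ u, f (u + w) = e (2 * eta L g w * (u + w / 2)) * f u)
    {v : ℂ} (hv : 2 * v ∉ L.lattice) (h1 : f v = 0) (h2 : f (-v) = 0) :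
    ∃ C, ∀ u, f u = C * brpm L g u v := by
  have hzero : ∀ u, brpm L g u v = 0 →
      (f u = 0 ∧ deriv (fun u => brpm L g u v) u ≠ 0) := by
    intro u hu
    have hd : HasDerivAt (fun u => brpm L g u v)
        (deriv (br L g) (u + v) * br L g (u - v) + br L g (u + v) * deriv (br L g) (u - v)) u :=
      ((differentiable_br L g (u + v)).hasDerivAt.comp_add_const u v).mul
        ((differentiable_br L g (u - v)).hasDerivAt.comp_sub_const u v)
    rw [hd.deriv]
    rcases mul_eq_zero.mp hu with h | h <;> rw [br_eq_zero_iff] at h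
    · refine ⟨?_, ?_⟩
      · have := hq _ h (-v)
        rwa [h2, mul_zero, show -v + (u + v) = u by ring] at this
      · rw [(br_eq_zero_iff L g).mpr h, zero_mul, add_zero]
        refine mul_ne_zero (deriv_br_ne_zero L g h) (br_ne_zero L g fun h' => hv ?_)
        have := L.lattice.sub_mem h h'
        rwa [show u + v - (u - v) = 2 * v by ring] at this
    · refine ⟨?_, ?_⟩
      · have := hq _ h v
        rwa [h1, mul_zero, show v + (u - v) = u by ring] at this
      · rw [(br_eq_zero_iff L g).mpr h, mul_zero, zero_add]
        refine mul_ne_zero (br_ne_zero L g fun h' => hv ?_) (deriv_br_ne_zero L g h)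
        have := L.lattice.sub_mem h' h
        rwa [show u + v - (u - v) = 2 * v by ring] at this
  have hdb := differentiable_brpm_left L g v
  obtain ⟨C, hC⟩ := exists_const_of_periodic L (f := fun u => (brpm L g u v)⁻¹ * f u)
    (fun x => ((hdb.analyticAt x).meromorphicAt.inv).mul (hf.analyticAt x).meromorphicAt)
    (fun w hw u => by
      rw [hq w hw, brpm_add_left L g hw, mul_inv]
      rw [mul_mul_mul_comm, inv_mul_cancel₀ (e_ne_zero _), one_mul])
    (fun x => by
      by_cases hx : brpm L g x v = 0
      · have h := (HasRes.inv_of_hasDerivAt (hdb x).hasDerivAt hx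
          (hzero x hx).2).mul_continuousAt (hf x).continuousAt
        rwa [(hzero x hx).1, mul_zero] at h
      · exact HasRes.of_continuousAt (((hdb x).continuousAt.inv₀ hx).mul (hf x).continuousAt))
  refine ⟨C, fun u => ?_⟩
  by_cases hu : brpm L g u v = 0
  · rw [(hzero u hu).1, hu, mul_zero]
  · rw [← hC u (((hdb u).continuousAt.inv₀ hu).mul (hf u).continuousAt)]
    field_simp

/-- The three-term relation. -/
theorem brpm_three_term (x y u v : ℂ) :
    brpm L g x y * brpm L g u v + brpm L g x u * brpm L g v y + brpm L g x v * brpm L g y u = 0 := by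
  -- When `2v`, `u + v` and `u - v` avoid the lattice, the left side as a function of `x` is a
  -- multiple of `[x ± v]` which vanishes at `x = u`. The other `v` are limits of such.
  have hdense := dense_affine_notMem_lattice L (ι := Fin 3) ![0, u, u] ![2, 1, -1]
    (by intro i; fin_cases i <;> simp)
  have key : ∀ v ∈ {t : ℂ | ∀ i, ![0, u, u] i + ![2, 1, -1] i * t ∉ L.lattice},
      brpm L g x y * brpm L g u v + brpm L g x u * brpm L g v y + brpm L g x v * brpm L g y u
        = (fun _ => (0 : ℂ)) v := by
    intro v hv
    have h0 : 2 * v ∉ L.lattice := by simpa using hv 0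
    have h1 : u + v ∉ L.lattice := by simpa using hv 1
    have h2 : u - v ∉ L.lattice := by simpa [sub_eq_add_neg] using hv 2
    obtain ⟨C, hC⟩ := exists_eq_mul_brpm L g (v := v)
      (f := fun x => brpm L g x y * brpm L g u v + brpm L g x u * brpm L g v y +
        brpm L g x v * brpm L g y u)
      ((((differentiable_brpm_left L g y).mul_const _).add
        ((differentiable_brpm_left L g u).mul_const _)).add
        ((differentiable_brpm_left L g v).mul_const _))
      (fun w hw x => by
        simp only [brpm_add_left L g hw]
        ring) h0
      (by
        simp only [brpm_self]
        rw [brpm_swap L g u v]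
        ring)
      (by
        simp only [brpm_neg_left, brpm_self]
        rw [brpm_swap L g u v]
        ring)
    have h3 := hC u
    have h4 : C = 0 := by
      have : C * brpm L g u v = 0 := by
        rw [← h3, brpm_self, brpm_swap L g u y]
        ring
      exact (mul_eq_zero.mp this).resolve_right (brpm_ne_zero L g h1 h2)
    simpa [h4] using hC x
  have := Continuous.ext_on hdense (by unfold brpm; fun_prop) continuous_const key
  exact congrFun this v

end EllipticBC

/-! ### Half-periods, and multipliers and symmetries of `A⁺`, `A⁻`, `A⁰`. -/

namespace EllipticBC

variable (L : PeriodPair) (g δ : ℂ)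

lemma notMem_of_eq_add {u v w : ℂ} (hv : v ∉ L.lattice) (hw : w ∈ L.lattice) (h : u = v + w) :
    u ∉ L.lattice := h ▸ add_notMem_lattice L hw hv

lemma notMem_of_two_mul {u v w : ℂ} (hv : v ∉ L.lattice) (hw : w ∈ L.lattice) (h : 2 * u = v + w) :
    u ∉ L.lattice := fun hu => by
  refine notMem_of_eq_add L hv hw h ?_
  rw [two_mul]
  exact add_mem hu hu

lemma om_mem (r : Fin 4) : om L r ∈ L.lattice := by
  fin_cases r
  · exact zero_mem _
  · exact L.ω₁_mem_lattice
  · exact L.ω₂_mem_lattice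
  · exact sub_mem (neg_mem L.ω₁_mem_lattice) L.ω₂_mem_lattice

/-- The four `ω_r` represent `Ω / 2Ω`. Hence the solutions of `2x + δ ∈ Ω` are, modulo `Ω`, the four
points `(ω_r - δ)/2`. -/
lemma exists_om_add_two_mul {w : ℂ} (hw : w ∈ L.lattice) :
    ∃ r, ∃ l ∈ L.lattice, w = om L r + 2 * l := by
  obtain ⟨m, n, rfl⟩ := PeriodPair.mem_lattice.mp hw
  have hmem : ∀ a b : ℤ, (a : ℂ) * L.ω₁ + b * L.ω₂ ∈ L.lattice := fun a b =>
    PeriodPair.mem_lattice.mpr ⟨a, b, rfl⟩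
  rcases Int.even_or_odd' m with ⟨a, rfl | rfl⟩ <;> rcases Int.even_or_odd' n with ⟨b, rfl | rfl⟩
  · exact ⟨0, _, hmem a b, by simp [om]; ring⟩
  · exact ⟨2, _, hmem a b, by simp [om]; ring⟩
  · exact ⟨1, _, hmem a b, by simp [om]; ring⟩
  · exact ⟨3, _, hmem (a + 1) (b + 1), by simp [om]; ring⟩

/-- The `ω_r` are inequivalent modulo `2Ω`, so at `(ω_r - δ)/2` only the term of index `r` in `A⁰`
can have a pole. -/
lemma half_om_sub_notMem {r s : Fin 4} (h : r ≠ s) : (om L r - om L s) / 2 ∉ L.lattice := by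
  have key : ∀ p q : ℤ, (p % 2 ≠ 0 ∨ q % 2 ≠ 0) → (p * L.ω₁ + q * L.ω₂) / 2 ∉ L.lattice := by
    intro p q hpq hm
    have h1 := (L.mul_ω₁_add_mul_ω₂_mem_lattice (α := p / 2) (β := q / 2)).mp (by
      convert hm using 1; push_cast; ring)
    have aux : ∀ t : ℤ, ((t : ℚ) / 2).den = 1 → t % 2 = 0 := by
      intro t ht
      have h2 := (Rat.den_eq_one_iff _).mp ht
      have h3 : (t : ℚ) = 2 * ((t : ℚ) / 2).num := by rw [h2]; ring
      have h4 : t = 2 * ((t : ℚ) / 2).num := by exact_mod_cast h3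
      omega
    rcases hpq with hp | hq
    · exact hp (aux _ h1.1)
    · exact hq (aux _ h1.2)
  have hom : ∀ r : Fin 4, om L r = ((![0, 1, 0, -1] r : ℤ) : ℂ) * L.ω₁ +
      ((![0, 0, 1, -1] r : ℤ) : ℂ) * L.ω₂ := by
    intro r
    fin_cases r <;> simp [om]
    ring
  rw [hom, hom]
  have := key (![0, 1, 0, -1] r - ![0, 1, 0, -1] s) (![0, 0, 1, -1] r - ![0, 0, 1, -1] s)
    (by revert h; revert r s; decide)
  convert this using 2
  push_cast
  ring

lemma br_add_two_mul {w : ℂ} (hw : w ∈ L.lattice) (u : ℂ) :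
    br L g (u + 2 * w) = e (2 * eta L g w * (u + w)) * br L g u := by
  rw [show u + 2 * w = u + w + w by ring, br_add L g hw, br_add L g hw,
    show 2 * eta L g w * (u + w) = eta L g w * (u + w + w / 2) + eta L g w * (u + w / 2) by ring,
    e_add]
  linear_combination (e (eta L g w * (u + w + w / 2)) * e (eta L g w * (u + w / 2)) *
    br L g u) * eps_sq L w

lemma prod_e {ι : Type*} (s : Finset ι) (f : ι → ℂ) : ∏ i ∈ s, e (f i) = e (∑ i ∈ s, f i) := by
  classical
  induction s using Finset.induction_on with
  | empty => simp [e_zero]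
  | insert i s hi ih => rw [Finset.prod_insert hi, Finset.sum_insert hi, ih, e_add]

lemma prod_br_add {w : ℂ} (hw : w ∈ L.lattice) (u : Fin 8 → ℂ) :
    ∏ p, br L g (u p + w) = e (eta L g w * (∑ p, u p + 4 * w)) * ∏ p, br L g (u p) := by
  simp only [br_add L g hw, Finset.prod_mul_distrib, Finset.prod_const, Finset.card_univ,
    Fintype.card_fin, prod_e]
  rw [show eps L w ^ 8 = 1 by
    rw [show eps L w ^ 8 = (eps L w * eps L w) ^ 4 by ring, eps_sq, one_pow], one_mul]
  congr 2
  rw [← Finset.mul_sum, Finset.sum_add_distrib]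
  simp only [Finset.sum_const, Finset.card_univ, Fintype.card_fin, nsmul_eq_mul]
  push_cast
  ring

lemma deriv_br_of_mem {w : ℂ} (hw : w ∈ L.lattice) :
    HasDerivAt (br L g) (eps L w * e (eta L g w * (w / 2))) w := by
  have h1 := (differentiable_br L g (0 + w)).hasDerivAt.comp_add_const 0 w
  rw [zero_add, funext (br_add L g hw)] at h1
  have h2 : DifferentiableAt ℂ (fun u => eps L w * e (eta L g w * (u + w / 2))) 0 :=
    ((differentiable_e.comp (by fun_prop)).const_mul _).differentiableAt
  have h3 := h1.unique (h2.hasDerivAt.mul (hasDerivAt_br_zero L g))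
  rw [br_zero, mul_zero, zero_add, mul_one, zero_add] at h3
  rw [← h3]
  exact (differentiable_br L g w).hasDerivAt

variable (a b : Fin 8 → ℂ) (c : Fin 4 → ℂ)

/-- The numerator contributes `η(8x + 4δ + 4w)`, by the balancing condition, and the denominator
`η(8x + 2δ + 4w)`. The remaining `2ηδ` is what `brpm_ratio_add` cancels. -/
lemma Aplus_add {w : ℂ} (hw : w ∈ L.lattice) (ha : ∑ p, a p = 4 * δ) (x : ℂ) :
    Aplus L g δ a (x + w) = e (2 * eta L g w * δ) * Aplus L g δ a x := by
  unfold Aplus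
  have h1 := prod_br_add L g hw (fun p => x + a p)
  simp only [Finset.sum_add_distrib, ha, Finset.sum_const, Finset.card_univ, Fintype.card_fin,
    nsmul_eq_mul] at h1
  rw [show 2 * (x + w) = 2 * x + 2 * w by ring, add_right_comm (2 * x), br_add_two_mul L g hw,
    br_add_two_mul L g hw]
  simp only [add_right_comm x w] at *
  rw [h1, show eta L g w * (((8 : ℕ) : ℂ) * x + 4 * δ + 4 * w) = 2 * eta L g w * δ +
    (2 * eta L g w * (2 * x + w) + 2 * eta L g w * (2 * x + δ + w)) by push_cast; ring, e_add, e_add]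
  have e1 := e_ne_zero (2 * eta L g w * (2 * x + w))
  have e2 := e_ne_zero (2 * eta L g w * (2 * x + δ + w))
  generalize e (2 * eta L g w * (2 * x + w)) = E1 at *
  generalize e (2 * eta L g w * (2 * x + δ + w)) = E2 at *
  rw [mul_mul_mul_comm E1, mul_assoc, mul_assoc, mul_left_comm,
    mul_div_mul_left _ _ (mul_ne_zero e1 e2), mul_div_assoc]

lemma Aminus_neg (x : ℂ) : Aminus L g δ a (-x) = Aplus L g δ a x := by
  unfold Aplus Aminus
  have : ∀ p, br L g (-x - a p) = -br L g (x + a p) := fun p => by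
    rw [← br_neg]; congr 1; ring
  simp only [this]
  rw [Finset.prod_neg, show 2 * -x - δ = -(2 * x + δ) by ring, show 2 * -x = -(2 * x) by ring,
    br_neg, br_neg, neg_mul_neg]
  simp [show (-1 : ℂ) ^ 8 = 1 by norm_num]

lemma Aplus_neg (x : ℂ) : Aplus L g δ a (-x) = Aminus L g δ a x := by
  rw [← Aminus_neg, neg_neg]

lemma Aminus_add {w : ℂ} (hw : w ∈ L.lattice) (ha : ∑ p, a p = 4 * δ) (x : ℂ) :
    Aminus L g δ a (x + w) = e (-(2 * eta L g w * δ)) * Aminus L g δ a x := by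
  have h := Aplus_add L g δ a hw ha (-(x + w))
  rw [show -(x + w) + w = -x by ring, Aplus_neg, Aplus_neg] at h
  rw [h, ← mul_assoc, ← e_add]
  simp [e_zero]

lemma brpm_ratio_add {w : ℂ} (hw : w ∈ L.lattice) (x y : ℂ) :
    brpm L g (x + w) y / brpm L g (x + w + δ) y =
      e (-(2 * eta L g w * δ)) * (brpm L g x y / brpm L g (x + δ) y) := by
  rw [add_right_comm, brpm_add_left L g hw, brpm_add_left L g hw,
    show 2 * eta L g w * (x + δ + w / 2) = 2 * eta L g w * δ + 2 * eta L g w * (x + w / 2) by ring,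
    e_add, e_neg]
  have := e_ne_zero (2 * eta L g w * (x + w / 2))
  generalize e (2 * eta L g w * (x + w / 2)) = E at *
  rw [show e (2 * eta L g w * δ) * E * brpm L g (x + δ) y =
    E * (e (2 * eta L g w * δ) * brpm L g (x + δ) y) by ring, mul_div_mul_left _ _ this]
  ring

lemma brpm_ratio_sub {w : ℂ} (hw : w ∈ L.lattice) (x y : ℂ) :
    brpm L g (x + w) y / brpm L g (x + w - δ) y =
      e (2 * eta L g w * δ) * (brpm L g x y / brpm L g (x - δ) y) := by
  have := brpm_ratio_add L g (-δ) hw x y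
  simpa [sub_eq_add_neg] using this

lemma brpm_ratio_right {w : ℂ} (hw : w ∈ L.lattice) (y z x : ℂ) :
    brpm L g y (x + w) / brpm L g z (x + w) = brpm L g y x / brpm L g z x := by
  rw [brpm_add_right L g hw, brpm_add_right L g hw, mul_div_mul_left _ _ (e_ne_zero _)]

lemma AzeroTerm_add {w : ℂ} (hw : w ∈ L.lattice) (r : Fin 4) (d x : ℂ) :
    AzeroTerm L g δ r a d (x + w) = AzeroTerm L g δ r a d x := by
  unfold AzeroTerm
  rw [brpm_add_left L g hw, brpm_add_right L g hw]
  have := e_ne_zero (2 * eta L g w * (x + w / 2))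
  generalize e (2 * eta L g w * (x + w / 2)) = E at *
  rw [show ∀ A B C D F G : ℂ, A * B * (E * C * D) / (2 * (E * F) * G) =
    (E * (A * B * (C * D))) / (E * (2 * F * G)) from fun _ _ _ _ _ _ => by ring_nf]
  rw [mul_div_mul_left _ _ this]

lemma AzeroTerm_neg (r : Fin 4) (d x : ℂ) :
    AzeroTerm L g δ r a d (-x) = AzeroTerm L g δ r a d x := by
  unfold AzeroTerm
  rw [brpm_neg_left, brpm_neg_right]

lemma Azero_add {w : ℂ} (hw : w ∈ L.lattice) (x : ℂ) :
    Azero L g δ a c (x + w) = Azero L g δ a c x := by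
  simp only [Azero, AzeroTerm_add L g δ a hw]

lemma Azero_neg (x : ℂ) : Azero L g δ a c (-x) = Azero L g δ a c x := by
  simp only [Azero, AzeroTerm_neg L g δ a]

/-- Passing from `a` to `b` reflects the point `(ω_r - δ)/2 + a_p` to its negative translated by
`ω_r`. Over eight factors the signs cancel, and by the balancing condition so do the exponents. -/
lemma AzeroTerm_dual (ha : ∑ p, a p = 4 * δ) (hb : ∀ p, b p = δ - a p) (r : Fin 4) (d x : ℂ) :
    AzeroTerm L g δ r b d x = AzeroTerm L g δ r a d x := by
  unfold AzeroTerm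
  have hsum : ∑ p, b p = 4 * δ := by
    simp only [hb, Finset.sum_sub_distrib, ha]
    simp
    ring
  have h : ∏ p, br L g ((om L r - δ) / 2 + b p) = ∏ p, br L g ((om L r - δ) / 2 + a p) := by
    have h1 := prod_br_add L g (om_mem L r) (fun p => -((om L r - δ) / 2 + a p))
    have h2 : ∀ p, -((om L r - δ) / 2 + a p) + om L r = (om L r - δ) / 2 + b p := fun p => by
      rw [hb]; ring
    simp only [h2, br_neg, Finset.prod_neg, Finset.sum_neg_distrib, Finset.sum_add_distrib, ha,
      Finset.sum_const, Finset.card_univ, Fintype.card_fin, nsmul_eq_mul] at h1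
    rw [h1]
    rw [show -(((8 : ℕ) : ℂ) * ((om L r - δ) / 2) + 4 * δ) + 4 * om L r = 0 by push_cast; ring]
    simp [e_zero, show (-1 : ℂ) ^ 8 = 1 by norm_num]
  rw [hsum, ha, h]

lemma Azero_dual (ha : ∑ p, a p = 4 * δ) (hb : ∀ p, b p = δ - a p) (x : ℂ) :
    Azero L g δ b c x = Azero L g δ a c x := by
  simp only [Azero, AzeroTerm_dual L g δ a b ha hb]

/-- The one-variable difference operator applied to `1 / [x ± y]`, times `[x ± y]`. -/
noncomputable def kernelSum (x y : ℂ) : ℂ :=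
  Aplus L g δ a x * (brpm L g x y / brpm L g (x + δ) y) +
    Aminus L g δ a x * (brpm L g x y / brpm L g (x - δ) y) + Azero L g δ a c x

lemma kernelSum_add_left {w : ℂ} (hw : w ∈ L.lattice) (ha : ∑ p, a p = 4 * δ) (x y : ℂ) :
    kernelSum L g δ a c (x + w) y = kernelSum L g δ a c x y := by
  unfold kernelSum
  rw [Aplus_add L g δ a hw ha, Aminus_add L g δ a hw ha, brpm_ratio_add L g δ hw,
    brpm_ratio_sub L g δ hw, Azero_add L g δ a c hw, mul_mul_mul_comm,
    mul_mul_mul_comm (e (-(2 * eta L g w * δ))), ← e_add, ← e_add, add_neg_cancel, neg_add_cancel,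
    e_zero, one_mul, one_mul]

lemma kernelSum_add_right {w : ℂ} (hw : w ∈ L.lattice) (x y : ℂ) :
    kernelSum L g δ a c x (y + w) = kernelSum L g δ a c x y := by
  simp only [kernelSum, brpm_ratio_right L g hw]

lemma kernelSum_neg_left (x y : ℂ) :
    kernelSum L g δ a c (-x) y = kernelSum L g δ a c x y := by
  unfold kernelSum
  rw [Aplus_neg, Aminus_neg, Azero_neg, brpm_neg_left, show -x + δ = -(x - δ) by ring,
    show -x - δ = -(x + δ) by ring, brpm_neg_left, brpm_neg_left]
  ring

lemma kernelSum_neg_right (x y : ℂ) :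
    kernelSum L g δ a c x (-y) = kernelSum L g δ a c x y := by
  simp only [kernelSum, brpm_neg_right]

end EllipticBC

/-! ### The kernel identity, by cancellation of residues. -/

namespace EllipticBC

variable (L : PeriodPair) (g δ : ℂ)

lemma continuous_brpm {φ ψ : ℂ → ℂ} (hφ : Continuous φ) (hψ : Continuous ψ) :
    Continuous (fun u => brpm L g (φ u) (ψ u)) := by unfold brpm; fun_prop

variable (a b : Fin 8 → ℂ) (c : Fin 4 → ℂ)

lemma continuousAt_Aplus {x : ℂ} (h1 : 2 * x ∉ L.lattice) (h2 : 2 * x + δ ∉ L.lattice) :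
    ContinuousAt (Aplus L g δ a) x := by
  unfold Aplus
  exact ContinuousAt.div (by fun_prop) (by fun_prop)
    (mul_ne_zero (br_ne_zero L g h1) (br_ne_zero L g h2))

lemma continuousAt_Aminus {x : ℂ} (h1 : 2 * x ∉ L.lattice) (h2 : 2 * x - δ ∉ L.lattice) :
    ContinuousAt (Aminus L g δ a) x := by
  unfold Aminus
  exact ContinuousAt.div (by fun_prop) (by fun_prop)
    (mul_ne_zero (br_ne_zero L g h1) (br_ne_zero L g h2))

lemma continuousAt_AzeroTerm {r : Fin 4} {d : ℂ} (hd : brpm L g ((om L r - δ) / 2) d ≠ 0) {x : ℂ}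
    (h1 : (om L r - δ) / 2 + x ∉ L.lattice) (h2 : (om L r - δ) / 2 - x ∉ L.lattice) :
    ContinuousAt (AzeroTerm L g δ r a d) x := by
  unfold AzeroTerm
  have hA : Continuous fun x => brpm L g x d := continuous_brpm L g continuous_id continuous_const
  have hB : Continuous fun x => brpm L g ((om L r - δ) / 2) x :=
    continuous_brpm L g continuous_const continuous_id
  exact ContinuousAt.div (by fun_prop) (by fun_prop)
    (mul_ne_zero (mul_ne_zero two_ne_zero (brpm_ne_zero L g h1 h2)) hd)

lemma continuousAt_ratio_add {d x y : ℂ} (h1 : x + d + y ∉ L.lattice)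
    (h2 : x + d - y ∉ L.lattice) :
    ContinuousAt (fun u => brpm L g u y / brpm L g (u + d) y) x := by
  have hA : Continuous fun u => brpm L g u y := continuous_brpm L g continuous_id continuous_const
  have hB : Continuous fun u => brpm L g (u + d) y :=
    continuous_brpm L g (by fun_prop) continuous_const
  exact ContinuousAt.div hA.continuousAt hB.continuousAt (brpm_ne_zero L g h1 h2)

lemma continuousAt_ratio_sub {d x y : ℂ} (h1 : x - d + y ∉ L.lattice)
    (h2 : x - d - y ∉ L.lattice) :
    ContinuousAt (fun u => brpm L g u y / brpm L g (u - d) y) x := by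
  have hA : Continuous fun u => brpm L g u y := continuous_brpm L g continuous_id continuous_const
  have hB : Continuous fun u => brpm L g (u - d) y :=
    continuous_brpm L g (by fun_prop) continuous_const
  exact ContinuousAt.div hA.continuousAt hB.continuousAt (brpm_ne_zero L g h1 h2)

lemma continuousAt_ratio_right {x y z : ℂ} (h1 : z + x ∉ L.lattice)
    (h2 : z - x ∉ L.lattice) :
    ContinuousAt (fun u => brpm L g y u / brpm L g z u) x := by
  have hA : ∀ z, Continuous fun u => brpm L g z u := fun z =>
    continuous_brpm L g continuous_const continuous_id
  exact ContinuousAt.div (hA y).continuousAt (hA z).continuousAt (brpm_ne_zero L g h1 h2)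

lemma continuousAt_Azero (hc : ∀ r, brpm L g ((om L r - δ) / 2) (c r) ≠ 0) {x : ℂ}
    (h1 : 2 * x + δ ∉ L.lattice) (h2 : 2 * x - δ ∉ L.lattice) :
    ContinuousAt (Azero L g δ a c) x := by
  unfold Azero
  refine tendsto_finsetSum _ fun r _ => (continuousAt_AzeroTerm L g δ a (hc r) ?_ ?_).tendsto
  · exact notMem_of_two_mul L h2 (om_mem L r) (by ring)
  · refine notMem_of_two_mul L (v := -(2 * x + δ)) (fun h => h1 ?_) (om_mem L r) (by ring)
    simpa using neg_mem h

lemma meromorphicAt_Aplus (x : ℂ) : MeromorphicAt (Aplus L g δ a) x := by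
  unfold Aplus
  refine MeromorphicAt.div ?_ ?_
  · exact MeromorphicAt.fun_prod fun p _ => meromorphicAt_br_comp L g (by fun_prop) x
  · exact (meromorphicAt_br_comp L g (by fun_prop) x).mul
      (meromorphicAt_br_comp L g (by fun_prop) x)

lemma meromorphicAt_Aminus (x : ℂ) : MeromorphicAt (Aminus L g δ a) x := by
  unfold Aminus
  refine MeromorphicAt.div ?_ ?_
  · exact MeromorphicAt.fun_prod fun p _ => meromorphicAt_br_comp L g (by fun_prop) x
  · exact (meromorphicAt_br_comp L g (by fun_prop) x).mul
      (meromorphicAt_br_comp L g (by fun_prop) x)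

lemma meromorphicAt_Azero (x : ℂ) : MeromorphicAt (Azero L g δ a c) x := by
  unfold Azero
  refine MeromorphicAt.fun_sum fun r _ => ?_
  unfold AzeroTerm
  refine MeromorphicAt.div ?_ ?_
  · exact (MeromorphicAt.const _ x).mul
      ((meromorphicAt_brpm_comp L g (by fun_prop) (by fun_prop) x).mul (MeromorphicAt.const _ x))
  · exact ((MeromorphicAt.const _ x).mul
      (meromorphicAt_brpm_comp L g (by fun_prop) (by fun_prop) x)).mul (MeromorphicAt.const _ x)

/-- The difference of the two sides of the kernel identity. -/
noncomputable def kernelDiff (y x : ℂ) : ℂ :=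
  kernelSum L g δ a c x y - kernelSum L g δ b c y x

lemma meromorphicAt_kernelDiff (y x : ℂ) : MeromorphicAt (kernelDiff L g δ a b c y) x := by
  unfold kernelDiff kernelSum
  have h1 := meromorphicAt_Aplus L g δ a x
  have h2 := meromorphicAt_Aminus L g δ a x
  have h3 := meromorphicAt_Azero L g δ a c x
  have hb : ∀ z : ℂ, MeromorphicAt (fun x => brpm L g (x + z) y) x := fun z =>
    meromorphicAt_brpm_comp L g (by fun_prop) (by fun_prop) x
  have hb' : ∀ z : ℂ, MeromorphicAt (fun x => brpm L g z x) x := fun z =>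
    meromorphicAt_brpm_comp L g (by fun_prop) (by fun_prop) x
  have hb0 : MeromorphicAt (fun x => brpm L g x y) x :=
    meromorphicAt_brpm_comp L g (by fun_prop) (by fun_prop) x
  refine MeromorphicAt.sub (((h1.mul (hb0.div (hb δ))).add (h2.mul (hb0.div ?_))).add h3) ?_
  · simpa [sub_eq_add_neg] using hb (-δ)
  · exact (((MeromorphicAt.const _ x).mul ((hb' y).div (hb' _))).add
      ((MeromorphicAt.const _ x).mul ((hb' y).div (hb' _)))).add (MeromorphicAt.const _ x)

lemma kernelDiff_neg_left (y x : ℂ) :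
    kernelDiff L g δ a b c (-y) x = kernelDiff L g δ a b c y x := by
  unfold kernelDiff
  rw [kernelSum_neg_left, kernelSum_neg_right]

lemma kernelDiff_neg_right (y x : ℂ) :
    kernelDiff L g δ a b c y (-x) = kernelDiff L g δ a b c y x := by
  unfold kernelDiff
  rw [kernelSum_neg_left, kernelSum_neg_right]

lemma kernelDiff_add {w : ℂ} (hw : w ∈ L.lattice) (ha : ∑ p, a p = 4 * δ) (y x : ℂ) :
    kernelDiff L g δ a b c y (x + w) = kernelDiff L g δ a b c y x := by
  unfold kernelDiff
  rw [kernelSum_add_left L g δ a c hw ha, kernelSum_add_right L g δ b c hw]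

section residues

variable {L g δ a b c}
variable (hδ : ∀ k : ℤ, k ≠ 0 → (k : ℂ) * δ ∉ L.lattice)
variable (hc : ∀ r, brpm L g ((om L r - δ) / 2) (c r) ≠ 0)
variable {y : ℂ} (hy : ∀ k : ℤ, 2 * y + k * δ ∉ L.lattice)

lemma continuousAt_kernelSum_right {x : ℂ} (h1 : x + δ + y ∉ L.lattice) (h2 : x + δ - y ∉ L.lattice)
    (h3 : x - δ + y ∉ L.lattice) (h4 : x - δ - y ∉ L.lattice) :
    ContinuousAt (fun x => kernelSum L g δ b c y x) x := by
  unfold kernelSum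
  have hn : ∀ {u v : ℂ}, u ∉ L.lattice → v = -u → v ∉ L.lattice := fun hu hv h => hu (by
    rw [hv] at h; simpa using neg_mem h)
  refine ((ContinuousAt.mul continuousAt_const ?_).add (ContinuousAt.mul continuousAt_const ?_)).add
    continuousAt_const
  · exact continuousAt_ratio_right L g (by rwa [show y + δ + x = x + δ + y by ring])
      (hn h4 (by ring))
  · exact continuousAt_ratio_right L g (by rwa [show y - δ + x = x - δ + y by ring])
      (hn h2 (by ring))

lemma continuousAt_Aplus_ratio {x : ℂ} (h1 : 2 * x ∉ L.lattice) (h2 : 2 * x + δ ∉ L.lattice)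
    (h3 : x + δ + y ∉ L.lattice) (h4 : x + δ - y ∉ L.lattice) :
    ContinuousAt (fun x => Aplus L g δ a x * (brpm L g x y / brpm L g (x + δ) y)) x :=
  (continuousAt_Aplus L g δ a h1 h2).mul (continuousAt_ratio_add L g h3 h4)

lemma continuousAt_Aminus_ratio {x : ℂ} (h1 : 2 * x ∉ L.lattice) (h2 : 2 * x - δ ∉ L.lattice)
    (h3 : x - δ + y ∉ L.lattice) (h4 : x - δ - y ∉ L.lattice) :
    ContinuousAt (fun x => Aminus L g δ a x * (brpm L g x y / brpm L g (x - δ) y)) x :=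
  (continuousAt_Aminus L g δ a h1 h2).mul (continuousAt_ratio_sub L g h3 h4)

include hc in
lemma continuousAt_kernelSum_left {x : ℂ} (h : 2 * x ∉ L.lattice) (hp : 2 * x + δ ∉ L.lattice)
    (hm : 2 * x - δ ∉ L.lattice) (h1 : x + δ + y ∉ L.lattice) (h2 : x + δ - y ∉ L.lattice)
    (h3 : x - δ + y ∉ L.lattice) (h4 : x - δ - y ∉ L.lattice) :
    ContinuousAt (fun x => kernelSum L g δ a c x y) x :=
  ((continuousAt_Aplus_ratio h hp h1 h2).add (continuousAt_Aminus_ratio h hm h3 h4)).add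
    (continuousAt_Azero L g δ a c hc hp hm)

include hδ hc hy in
-- No residue has to be computed here: the function is even and periodic, hence invariant under `u ↦
-- 2x - u`, which fixes `x` and reverses the sign of the residue.
lemma hasRes_kernelDiff_of_two_mul_mem (ha : ∑ p, a p = 4 * δ) {x : ℂ} (hx : 2 * x ∈ L.lattice) :
    HasRes (kernelDiff L g δ a b c y) x 0 := by
  have hp : 2 * x + δ ∉ L.lattice := notMem_of_eq_add L (hδ 1 one_ne_zero) hx (by push_cast; ring)
  have hm : 2 * x - δ ∉ L.lattice :=
    notMem_of_eq_add L (hδ (-1) (by norm_num)) hx (by push_cast; ring)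
  have hny : ∀ k : ℤ, -(2 * y) + k * δ ∉ L.lattice := fun k h => hy (-k) (by
    have := neg_mem h
    convert this using 1
    push_cast; ring)
  have h1 : x + δ + y ∉ L.lattice := notMem_of_two_mul L (hy 2) hx (by push_cast; ring)
  have h2 : x + δ - y ∉ L.lattice := notMem_of_two_mul L (hny 2) hx (by push_cast; ring)
  have h3 : x - δ + y ∉ L.lattice := notMem_of_two_mul L (hy (-2)) hx (by push_cast; ring)
  have h4 : x - δ - y ∉ L.lattice := notMem_of_two_mul L (hny (-2)) hx (by push_cast; ring)
  have hd : HasDerivAt (fun u => br L g (2 * u)) (2 * deriv (br L g) (2 * x)) x := by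
    have := (differentiable_br L g (2 * x)).hasDerivAt.comp x ((hasDerivAt_id x).const_mul 2)
    refine this.congr_deriv ?_
    ring
  have hinv := HasRes.inv_of_hasDerivAt hd ((br_eq_zero_iff L g).mpr hx)
    (mul_ne_zero two_ne_zero (deriv_br_ne_zero L g hx))
  have hcy : Continuous fun x => brpm L g x y := continuous_brpm L g continuous_id continuous_const
  have hP : ContinuousAt (fun u => (∏ p, br L g (u + a p)) / br L g (2 * u + δ) *
      (brpm L g u y / brpm L g (u + δ) y)) x :=
    ContinuousAt.mul (ContinuousAt.div (by fun_prop) (by fun_prop) (br_ne_zero L g hp))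
      (continuousAt_ratio_add L g h1 h2)
  have hM : ContinuousAt (fun u => (∏ p, br L g (u - a p)) / br L g (2 * u - δ) *
      (brpm L g u y / brpm L g (u - δ) y)) x :=
    ContinuousAt.mul (ContinuousAt.div (by fun_prop) (by fun_prop) (br_ne_zero L g hm))
      (continuousAt_ratio_sub L g h3 h4)
  have hAll := (((hinv.mul_continuousAt hP).add (hinv.mul_continuousAt hM)).add
    (HasRes.of_continuousAt (continuousAt_Azero L g δ a c hc hp hm))).sub
    (HasRes.of_continuousAt (continuousAt_kernelSum_right (b := b) (c := c) (g := g) h1 h2 h3 h4))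
  have hres := HasRes.congr hAll (φ := kernelDiff L g δ a b c y) (fun u => by
    unfold kernelDiff
    congr 1
    unfold kernelSum Aplus Aminus
    rw [mul_comm (br L g (2 * u)), mul_comm (br L g (2 * u)), ← div_div, ← div_div]
    ring)
  have hneg := (hres.comp_neg (kernelDiff_neg_right L g δ a b c y)).comp_add
    (fun u => kernelDiff_add L g δ a b c hx ha y u)
  rw [show -x + 2 * x = x by ring] at hneg
  have hzero := hres.unique hneg
  rw [self_eq_neg.mp hzero] at hres
  exact hres

include hδ hy hc in
-- Both `A⁺` terms, in `x` and in `y`, have a pole from the common factor `[x + y + δ]`. At `x = -δ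
-- - y` one has `[x + a_p] = -[y + b_p]`, so the residues agree and cancel in the difference.
lemma hasRes_kernelDiff_cross (hb : ∀ p, b p = δ - a p) :
    HasRes (kernelDiff L g δ a b c y) (-δ - y) 0 := by
  have hny : ∀ k : ℤ, -(2 * y) + k * δ ∉ L.lattice := fun k h => hy (-k) (by
    have := neg_mem h
    convert this using 1
    push_cast; ring)
  have n0 : 2 * (-δ - y) ∉ L.lattice :=
    notMem_of_eq_add L (hny (-2)) (zero_mem _) (by push_cast; ring)
  have np : 2 * (-δ - y) + δ ∉ L.lattice :=
    notMem_of_eq_add L (hny (-1)) (zero_mem _) (by push_cast; ring)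
  have nm : 2 * (-δ - y) - δ ∉ L.lattice :=
    notMem_of_eq_add L (hny (-3)) (zero_mem _) (by push_cast; ring)
  have h2 : -δ - y + δ - y ∉ L.lattice :=
    notMem_of_eq_add L (hny 0) (zero_mem _) (by push_cast; ring)
  have h3 : -δ - y - δ + y ∉ L.lattice :=
    notMem_of_eq_add L (hδ (-2) (by norm_num)) (zero_mem _) (by push_cast; ring)
  have h4 : -δ - y - δ - y ∉ L.lattice :=
    notMem_of_eq_add L (hny (-2)) (zero_mem _) (by push_cast; ring)
  have hd : HasDerivAt (fun u => br L g (u + δ + y)) 1 (-δ - y) := by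
    have h0 := hasDerivAt_br_zero L g
    rw [show (0 : ℂ) = -δ - y + (δ + y) by ring] at h0
    simpa only [add_assoc] using h0.comp_add_const (-δ - y) (δ + y)
  have hinv := HasRes.inv_of_hasDerivAt hd (by
    rw [show -δ - y + δ + y = 0 by ring, br_zero]) one_ne_zero
  have hcy : Continuous fun x => brpm L g x y := continuous_brpm L g continuous_id continuous_const
  have hcy' : Continuous fun x => brpm L g y x := continuous_brpm L g continuous_const continuous_id
  have hP : ContinuousAt (fun u => Aplus L g δ a u * (brpm L g u y / br L g (u + δ - y))) (-δ - y) :=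
    (continuousAt_Aplus L g δ a n0 np).mul
      (ContinuousAt.div hcy.continuousAt (by fun_prop) (br_ne_zero L g h2))
  have hQ : ContinuousAt (fun u => Aplus L g δ b y * (brpm L g y u / br L g (y + δ - u)))
      (-δ - y) := by
    refine continuousAt_const.mul
      (ContinuousAt.div hcy'.continuousAt (by fun_prop) (br_ne_zero L g ?_))
    exact notMem_of_eq_add L (hy 2) (zero_mem _) (by push_cast; ring)
  have hR : ContinuousAt (fun u => Aminus L g δ b y * (brpm L g y u / brpm L g (y - δ) u))
      (-δ - y) := by
    refine continuousAt_const.mul (continuousAt_ratio_right L g ?_ ?_)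
    · exact notMem_of_eq_add L (hδ (-2) (by norm_num)) (zero_mem _) (by push_cast; ring)
    · exact notMem_of_eq_add L (hy 0) (zero_mem _) (by push_cast; ring)
  have hAll := (((hinv.mul_continuousAt hP).add (HasRes.of_continuousAt
    (continuousAt_Aminus_ratio (g := g) (a := a) n0 nm h3 h4))).add
    (HasRes.of_continuousAt (continuousAt_Azero L g δ a c hc np nm))).sub
    (((hinv.mul_continuousAt hQ).add (HasRes.of_continuousAt hR)).add
    (HasRes.of_continuousAt (continuousAt_const (y := Azero L g δ b c y))))
  have hres := HasRes.congr hAll (φ := kernelDiff L g δ a b c y) (fun u => by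
    unfold kernelDiff kernelSum
    rw [show brpm L g (u + δ) y = br L g (u + δ + y) * br L g (u + δ - y) from rfl,
      show brpm L g (y + δ) u = br L g (u + δ + y) * br L g (y + δ - u) by
        rw [brpm, show y + δ + u = u + δ + y by ring]]
    rw [← div_div, ← div_div]
    ring)
  convert hres using 1
  have hA : Aplus L g δ a (-δ - y) = (∏ p, br L g (y + b p)) /
      (br L g (2 * y + 2 * δ) * br L g (2 * y + δ)) := by
    unfold Aplus
    have : ∀ p, br L g (-δ - y + a p) = -br L g (y + b p) := fun p => by
      rw [← br_neg, hb]; congr 1; ring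
    simp only [this]
    rw [Finset.prod_neg, show 2 * (-δ - y) = -(2 * y + 2 * δ) by ring,
      show -(2 * y + 2 * δ) + δ = -(2 * y + δ) by ring, br_neg, br_neg, neg_mul_neg]
    simp [show (-1 : ℂ) ^ 8 = 1 by norm_num]
  have b0 : br L g (2 * y) ≠ 0 := br_ne_zero L g (by simpa using hy 0)
  have b1 : br L g (2 * y + δ) ≠ 0 := br_ne_zero L g (by simpa using hy 1)
  have b2 : br L g (2 * y + 2 * δ) ≠ 0 := br_ne_zero L g (by simpa using hy 2)
  rw [hA, Aplus, brpm, brpm, show -δ - y + y = -δ by ring, show -δ - y - y = -(2 * y + δ) by ring,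
    show -δ - y + δ - y = -(2 * y) by ring, show y + (-δ - y) = -δ by ring,
    show y - (-δ - y) = 2 * y + δ by ring, show y + δ - (-δ - y) = 2 * y + 2 * δ by ring,
    br_neg, br_neg, br_neg]
  field_simp
  ring

include hδ hy hc in
-- At `s = (ω_r - δ)/2` the poles come from `A⁺(x)` and from the `r`-th term of `A⁰`. Since `s + δ =
-- -s + ω_r`, the ratio `[s ± y]/[s + δ ± y]` is a constant free of `y`, and the exponential
-- coefficient in `A⁰` is the one that compensates it.
lemma hasRes_kernelDiff_half (ha : ∑ p, a p = 4 * δ) (r : Fin 4) :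
    HasRes (kernelDiff L g δ a b c y) ((om L r - δ) / 2) 0 := by
  set s := (om L r - δ) / 2 with hs
  have hw := om_mem L r
  have hny : ∀ k : ℤ, -(2 * y) + k * δ ∉ L.lattice := fun k h => hy (-k) (by
    have := neg_mem h
    convert this using 1
    push_cast; ring)
  have n0 : 2 * s ∉ L.lattice :=
    notMem_of_eq_add L (hδ (-1) (by norm_num)) hw (by rw [hs]; push_cast; ring)
  have np : 2 * s + δ = om L r := by rw [hs]; ring
  have nm : 2 * s - δ ∉ L.lattice :=
    notMem_of_eq_add L (hδ (-2) (by norm_num)) hw (by rw [hs]; push_cast; ring)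
  have h1 : s + δ + y ∉ L.lattice := notMem_of_two_mul L (hy 1) hw (by rw [hs]; push_cast; ring)
  have h2 : s + δ - y ∉ L.lattice := notMem_of_two_mul L (hny 1) hw (by rw [hs]; push_cast; ring)
  have h3 : s - δ + y ∉ L.lattice :=
    notMem_of_two_mul L (hy (-3)) hw (by rw [hs]; push_cast; ring)
  have h4 : s - δ - y ∉ L.lattice :=
    notMem_of_two_mul L (hny (-3)) hw (by rw [hs]; push_cast; ring)
  have hd : HasDerivAt (fun u => br L g (2 * u + δ))
      (2 * (eps L (om L r) * e (eta L g (om L r) * (om L r / 2)))) s := by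
    have h0 := deriv_br_of_mem L g hw
    rw [← np] at h0
    have := h0.comp s (((hasDerivAt_id s).const_mul 2).add_const δ)
    rw [np] at this
    refine this.congr_deriv ?_
    ring
  have hinv := HasRes.inv_of_hasDerivAt hd (by rw [np, (br_eq_zero_iff L g).mpr hw])
    (mul_ne_zero two_ne_zero (mul_ne_zero (eps_ne_zero L _) (e_ne_zero _)))
  have hd' : HasDerivAt (fun u => br L g (s - u)) (-1) s := by
    have h0 := hasDerivAt_br_zero L g
    rw [show (0 : ℂ) = s - s by ring] at h0
    have := h0.comp s ((hasDerivAt_id s).const_sub s)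
    refine this.congr_deriv ?_
    ring
  have hinv' := HasRes.inv_of_hasDerivAt hd' (by rw [sub_self, br_zero]) (by norm_num)
  have hcy : Continuous fun x => brpm L g x y := continuous_brpm L g continuous_id continuous_const
  have hcc : Continuous fun x => brpm L g x (c r) :=
    continuous_brpm L g continuous_id continuous_const
  have hP : ContinuousAt (fun u => (∏ p, br L g (u + a p)) / br L g (2 * u) *
      (brpm L g u y / brpm L g (u + δ) y)) s :=
    ContinuousAt.mul (ContinuousAt.div (by fun_prop) (by fun_prop) (br_ne_zero L g n0))
      (continuousAt_ratio_add L g h1 h2)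
  have hQ : ContinuousAt (fun u => eps L (om L r) *
      e ((δ - om L r / 2 - (∑ p, a p) / 2) * eta L g (om L r)) *
      (brpm L g u (c r) * ∏ p, br L g ((om L r - δ) / 2 + a p)) /
      (2 * br L g (s + u) * brpm L g ((om L r - δ) / 2) (c r))) s := by
    refine ContinuousAt.div (by fun_prop) (by fun_prop)
      (mul_ne_zero (mul_ne_zero two_ne_zero (br_ne_zero L g ?_)) (hc r))
    rwa [← two_mul]
  have hR : ContinuousAt (fun u => ∑ t ∈ Finset.univ.erase r, AzeroTerm L g δ t a (c t) u) s := by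
    refine tendsto_finsetSum _ fun t ht =>
      (continuousAt_AzeroTerm L g δ a (hc t) ?_ ?_).tendsto
    · exact notMem_of_two_mul L (hδ (-2) (by norm_num)) (add_mem (om_mem L t) hw)
        (by rw [hs]; push_cast; ring)
    · rw [hs, show (om L t - δ) / 2 - (om L r - δ) / 2 = (om L t - om L r) / 2 by ring]
      exact half_om_sub_notMem L (Finset.ne_of_mem_erase ht)
  have hAll := (((hinv.mul_continuousAt hP).add (HasRes.of_continuousAt
    (continuousAt_Aminus_ratio (g := g) (a := a) n0 nm h3 h4))).add
    ((hinv'.mul_continuousAt hQ).add (HasRes.of_continuousAt hR))).sub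
    (HasRes.of_continuousAt (continuousAt_kernelSum_right (b := b) (c := c) (g := g) h1 h2 h3 h4))
  have hres := HasRes.congr hAll (φ := kernelDiff L g δ a b c y) (fun u => by
    unfold kernelDiff
    congr 1
    unfold kernelSum
    congr 1
    · congr 1
      unfold Aplus
      rw [← div_div]
      ring
    · unfold Azero
      rw [← Finset.add_sum_erase _ _ (Finset.mem_univ r)]
      congr 1
      unfold AzeroTerm
      rw [← hs, show brpm L g s u = br L g (s + u) * br L g (s - u) from rfl,
        show ∀ A B C D : ℂ, 2 * (A * B) * C = B * (2 * A * C) from fun _ _ _ _ => by ring, ← div_div]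
      · ring
      · exact 0)
  convert hres using 1
  have hsd : brpm L g (s + δ) y = e (eta L g (om L r) * δ) * brpm L g s y := by
    rw [show s + δ = -s + om L r by rw [hs]; ring, brpm_add_left L g hw, brpm_neg_left]
    congr 2
    rw [hs]; ring
  have b0 := br_ne_zero L g n0
  have b1 : brpm L g s y ≠ 0 := brpm_ne_zero L g
    (notMem_of_two_mul L (hy (-1)) hw (by rw [hs]; push_cast; ring))
    (notMem_of_two_mul L (hny (-1)) hw (by rw [hs]; push_cast; ring))
  have b2 := hc r
  rw [← hs] at b2 ⊢
  rw [hsd, ha, ← two_mul s, show (δ - om L r / 2 - 4 * δ / 2) * eta L g (om L r) =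
    -(eta L g (om L r) * (om L r / 2) + eta L g (om L r) * δ) by ring, e_neg, e_add]
  have e1 := e_ne_zero (eta L g (om L r) * (om L r / 2))
  have e2 := e_ne_zero (eta L g (om L r) * δ)
  have e3 := eps_ne_zero L (om L r)
  have e4 : eps L (om L r) ^ 2 = 1 := by rw [sq, eps_sq]
  generalize e (eta L g (om L r) * (om L r / 2)) = E1 at *
  generalize e (eta L g (om L r) * δ) = E2 at *
  generalize eps L (om L r) = E3 at *
  generalize brpm L g s (c r) = B at *
  generalize brpm L g s y = B' at *
  generalize br L g (2 * s) = B'' at *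
  field_simp
  linear_combination (∏ p, br L g (s + a p)) * e4

include hδ hy hc in
lemma hasRes_kernelDiff_cross_of_mem (ha : ∑ p, a p = 4 * δ) (hb : ∀ p, b p = δ - a p) {x : ℂ}
    (hx : x + δ + y ∈ L.lattice) : HasRes (kernelDiff L g δ a b c y) x 0 := by
  have := (hasRes_kernelDiff_cross (a := a) (b := b) hδ hc hy hb).comp_add
    (fun u => kernelDiff_add L g δ a b c hx ha y u)
  rwa [show -δ - y + (x + δ + y) = x by ring] at this

include hδ hy hc in
lemma hasRes_kernelDiff_half_of_mem (ha : ∑ p, a p = 4 * δ) {x : ℂ}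
    (hx : 2 * x + δ ∈ L.lattice) : HasRes (kernelDiff L g δ a b c y) x 0 := by
  obtain ⟨r, l, hl, h⟩ := exists_om_add_two_mul L hx
  have := (hasRes_kernelDiff_half (b := b) hδ hc hy ha r).comp_add
    (fun u => kernelDiff_add L g δ a b c hl ha y u)
  rwa [show (om L r - δ) / 2 + l = x by linear_combination -h / 2] at this

include hc in
lemma continuousAt_kernelDiff {x : ℂ} (h : 2 * x ∉ L.lattice) (hp : 2 * x + δ ∉ L.lattice)
    (hm : 2 * x - δ ∉ L.lattice) (h1 : x + δ + y ∉ L.lattice) (h2 : x + δ - y ∉ L.lattice)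
    (h3 : x - δ + y ∉ L.lattice) (h4 : x - δ - y ∉ L.lattice) :
    ContinuousAt (kernelDiff L g δ a b c y) x := by
  have hl : ContinuousAt (fun x => kernelSum L g δ a c x y) x :=
    continuousAt_kernelSum_left hc h hp hm h1 h2 h3 h4
  have hr : ContinuousAt (fun x => kernelSum L g δ b c y x) x :=
    continuousAt_kernelSum_right h1 h2 h3 h4
  exact hl.sub hr

include hδ hy hc in
-- Evenness in `x` and in `y` reduces every possible pole to one of the three types already treated.
lemma hasRes_kernelDiff (ha : ∑ p, a p = 4 * δ) (hb : ∀ p, b p = δ - a p) (x : ℂ) :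
    HasRes (kernelDiff L g δ a b c y) x 0 := by
  have hny : ∀ k : ℤ, 2 * (-y) + k * δ ∉ L.lattice := fun k h => hy (-k) (by
    have := neg_mem h
    rwa [show -(2 * (-y) + k * δ) = 2 * y + ((-k : ℤ) : ℂ) * δ by push_cast; ring] at this)
  have hneg : ∀ {x : ℂ}, HasRes (kernelDiff L g δ a b c y) (-x) 0 →
      HasRes (kernelDiff L g δ a b c y) x 0 := fun h => by
    simpa using h.comp_neg (kernelDiff_neg_right L g δ a b c y)
  have hyneg : kernelDiff L g δ a b c (-y) = kernelDiff L g δ a b c y :=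
    funext (kernelDiff_neg_left L g δ a b c y)
  by_cases h0 : 2 * x ∈ L.lattice
  · exact hasRes_kernelDiff_of_two_mul_mem hδ hc hy ha h0
  by_cases hp : 2 * x + δ ∈ L.lattice
  · exact hasRes_kernelDiff_half_of_mem hδ hc hy ha hp
  by_cases hm : 2 * x - δ ∈ L.lattice
  · refine hneg (hasRes_kernelDiff_half_of_mem hδ hc hy ha ?_)
    exact (show -(2 * x - δ) = 2 * -x + δ by ring) ▸ neg_mem hm
  by_cases h1 : x + δ + y ∈ L.lattice
  · exact hasRes_kernelDiff_cross_of_mem hδ hc hy ha hb h1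
  by_cases h2 : x + δ - y ∈ L.lattice
  · rw [← hyneg]
    exact hasRes_kernelDiff_cross_of_mem hδ hc hny ha hb h2
  by_cases h3 : x - δ + y ∈ L.lattice
  · have h5 : -x + δ + -y ∈ L.lattice := (show -(x - δ + y) = -x + δ + -y by ring) ▸ neg_mem h3
    have h6 := hasRes_kernelDiff_cross_of_mem (a := a) (b := b) hδ hc hny ha hb h5
    rw [hyneg] at h6
    exact hneg h6
  by_cases h4 : x - δ - y ∈ L.lattice
  · have h5 : -x + δ + y ∈ L.lattice := (show -(x - δ - y) = -x + δ + y by ring) ▸ neg_mem h4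
    exact hneg (hasRes_kernelDiff_cross_of_mem (a := a) (b := b) hδ hc hy ha hb h5)
  exact HasRes.of_continuousAt (continuousAt_kernelDiff hc h0 hp hm h1 h2 h3 h4)

include hδ hc hy in
/-- The kernel function identity for the one-variable difference operators. -/
theorem kernelSum_eq (ha : ∑ p, a p = 4 * δ) (hb : ∀ p, b p = δ - a p) {x : ℂ}
    (hx : ∀ k : ℤ, 2 * x + k * δ ∉ L.lattice) (hadd : ∀ k : ℤ, x + y + k * δ ∉ L.lattice)
    (hsub : ∀ k : ℤ, x - y + k * δ ∉ L.lattice) :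
    kernelSum L g δ a c x y = kernelSum L g δ b c y x := by
  obtain ⟨C, hC⟩ := exists_const_of_periodic L (meromorphicAt_kernelDiff L g δ a b c y)
    (fun w hw u => kernelDiff_add L g δ a b c hw ha y u)
    (hasRes_kernelDiff (b := b) hδ hc hy ha hb)
  have hcont : ∀ z : ℂ, (∀ k : ℤ, 2 * z + k * δ ∉ L.lattice) → z + δ + y ∉ L.lattice →
      z + δ - y ∉ L.lattice → z - δ + y ∉ L.lattice → z - δ - y ∉ L.lattice →
      ContinuousAt (kernelDiff L g δ a b c y) z := fun z hz h1 h2 h3 h4 =>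
    continuousAt_kernelDiff hc (notMem_of_eq_add L (hz 0) (zero_mem _) (by simp))
      (notMem_of_eq_add L (hz 1) (zero_mem _) (by push_cast; ring))
      (notMem_of_eq_add L (hz (-1)) (zero_mem _) (by push_cast; ring)) h1 h2 h3 h4
  have hxC := hC x (hcont x hx
    (notMem_of_eq_add L (hadd 1) (zero_mem _) (by push_cast; ring))
    (notMem_of_eq_add L (hsub 1) (zero_mem _) (by push_cast; ring))
    (notMem_of_eq_add L (hadd (-1)) (zero_mem _) (by push_cast; ring))
    (notMem_of_eq_add L (hsub (-1)) (zero_mem _) (by push_cast; ring)))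
  have hyC := hC y (hcont y hy
    (notMem_of_eq_add L (hy 1) (zero_mem _) (by push_cast; ring))
    (notMem_of_eq_add L (hδ 1 (by norm_num)) (zero_mem _) (by push_cast; ring))
    (notMem_of_eq_add L (hy (-1)) (zero_mem _) (by push_cast; ring))
    (notMem_of_eq_add L (hδ (-1) (by norm_num)) (zero_mem _) (by push_cast; ring)))
  -- This fixes the constant: `[y ± y] = 0` removes the shifted terms on both sides, and `A⁰` is the
  -- same for `a` and `b`.
  have h0 : kernelDiff L g δ a b c y y = 0 := by
    unfold kernelDiff kernelSum
    rw [brpm_self, zero_div, zero_div, Azero_dual L g δ a b c ha hb]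
    simp
  rw [h0] at hyC
  rw [← hyC] at hxC
  exact sub_eq_zero.mp hxC

end residues

end EllipticBC

/-! ### Products of three-term combinations of anticommuting elements. -/

namespace EllipticBC

section strings

variable {R : Type*} [Ring R] (v : ℕ → R)

/-- The ordered product `v i * v (i + 1) * ⋯ * v (i + n - 1)`. -/
def orderedProd (i n : ℕ) : R := ((List.range' i n).map v).prod

lemma orderedProd_zero (i : ℕ) : orderedProd v i 0 = 1 := by simp [orderedProd]

lemma orderedProd_succ (i n : ℕ) : orderedProd v i (n + 1) = orderedProd v i n * v (i + n) := by
  simp [orderedProd, List.range'_concat]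

variable {v}

lemma orderedProd_mul_eq_zero (h0 : ∀ i, v i * v i = 0) (h1 : ∀ i j, v i * v j = -(v j * v i))
    {i n k : ℕ} (hik : i ≤ k) (hk : k < i + n) : orderedProd v i n * v k = 0 := by
  induction n with
  | zero => omega
  | succ n ih =>
    rw [orderedProd_succ, mul_assoc]
    rcases eq_or_ne k (i + n) with rfl | hne
    · rw [h0, mul_zero]
    · rw [h1, mul_neg, ← mul_assoc, ih (by omega), zero_mul, neg_zero]

variable (v)

/-- The ordered product of `v 0, …, v (n + 1)` with the factors `v p` and `v (q + 1)` omitted. -/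
def windowProd (n p q : ℕ) : R :=
  orderedProd v 0 p * orderedProd v (p + 1) (q - p) * orderedProd v (q + 2) (n - q)

lemma windowProd_mul_last {n p q : ℕ} (hq : q ≤ n) :
    windowProd v n p q * v (n + 2) = windowProd v (n + 1) p q := by
  rw [windowProd, windowProd, Nat.succ_sub hq, orderedProd_succ, ← mul_assoc]
  congr 2
  omega

variable {v}

lemma windowProd_mul_succ_of_lt (h0 : ∀ i, v i * v i = 0) (h1 : ∀ i j, v i * v j = -(v j * v i))
    {n p q : ℕ} (hq : q < n) : windowProd v n p q * v (n + 1) = 0 := by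
  rw [windowProd, mul_assoc, orderedProd_mul_eq_zero h0 h1 (by omega) (by omega), mul_zero]

variable (v) in
lemma windowProd_mul_succ_self {n p : ℕ} (hp : p ≤ n) :
    windowProd v n p n * v (n + 1) = windowProd v (n + 1) p (n + 1) := by
  rw [windowProd, windowProd, Nat.succ_sub hp, orderedProd_succ, Nat.sub_self, Nat.sub_self,
    orderedProd_zero, orderedProd_zero, mul_one, mul_one, mul_assoc]
  congr 3
  omega

lemma windowProd_mul_of_succ_lt (h0 : ∀ i, v i * v i = 0) (h1 : ∀ i j, v i * v j = -(v j * v i))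
    {n p q : ℕ} (hq : q + 1 < n) : windowProd v n p q * v n = 0 := by
  rw [windowProd, mul_assoc, orderedProd_mul_eq_zero h0 h1 (by omega) (by omega), mul_zero]

lemma windowProd_mul_self_of_lt (h0 : ∀ i, v i * v i = 0) (h1 : ∀ i j, v i * v j = -(v j * v i))
    {n p : ℕ} (hp : p < n) : windowProd v n p n * v n = 0 := by
  rw [windowProd, Nat.sub_self, orderedProd_zero, mul_one, mul_assoc,
    orderedProd_mul_eq_zero h0 h1 (by omega) (by omega), mul_zero]

variable (v) in
lemma windowProd_self_mul (n : ℕ) :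
    windowProd v n n n * v n = windowProd v (n + 1) (n + 1) (n + 1) := by
  simp only [windowProd, Nat.sub_self, orderedProd_zero, mul_one, orderedProd_succ, zero_add]

/-- The window ends in `v (n + 2)` and lacks `v (n + 1)`. Filling the gap from the right takes one
transposition, which is the source of the minus sign in the continuant recursion. -/
lemma windowProd_mul_pred (h1 : ∀ i j, v i * v j = -(v j * v i)) {n p : ℕ} (hp : p ≤ n) :
    windowProd v (n + 1) p n * v (n + 1) = -windowProd v (n + 2) p (n + 2) := by
  rw [windowProd, windowProd, show n + 2 - p = n - p + 1 + 1 by omega, orderedProd_succ,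
    orderedProd_succ, Nat.sub_self, show n + 1 - n = 0 + 1 by omega, orderedProd_succ,
    orderedProd_zero, orderedProd_zero, mul_one, one_mul, mul_assoc, add_zero, h1,
    show p + 1 + (n - p) = n + 1 by omega, show p + 1 + (n - p + 1) = n + 2 by omega]
  simp only [mul_neg, mul_assoc]

/-- The continuant recursion satisfied by the coefficients `C`. -/
structure IsContinuant (am a0 ap : ℕ → ℂ) (K : ℕ → ℕ → ℂ) : Prop where
  zero : ∀ p, K p 0 = 1
  one : ∀ p, K p 1 = a0 p
  step : ∀ p s, K p (s + 2) = a0 (p + s + 1) * K p (s + 1) - ap (p + s) * am (p + s + 1) * K p s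

variable [Algebra ℂ R] {am a0 ap : ℕ → ℂ} {K : ℕ → ℕ → ℂ}

/-- Expansion of a product of consecutive three-term combinations of anticommuting elements. -/
theorem prod_three_term (h0 : ∀ i, v i * v i = 0) (h1 : ∀ i j, v i * v j = -(v j * v i))
    (hK : IsContinuant am a0 ap K) (n : ℕ) :
    ((List.range n).map fun k => am k • v k + a0 k • v (k + 1) + ap k • v (k + 2)).prod =
      ∑ q ∈ Finset.range (n + 1), ∑ p ∈ Finset.range (q + 1),
        ((∏ k ∈ Finset.range p, am k) * (∏ k ∈ Finset.Ico q n, ap k) * K p (q - p)) •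
          windowProd v n p q := by
  induction n with
  | zero => simp [windowProd, orderedProd_zero, hK.zero]
  | succ n ih =>
    rw [List.range_succ, List.map_append, List.prod_append, ih, Finset.sum_range_succ _ (n + 1)]
    simp only [List.map_cons, List.map_nil, List.prod_cons, List.prod_nil, mul_one, mul_add]
    -- The element `v (n + 2)` is new, so every window survives and its product of `ap` grows by one
    -- factor.
    have hlast : (∑ q ∈ Finset.range (n + 1), ∑ p ∈ Finset.range (q + 1),
        ((∏ k ∈ Finset.range p, am k) * (∏ k ∈ Finset.Ico q n, ap k) * K p (q - p)) •
          windowProd v n p q) * (ap n • v (n + 2)) =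
        ∑ q ∈ Finset.range (n + 1), ∑ p ∈ Finset.range (q + 1),
        ((∏ k ∈ Finset.range p, am k) * (∏ k ∈ Finset.Ico q (n + 1), ap k) * K p (q - p)) •
          windowProd v (n + 1) p q := by
      simp only [Finset.sum_mul]
      refine Finset.sum_congr rfl fun q hq => Finset.sum_congr rfl fun p _ => ?_
      have hqn : q ≤ n := by rw [Finset.mem_range] at hq; omega
      rw [smul_mul_smul_comm, windowProd_mul_last v hqn, Finset.prod_Ico_succ_top hqn]
      congr 1
      ring
    -- Only the windows that omit `v (n + 1)`, those with `q = n`, survive.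
    have hmid : (∑ q ∈ Finset.range (n + 1), ∑ p ∈ Finset.range (q + 1),
        ((∏ k ∈ Finset.range p, am k) * (∏ k ∈ Finset.Ico q n, ap k) * K p (q - p)) •
          windowProd v n p q) * (a0 n • v (n + 1)) =
        ∑ p ∈ Finset.range (n + 1),
        ((∏ k ∈ Finset.range p, am k) * (a0 n * K p (n - p))) •
          windowProd v (n + 1) p (n + 1) := by
      simp only [Finset.sum_mul]
      rw [Finset.sum_range_succ, Finset.sum_eq_zero, zero_add]
      · refine Finset.sum_congr rfl fun p hp => ?_
        have hpn : p ≤ n := by rw [Finset.mem_range] at hp; omega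
        rw [smul_mul_smul_comm, windowProd_mul_succ_self v hpn]
        congr 1
        simp
        ring
      · intro q hq
        refine Finset.sum_eq_zero fun p _ => ?_
        rw [smul_mul_smul_comm, windowProd_mul_succ_of_lt h0 h1 (Finset.mem_range.mp hq), smul_zero]
    rw [hlast, hmid, add_comm]
    congr 1
    simp only [Finset.Ico_self, Finset.prod_empty, mul_one]
    cases n with
    | zero =>
      simp [Finset.sum_range_succ, hK.zero, hK.one, windowProd_self_mul, add_comm]
    | succ n =>
      -- A window omits `v (n + 1)` if `p = q = n + 1`, which extends the pure product of `am`, or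
      -- if `q = n`, which gives the terms with a transposition.
      have hfirst : (∑ q ∈ Finset.range (n + 1 + 1), ∑ p ∈ Finset.range (q + 1),
          ((∏ k ∈ Finset.range p, am k) * (∏ k ∈ Finset.Ico q (n + 1), ap k) * K p (q - p)) •
            windowProd v (n + 1) p q) * (am (n + 1) • v (n + 1)) =
          (∏ k ∈ Finset.range (n + 2), am k) • windowProd v (n + 2) (n + 2) (n + 2) -
          ∑ p ∈ Finset.range (n + 1),
          ((∏ k ∈ Finset.range p, am k) * (ap n * am (n + 1) * K p (n - p))) •
            windowProd v (n + 2) p (n + 2) := by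
        simp only [Finset.sum_mul]
        rw [Finset.sum_range_succ, Finset.sum_range_succ, Finset.sum_eq_zero, zero_add, add_comm,
          sub_eq_add_neg]
        · congr 1
          · rw [Finset.sum_range_succ, Finset.sum_eq_zero, zero_add]
            · rw [smul_mul_smul_comm, windowProd_self_mul]
              congr 1
              simp [hK.zero, Finset.prod_range_succ]
            · intro p hp
              rw [smul_mul_smul_comm, windowProd_mul_self_of_lt h0 h1 (Finset.mem_range.mp hp),
                smul_zero]
          · rw [← Finset.sum_neg_distrib]
            refine Finset.sum_congr rfl fun p hp => ?_
            have hpn : p ≤ n := by rw [Finset.mem_range] at hp; omega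
            rw [smul_mul_smul_comm, windowProd_mul_pred h1 hpn, smul_neg]
            congr 2
            simp
            ring
        · intro q hq
          refine Finset.sum_eq_zero fun p _ => ?_
          rw [smul_mul_smul_comm, windowProd_mul_of_succ_lt h0 h1
            (by rw [Finset.mem_range] at hq; omega), smul_zero]
      rw [hfirst, Finset.sum_range_succ _ (n + 1), Finset.sum_range_succ _ (n + 1 + 1),
        Finset.sum_range_succ _ (n + 1)]
      -- For `p ≤ n` the terms from the middle and from the transposition combine by the recursion;
      -- `p = n + 1` and `p = n + 2` use only its initial values.
      have hstep : ∑ p ∈ Finset.range (n + 1), ((∏ k ∈ Finset.range p, am k) * K p (n + 1 + 1 - p)) •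
            windowProd v (n + 1 + 1) p (n + 1 + 1) =
          (∑ p ∈ Finset.range (n + 1), ((∏ k ∈ Finset.range p, am k) * (a0 (n + 1) *
            K p (n + 1 - p))) • windowProd v (n + 1 + 1) p (n + 1 + 1)) -
          ∑ p ∈ Finset.range (n + 1), ((∏ k ∈ Finset.range p, am k) * (ap n * am (n + 1) *
            K p (n - p))) • windowProd v (n + 2) p (n + 2) := by
        rw [← Finset.sum_sub_distrib]
        refine Finset.sum_congr rfl fun p hp => ?_
        have hpn : p ≤ n := by rw [Finset.mem_range] at hp; omega
        rw [← sub_smul, show n + 1 + 1 - p = n - p + 2 by omega, hK.step,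
          show n + 1 - p = n - p + 1 by omega, show p + (n - p) = n by omega]
        congr 1
        ring
      rw [hstep]
      simp only [Nat.sub_self, hK.zero, mul_one, show n + 1 + 1 - (n + 1) = 1 by omega, hK.one]
      abel

end strings

end EllipticBC

/-! ### The coefficients `C` as continuants. -/

namespace EllipticBC

section continuant

/-- The subsets of `{1, …, s - 1}` without two consecutive elements. -/
def sparseSets (s : ℕ) : Finset (Finset ℕ) :=
  (Finset.Ioo 0 s).powerset.filter (fun S => ∀ ξ ∈ S, ξ + 1 ∉ S)

lemma mem_sparseSets {s : ℕ} {S : Finset ℕ} :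
    S ∈ sparseSets s ↔ (∀ ξ ∈ S, 0 < ξ ∧ ξ < s) ∧ ∀ ξ ∈ S, ξ + 1 ∉ S := by
  simp [sparseSets, Finset.subset_iff]

/-- `S` and `S - 1` are disjoint subsets of `{0, …, s - 1}` of equal size. Thus the bound `r ≤ s/2`
in the definition of `C` excludes no set. -/
lemma card_le_of_mem_sparseSets {s : ℕ} {S : Finset ℕ} (hS : S ∈ sparseSets s) :
    S.card ≤ s / 2 := by
  rw [mem_sparseSets] at hS
  obtain ⟨h1, h2⟩ := hS
  have hinj : Set.InjOn (fun ξ : ℕ => ξ - 1) (S : Set ℕ) := fun a ha b hb hab => by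
    have := (h1 a ha).1
    have := (h1 b hb).1
    simp only at hab
    omega
  have hdis : Disjoint S (S.image fun ξ => ξ - 1) := by
    rw [Finset.disjoint_left]
    intro a ha hb
    obtain ⟨b, hbS, rfl⟩ := Finset.mem_image.mp hb
    have := (h1 b hbS).1
    exact h2 _ ha (by rwa [Nat.sub_add_cancel this])
  have hsub : S ∪ S.image (fun ξ => ξ - 1) ⊆ Finset.range s := by
    intro a ha
    rw [Finset.mem_range]
    rcases Finset.mem_union.mp ha with ha | ha
    · exact (h1 a ha).2
    · obtain ⟨b, hb, rfl⟩ := Finset.mem_image.mp ha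
      have := h1 b hb
      omega
  have := Finset.card_le_card hsub
  rw [Finset.card_union_of_disjoint hdis, Finset.card_image_of_injOn hinj, Finset.card_range] at this
  omega

/-- The weight of a set of disjoint dominoes. -/
def sparseWeight (f h : ℕ → ℂ) (s : ℕ) (S : Finset ℕ) : ℂ :=
  (-1) ^ S.card * ((∏ ξ ∈ S, f ξ) * ∏ k ∈ (Finset.range s).filter (fun k => k ∉ S ∧ k + 1 ∉ S), h k)

lemma sum_sparseSets_eq (f h : ℕ → ℂ) (s : ℕ) :
    ∑ r ∈ Finset.range (s / 2 + 1), (-1) ^ r *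
      ∑ S ∈ ((Finset.Ioo 0 s).powersetCard r).filter (fun S => ∀ ξ ∈ S, ξ + 1 ∉ S),
        (∏ ξ ∈ S, f ξ) * ∏ k ∈ (Finset.range s).filter (fun k => k ∉ S ∧ k + 1 ∉ S), h k =
    ∑ S ∈ sparseSets s, sparseWeight f h s S := by
  rw [← Finset.sum_fiberwise_of_maps_to (s := sparseSets s) (t := Finset.range (s / 2 + 1))
    (g := Finset.card) (fun S hS => Finset.mem_range.mpr
      (Nat.lt_succ_of_le (card_le_of_mem_sparseSets hS)))]
  refine Finset.sum_congr rfl fun r _ => ?_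
  rw [Finset.mul_sum]
  refine Finset.sum_congr ?_ fun S hS => ?_
  · ext S
    simp only [sparseSets, Finset.mem_filter, Finset.mem_powersetCard, Finset.mem_powerset]
    tauto
  · rw [sparseWeight, (Finset.mem_filter.mp hS).2]

lemma sparseSets_succ_succ (s : ℕ) :
    sparseSets (s + 2) = sparseSets (s + 1) ∪ (sparseSets s).image (insert (s + 1)) := by
  ext S
  simp only [Finset.mem_union, Finset.mem_image, mem_sparseSets]
  constructor
  · rintro ⟨h1, h2⟩
    by_cases hs : s + 1 ∈ S
    · refine Or.inr ⟨S.erase (s + 1), ⟨fun ξ hξ => ?_, fun ξ hξ h => ?_⟩, Finset.insert_erase hs⟩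
      · rw [Finset.mem_erase] at hξ
        have := h1 ξ hξ.2
        refine ⟨this.1, ?_⟩
        have h3 : ξ ≠ s := by rintro rfl; exact h2 _ hξ.2 hs
        omega
      · rw [Finset.mem_erase] at hξ h
        exact h2 ξ hξ.2 h.2
    · refine Or.inl ⟨fun ξ hξ => ?_, h2⟩
      have := h1 ξ hξ
      refine ⟨this.1, ?_⟩
      have h3 : ξ ≠ s + 1 := by rintro rfl; exact hs hξ
      omega
  · rintro (⟨h1, h2⟩ | ⟨T, ⟨h1, h2⟩, rfl⟩)
    · exact ⟨fun ξ hξ => ⟨(h1 ξ hξ).1, by have := (h1 ξ hξ).2; omega⟩, h2⟩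
    · refine ⟨fun ξ hξ => ?_, fun ξ hξ h => ?_⟩
      · rcases Finset.mem_insert.mp hξ with rfl | hξ
        · omega
        · have := h1 ξ hξ
          omega
      · rcases Finset.mem_insert.mp hξ with rfl | hξ <;> rcases Finset.mem_insert.mp h with h | h
        · omega
        · have := h1 _ h
          omega
        · have := h1 _ hξ
          omega
        · exact h2 _ hξ h

/-- An element `ξ` of `S` is a domino on the cells `ξ - 1, ξ`, and the uncovered cells are single.
The last cell `s + 1` is either single, with weight `h (s + 1)`, or covered by the domino `s + 1`,
with weight `-f (s + 1)`. -/
lemma sum_sparseWeight_step (f h : ℕ → ℂ) (s : ℕ) :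
    ∑ S ∈ sparseSets (s + 2), sparseWeight f h (s + 2) S =
      h (s + 1) * (∑ S ∈ sparseSets (s + 1), sparseWeight f h (s + 1) S) -
        f (s + 1) * ∑ S ∈ sparseSets s, sparseWeight f h s S := by
  have hnot : ∀ S ∈ sparseSets (s + 1), s + 1 ∉ S ∧ s + 2 ∉ S := fun S hS => by
    rw [mem_sparseSets] at hS
    exact ⟨fun h => by have := hS.1 _ h; omega, fun h => by have := hS.1 _ h; omega⟩
  have hnot' : ∀ S ∈ sparseSets s, s + 1 ∉ S ∧ s ∉ S := fun S hS => by
    rw [mem_sparseSets] at hS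
    exact ⟨fun h => by have := hS.1 _ h; omega, fun h => by have := hS.1 _ h; omega⟩
  rw [sparseSets_succ_succ, Finset.sum_union, Finset.sum_image, Finset.mul_sum, Finset.mul_sum,
    sub_eq_add_neg, ← Finset.sum_neg_distrib]
  · congr 1
    · refine Finset.sum_congr rfl fun S hS => ?_
      rw [sparseWeight, sparseWeight, Finset.range_add_one (n := s + 1), Finset.filter_insert,
        if_pos (hnot S hS), Finset.prod_insert (by simp)]
      ring
    · refine Finset.sum_congr rfl fun S hS => ?_
      have h1 := hnot' S hS
      have hfil : (Finset.range (s + 2)).filter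
          (fun k => k ∉ insert (s + 1) S ∧ k + 1 ∉ insert (s + 1) S) =
          (Finset.range s).filter (fun k => k ∉ S ∧ k + 1 ∉ S) := by
        ext k
        simp only [Finset.mem_filter, Finset.mem_range, Finset.mem_insert, not_or]
        constructor
        · rintro ⟨h2, h3, h4⟩
          exact ⟨by omega, h3.2, h4.2⟩
        · rintro ⟨h2, h3, h4⟩
          exact ⟨by omega, ⟨by omega, h3⟩, by omega, h4⟩
      rw [sparseWeight, sparseWeight, hfil, Finset.prod_insert h1.1,
        Finset.card_insert_of_notMem h1.1]
      ring
  · intro S hS T hT hST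
    have h1 := (hnot' S hS).1
    have h2 := (hnot' T hT).1
    rw [← Finset.erase_insert h1, ← Finset.erase_insert h2]
    exact congrArg (fun U => U.erase (s + 1)) hST
  · rw [Finset.disjoint_left]
    intro S hS hS'
    obtain ⟨T, -, rfl⟩ := Finset.mem_image.mp hS'
    exact (hnot _ hS).1 (Finset.mem_insert_self _ _)

end continuant

variable (L : PeriodPair) (g δ : ℂ) (a : Fin 8 → ℂ) (c : Fin 4 → ℂ)

lemma C_eq_sum (s : ℕ) (z : ℂ) :
    C L g δ a c s z = ∑ S ∈ sparseSets s, sparseWeight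
      (fun ξ => Aplus L g δ a (z + ((ξ : ℂ) - 1) * δ) * Aminus L g δ a (z + ξ * δ))
      (fun k => Azero L g δ a c (z + k * δ)) s S := by
  rw [← sum_sparseSets_eq]
  rfl

lemma C_zero (z : ℂ) : C L g δ a c 0 z = 1 := by
  simp [C, Finset.sum_filter]

lemma C_one (z : ℂ) : C L g δ a c 1 z = Azero L g δ a c z := by
  simp [C, Finset.sum_filter, Finset.filter_singleton]

lemma C_succ_succ (s : ℕ) (z : ℂ) :
    C L g δ a c (s + 2) z =
      Azero L g δ a c (z + (s + 1) * δ) * C L g δ a c (s + 1) z -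
        Aplus L g δ a (z + s * δ) * Aminus L g δ a (z + (s + 1) * δ) * C L g δ a c s z := by
  rw [C_eq_sum, C_eq_sum, C_eq_sum, sum_sparseWeight_step]
  push_cast
  rw [add_sub_cancel_right]

lemma isContinuant_C (x : ℂ) :
    IsContinuant (fun k => Aminus L g δ a (x + k * δ)) (fun k => Azero L g δ a c (x + k * δ))
      (fun k => Aplus L g δ a (x + k * δ)) (fun p s => C L g δ a c s (x + p * δ)) where
  zero p := C_zero L g δ a c _
  one p := C_one L g δ a c _
  step p s := by
    rw [C_succ_succ]
    have e1 : x + (p : ℂ) * δ + ((s : ℂ) + 1) * δ = x + ((p + s + 1 : ℕ) : ℂ) * δ := by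
      push_cast; ring
    have e2 : x + (p : ℂ) * δ + (s : ℂ) * δ = x + ((p + s : ℕ) : ℂ) * δ := by push_cast; ring
    rw [e1, e2]

end EllipticBC

/-! ### The Cauchy determinant, and determinants in the exterior algebra. -/

namespace EllipticBC

variable (L : PeriodPair) (g δ : ℂ)

/-- The three-term relation with the points `ω₁/2` and `0` turns `[x ± y]` into a two-by-two
determinant, and the Cauchy determinant then becomes a problem about homogeneous polynomials in `F`
and `G`. -/
lemma exists_brpm_eq_sub : ∃ F G : ℂ → ℂ, ∀ x y, brpm L g x y = F x * G y - G x * F y := by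
  have h0 : brpm L g (L.ω₁ / 2) 0 ≠ 0 := brpm_ne_zero L g
    (by simpa using L.ω₁_div_two_notMem_lattice) (by simpa using L.ω₁_div_two_notMem_lattice)
  refine ⟨fun x => brpm L g x (L.ω₁ / 2) / brpm L g (L.ω₁ / 2) 0, fun x => brpm L g x 0,
    fun x y => ?_⟩
  have h := brpm_three_term L g x y (L.ω₁ / 2) 0
  rw [brpm_swap L g y 0] at h
  field_simp
  linear_combination h

lemma prod_sub_eq_sum_pow {ι : Type*} [DecidableEq ι] (s : Finset ι) (A B : ι → ℂ) (p q : ℂ) :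
    ∏ k ∈ s, (p * A k - q * B k) = ∑ t ∈ Finset.range (s.card + 1), p ^ t * q ^ (s.card - t) *
      ∑ T ∈ s.powersetCard t, (∏ k ∈ T, A k) * ∏ k ∈ s \ T, -B k := by
  simp only [sub_eq_add_neg, ← mul_neg]
  rw [Finset.prod_add, Finset.sum_powerset]
  refine Finset.sum_congr rfl fun t _ => ?_
  rw [Finset.mul_sum]
  refine Finset.sum_congr rfl fun T hT => ?_
  obtain ⟨hTs, hTc⟩ := Finset.mem_powersetCard.mp hT
  rw [Finset.prod_mul_distrib, Finset.prod_mul_distrib, Finset.prod_const, Finset.prod_const,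
    Finset.card_sdiff_of_subset hTs, hTc]
  ring

/-- Each entry is homogeneous of degree `N - 1` in `(F (u i), G (u i))`. So the matrix is a
projective Vandermonde matrix in `u` times a matrix depending only on `Y`, whose determinant goes
into `K`. -/
lemma exists_det_prod_erase {N : ℕ} (Y : Fin N → ℂ) :
    ∃ K : ℂ, ∀ u : Fin N → ℂ,
      (Matrix.of fun i j => ∏ k ∈ Finset.univ.erase j, brpm L g (u i) (Y k)).det =
        K * ∏ i, ∏ j ∈ Finset.Ioi i, brpm L g (u i) (u j) := by
  obtain ⟨F, G, hFG⟩ := exists_brpm_eq_sub L g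
  let M : Matrix (Fin N) (Fin N) ℂ := Matrix.of fun t j =>
    ∑ T ∈ (Finset.univ.erase j).powersetCard t, (∏ k ∈ T, G (Y k)) *
      ∏ k ∈ Finset.univ.erase j \ T, -F (Y k)
  refine ⟨(∏ i : Fin N, ∏ _j ∈ Finset.Ioi i, (-1 : ℂ)) * M.det, fun u => ?_⟩
  have hmul : (Matrix.of fun i j => ∏ k ∈ Finset.univ.erase j, brpm L g (u i) (Y k)) =
      Matrix.projVandermonde (F ∘ u) (G ∘ u) * M := by
    ext i j
    have hcard : (Finset.univ.erase j).card + 1 = N := by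
      rw [Finset.card_erase_add_one (Finset.mem_univ j), Finset.card_univ, Fintype.card_fin]
    simp only [Matrix.of_apply, hFG, prod_sub_eq_sum_pow, Matrix.mul_apply,
      Matrix.projVandermonde_apply, M, Function.comp_apply]
    rw [hcard, ← Fin.sum_univ_eq_sum_range (fun t => F (u i) ^ t * G (u i) ^
      ((Finset.univ.erase j).card - t) * ∑ T ∈ (Finset.univ.erase j).powersetCard t,
        (∏ k ∈ T, G (Y k)) * ∏ k ∈ Finset.univ.erase j \ T, -F (Y k)) N]
    refine Finset.sum_congr rfl fun t _ => ?_
    congr 3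
    rw [Fin.val_rev]
    omega
  rw [hmul, Matrix.det_mul, Matrix.det_projVandermonde, mul_right_comm, ← Finset.prod_mul_distrib]
  congr 1
  refine Finset.prod_congr rfl fun i _ => ?_
  rw [← Finset.prod_mul_distrib]
  refine Finset.prod_congr rfl fun j _ => ?_
  rw [hFG, Function.comp_apply, Function.comp_apply, Function.comp_apply, Function.comp_apply]
  ring

/-- The Cauchy determinant for `1 / [u ± y]`, up to a constant depending on `y`. -/
theorem exists_det_inv_brpm {N : ℕ} (Y : Fin N → ℂ) (hY : ∀ i j, i ≠ j → brpm L g (Y i) (Y j) ≠ 0) :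
    ∃ K : ℂ, K ≠ 0 ∧ ∀ u : Fin N → ℂ, (∀ i j, brpm L g (u i) (Y j) ≠ 0) →
      (Matrix.of fun i j => (brpm L g (u i) (Y j))⁻¹).det =
        K * (∏ i, ∏ j ∈ Finset.Ioi i, brpm L g (u i) (u j)) *
          ∏ i, ∏ j, (brpm L g (u i) (Y j))⁻¹ := by
  obtain ⟨K, hK⟩ := exists_det_prod_erase L g Y
  refine ⟨K, ?_, fun u hu => ?_⟩
  -- At `u = Y` the matrix of products is diagonal with nonzero diagonal entries, so `K` cannot
  -- vanish. Its value is not needed, since only ratios of Cauchy determinants are used.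
  · rintro rfl
    have h := hK Y
    rw [zero_mul] at h
    have hdiag : (Matrix.of fun i j => ∏ k ∈ Finset.univ.erase j, brpm L g (Y i) (Y k)) =
        Matrix.diagonal fun j => ∏ k ∈ Finset.univ.erase j, brpm L g (Y j) (Y k) := by
      ext i j
      rw [Matrix.of_apply, Matrix.diagonal_apply]
      split_ifs with hij
      · rw [hij]
      · exact Finset.prod_eq_zero (Finset.mem_erase.mpr ⟨hij, Finset.mem_univ i⟩)
          (brpm_self L g (Y i))
    rw [hdiag, Matrix.det_diagonal] at h
    refine Finset.prod_ne_zero_iff.mpr (fun j _ => Finset.prod_ne_zero_iff.mpr fun k hk => ?_) h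
    exact hY j k (Finset.ne_of_mem_erase hk).symm
  · rw [← hK, mul_comm, ← Matrix.det_mul_column]
    congr 1
    ext i j
    rw [Matrix.of_apply, Matrix.of_apply, Matrix.of_apply,
      ← Finset.mul_prod_erase _ _ (Finset.mem_univ j), mul_assoc, ← Finset.prod_mul_distrib,
      Finset.prod_eq_one, mul_one]
    exact fun k _ => inv_mul_cancel₀ (hu i k)

/-- The product of `[u ± v]` over the pairs of entries of a list, in their order. -/
noncomputable def pairProd : List ℂ → ℂ
  | [] => 1
  | u :: l => (l.map (brpm L g u)).prod * pairProd l

/-- The product of `[u ± v]` over `u` in the first and `v` in the second list. -/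
noncomputable def crossProd (l l' : List ℂ) : ℂ := (l.map fun u => (l'.map (brpm L g u)).prod).prod

lemma pairProd_append (l l' : List ℂ) :
    pairProd L g (l ++ l') = pairProd L g l * pairProd L g l' * crossProd L g l l' := by
  induction l with
  | nil => simp [pairProd, crossProd]
  | cons u l ih =>
    simp only [List.cons_append, pairProd, ih, crossProd, List.map_append, List.prod_append,
      List.map_cons, List.prod_cons]
    ring

lemma crossProd_append_right (l l' l'' : List ℂ) :
    crossProd L g l (l' ++ l'') = crossProd L g l l' * crossProd L g l l'' := by
  simp only [crossProd, List.map_append, List.prod_append, List.prod_map_mul]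

lemma crossProd_append_left (l l' l'' : List ℂ) :
    crossProd L g (l ++ l') l'' = crossProd L g l l'' * crossProd L g l' l'' := by
  simp only [crossProd, List.map_append, List.prod_append]

lemma crossProd_nil_right (l : List ℂ) : crossProd L g l [] = 1 := by
  simp [crossProd]

lemma crossProd_flatten_right {m : ℕ} (l : List ℂ) (f : Fin m → List ℂ) :
    crossProd L g l (List.ofFn f).flatten = ∏ j, crossProd L g l (f j) := by
  induction m with
  | zero => simp [crossProd_nil_right]
  | succ m ih =>
    rw [List.ofFn_succ, List.flatten_cons, crossProd_append_right, ih, Fin.prod_univ_succ]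

lemma pairProd_flatten {m : ℕ} (f : Fin m → List ℂ) :
    pairProd L g (List.ofFn f).flatten =
      (∏ i, pairProd L g (f i)) * ∏ i, ∏ j ∈ Finset.Ioi i, crossProd L g (f i) (f j) := by
  induction m with
  | zero => simp [pairProd]
  | succ m ih =>
    rw [List.ofFn_succ, List.flatten_cons, pairProd_append, ih, crossProd_flatten_right,
      Fin.prod_univ_succ, Fin.prod_univ_succ, Fin.prod_Ioi_zero]
    simp only [Fin.prod_Ioi_succ]
    ring

lemma prod_map_flatten {m : ℕ} {R : Type*} [CommMonoid R] (φ : ℂ → R) (f : Fin m → List ℂ) :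
    ((List.ofFn f).flatten.map φ).prod = ∏ i, ((f i).map φ).prod := by
  rw [List.map_flatten, List.prod_flatten, List.map_map, List.map_ofFn, List.prod_ofFn]
  rfl

lemma pairProd_ofFn {N : ℕ} (u : Fin N → ℂ) :
    pairProd L g (List.ofFn u) = ∏ i, ∏ j ∈ Finset.Ioi i, brpm L g (u i) (u j) := by
  induction N with
  | zero => simp [pairProd]
  | succ N ih =>
    rw [List.ofFn_succ, pairProd, ih, Fin.prod_univ_succ, Fin.prod_Ioi_zero, List.map_ofFn,
      List.prod_ofFn]
    simp only [Fin.prod_Ioi_succ, Function.comp_apply]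

open ExteriorAlgebra in
/-- The determinant, as a linear functional on the exterior algebra. -/
noncomputable def detFunctional (N : ℕ) : ExteriorAlgebra ℂ (Fin N → ℂ) →ₗ[ℂ] ℂ :=
  liftAlternating (Pi.single N Matrix.detRowAlternating)

lemma detFunctional_ofFn {N : ℕ} (f : Fin N → Fin N → ℂ) :
    detFunctional N ((List.ofFn f).map (ExteriorAlgebra.ι ℂ)).prod = (Matrix.of f).det := by
  have h := ExteriorAlgebra.liftAlternating_apply_ιMulti (R := ℂ)
    (Pi.single N Matrix.detRowAlternating : ∀ i, (Fin N → ℂ) [⋀^Fin i]→ₗ[ℂ] ℂ) f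
  rw [ExteriorAlgebra.ιMulti_apply, Pi.single_eq_same] at h
  rw [List.map_ofFn]
  exact h

/-- The row of the Cauchy matrix attached to the point `u`. -/
noncomputable def cauchyRow {N : ℕ} (Y : Fin N → ℂ) (u : ℂ) : Fin N → ℂ :=
  fun j => (brpm L g u (Y j))⁻¹

/-- The same `K` serves every list of `N` points. This is what lets strings and windows, which are
concatenated lists, be compared. -/
lemma exists_detFunctional_cauchyRow {N : ℕ} (Y : Fin N → ℂ)
    (hY : ∀ i j, i ≠ j → brpm L g (Y i) (Y j) ≠ 0) :
    ∃ K : ℂ, K ≠ 0 ∧ ∀ l : List ℂ, l.length = N → (∀ u ∈ l, ∀ j, brpm L g u (Y j) ≠ 0) →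
      detFunctional N (l.map fun u => ExteriorAlgebra.ι ℂ (cauchyRow L g Y u)).prod =
        K * pairProd L g l * (l.map fun u => ∏ j, (brpm L g u (Y j))⁻¹).prod := by
  obtain ⟨K, hK0, hK⟩ := exists_det_inv_brpm L g Y hY
  refine ⟨K, hK0, fun l hl hlY => ?_⟩
  obtain ⟨u, rfl⟩ : ∃ u : Fin N → ℂ, l = List.ofFn u := by
    subst hl
    exact ⟨l.get, (List.ofFn_get l).symm⟩
  have h1 := detFunctional_ofFn (fun i => cauchyRow L g Y (u i))
  rw [List.map_ofFn] at h1 ⊢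
  rw [show (fun u => ExteriorAlgebra.ι ℂ (cauchyRow L g Y u)) ∘ u =
    ExteriorAlgebra.ι ℂ ∘ fun i => cauchyRow L g Y (u i) from rfl, h1, pairProd_ofFn, List.map_ofFn,
    List.prod_ofFn]
  exact hK u fun i j => hlY _ (List.mem_ofFn.mpr ⟨i, rfl⟩) j

end EllipticBC

/-! ### Expansion of the transformed Cauchy determinant over windows. -/

namespace EllipticBC

variable (L : PeriodPair) (g δ : ℂ) (a : Fin 8 → ℂ) (c : Fin 4 → ℂ)

/-- The string `x, x + δ, …, x + (n - 1)δ`. -/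
noncomputable def strPts (x : ℂ) (n : ℕ) : List ℂ := (List.range n).map fun k : ℕ => x + (k : ℂ) * δ

/-- The points `x - δ, x, …, x + nδ` with `x + (p - 1)δ` and `x + qδ` omitted. -/
noncomputable def winPts (x : ℂ) (n p q : ℕ) : List ℂ :=
  (List.range' 0 p ++ List.range' (p + 1) (q - p) ++ List.range' (q + 2) (n - q)).map
    fun k : ℕ => x + ((k : ℂ) - 1) * δ

/-- The one-variable difference operator applied to the rows of the Cauchy matrix. -/
noncomputable def diffRow {N : ℕ} (Y : Fin N → ℂ) (u : ℂ) : Fin N → ℂ :=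
  Aminus L g δ a u • cauchyRow L g Y (u - δ) + Azero L g δ a c u • cauchyRow L g Y u +
    Aplus L g δ a u • cauchyRow L g Y (u + δ)

/-- The coefficient of a window in the expansion along a string. -/
noncomputable def strCoeff (x : ℂ) (n p q : ℕ) : ℂ :=
  shifted δ (Aminus L g δ a) x p * shifted δ (Aplus L g δ a) (x + q * δ) (n - q) *
    C L g δ a c (q - p) (x + p * δ)

open ExteriorAlgebra in
lemma prod_map_diffRow {N : ℕ} (Y : Fin N → ℂ) (x : ℂ) (n : ℕ) :
    ((strPts δ x n).map fun u => ι ℂ (diffRow L g δ a c Y u)).prod =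
      ∑ q ∈ Finset.Icc 0 n, ∑ p ∈ Finset.Icc 0 q, strCoeff L g δ a c x n p q •
        ((winPts δ x n p q).map fun u => ι ℂ (cauchyRow L g Y u)).prod := by
  -- Index `k` stands for the point `x + (k - 1)δ`, so that the operator at `x + kδ` involves
  -- exactly the indices `k`, `k + 1` and `k + 2`.
  have h := prod_three_term (R := ExteriorAlgebra ℂ (Fin N → ℂ))
    (v := fun k => ι ℂ (cauchyRow L g Y (x + ((k : ℂ) - 1) * δ)))
    (fun i => ι_sq_zero _) (fun i j => eq_neg_of_add_eq_zero_left (ι_add_mul_swap _ _))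
    (isContinuant_C L g δ a c x) n
  rw [strPts, List.map_map]
  have hl : ((List.range n).map ((fun u => ι ℂ (diffRow L g δ a c Y u)) ∘
      fun k : ℕ => x + (k : ℂ) * δ)) = (List.range n).map fun k : ℕ =>
        Aminus L g δ a (x + k * δ) • ι ℂ (cauchyRow L g Y (x + ((k : ℂ) - 1) * δ)) +
        Azero L g δ a c (x + k * δ) • ι ℂ (cauchyRow L g Y (x + (((k + 1 : ℕ) : ℂ) - 1) * δ)) +
        Aplus L g δ a (x + k * δ) • ι ℂ (cauchyRow L g Y (x + (((k + 2 : ℕ) : ℂ) - 1) * δ)) := by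
    refine List.map_congr_left fun k _ => ?_
    simp only [Function.comp_apply, diffRow, map_add, map_smul]
    rw [show x + ((k : ℂ) - 1) * δ = x + k * δ - δ by ring,
      show x + (((k + 1 : ℕ) : ℂ) - 1) * δ = x + k * δ by push_cast; ring,
      show x + (((k + 2 : ℕ) : ℂ) - 1) * δ = x + k * δ + δ by push_cast; ring]
  rw [hl, h, Nat.range_succ_eq_Icc_zero]
  refine Finset.sum_congr rfl fun q _ => ?_
  rw [Nat.range_succ_eq_Icc_zero]
  refine Finset.sum_congr rfl fun p _ => ?_
  congr 1
  · rw [strCoeff, shifted, shifted, Finset.prod_Ico_eq_prod_range]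
    congr 2
    refine Finset.prod_congr rfl fun k _ => ?_
    congr 1
    push_cast
    ring
  · rw [windowProd, orderedProd, orderedProd, orderedProd, ← List.prod_append, ← List.prod_append,
      ← List.map_append, ← List.map_append, winPts, List.map_map]
    rfl

open ExteriorAlgebra in
/-- Expansion of the image of the Cauchy determinant under the product of the difference
operators, when the variables form strings. -/
theorem detFunctional_diffRow {N m : ℕ} (Y : Fin N → ℂ) (x : Fin m → ℂ) (α : Fin m → ℕ) :
    detFunctional N ((List.ofFn fun i => strPts δ (x i) (α i)).flatten.map
        fun u => ι ℂ (diffRow L g δ a c Y u)).prod =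
      ∑ μ ∈ Finset.Icc 0 α, ∑ ν ∈ Finset.Icc 0 μ, (∏ i, strCoeff L g δ a c (x i) (α i) (ν i) (μ i)) *
        detFunctional N ((List.ofFn fun i => winPts δ (x i) (α i) (ν i) (μ i)).flatten.map
          fun u => ι ℂ (cauchyRow L g Y u)).prod := by
  -- The ordered product over strings is multilinear in the products of the single strings, so the
  -- sums over `(ν_i, μ_i)` expand into sums over boxes without any commutativity.
  have hflat : ∀ (φ : ℂ → ExteriorAlgebra ℂ (Fin N → ℂ)) (f : Fin m → List ℂ),
      ((List.ofFn f).flatten.map φ).prod =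
        MultilinearMap.mkPiAlgebraFin ℂ m _ fun i => ((f i).map φ).prod := fun φ f => by
    rw [MultilinearMap.mkPiAlgebraFin_apply, List.map_flatten, List.prod_flatten, List.map_map,
      List.map_ofFn]
    rfl
  simp only [hflat, prod_map_diffRow]
  rw [MultilinearMap.map_sum_finset, map_sum, Pi.Icc_eq]
  refine Finset.sum_congr rfl fun μ _ => ?_
  rw [MultilinearMap.map_sum_finset, map_sum, Pi.Icc_eq]
  refine Finset.sum_congr rfl fun ν _ => ?_
  rw [MultilinearMap.map_smul_univ, map_smul, smul_eq_mul]

end EllipticBC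

/-! ### Interpolated shifted products, and the exchange of omitted points. -/

namespace EllipticBC

variable (L : PeriodPair) (g δ : ℂ)

/-- The property of interpolating the shifted products `[u]_k` to integer values of `k`, in the
manner of a gamma function. -/
structure IsShiftGamma (u : ℂ) (G : ℤ → ℂ) : Prop where
  ne_zero : ∀ k, G k ≠ 0
  succ : ∀ k : ℤ, G (k + 1) = br L g (u + k * δ) * G k

lemma shifted_succ (f : ℂ → ℂ) (u : ℂ) (n : ℕ) :
    shifted δ f u (n + 1) = shifted δ f u n * f (u + n * δ) := Finset.prod_range_succ _ n

lemma shifted_succ' (f : ℂ → ℂ) (u : ℂ) (n : ℕ) :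
    shifted δ f u (n + 1) = f u * shifted δ f (u + δ) n := by
  rw [shifted, shifted, Finset.prod_range_succ', mul_comm]
  congr 1
  · simp
  · refine Finset.prod_congr rfl fun i _ => ?_
    congr 1
    push_cast
    ring

/-- Extending `[u]_k` to negative `k` by reciprocals makes every bracket and shifted product along
`u + ℤδ` a ratio of two values of `G`. The identities between factors then reduce to cancellation.
-/
lemma exists_isShiftGamma (u : ℂ) (hu : ∀ k : ℤ, br L g (u + k * δ) ≠ 0) :
    ∃ G, IsShiftGamma L g δ u G := by
  refine ⟨fun k => Int.casesOn k (fun n => shifted δ (br L g) u n)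
    fun n => (shifted δ (br L g) (u - ((n + 1 : ℕ) : ℂ) * δ) (n + 1))⁻¹, fun k => ?_, fun k => ?_⟩
  · rcases k with n | n
    · refine Finset.prod_ne_zero_iff.mpr fun i _ => ?_
      simpa using hu i
    · refine inv_ne_zero (Finset.prod_ne_zero_iff.mpr fun i _ => ?_)
      have := hu (i - ((n + 1 : ℕ) : ℤ))
      convert this using 2
      push_cast
      ring
  · rcases k with n | n
    · simp only [Int.ofNat_eq_natCast, Int.cast_natCast]
      rw [mul_comm]
      exact shifted_succ δ _ u n
    · rcases n with _ | n
      · have := hu (-1)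
        simp only [Int.cast_neg, Int.cast_one, neg_mul, one_mul] at this
        change shifted δ (br L g) u 0 = br L g (u + ((Int.negSucc 0 : ℤ) : ℂ) * δ) *
          (shifted δ (br L g) (u - ((0 + 1 : ℕ) : ℂ) * δ) (0 + 1))⁻¹
        simp [sub_eq_add_neg, this, shifted]
      · have := hu (Int.negSucc (n + 1))
        rw [show Int.negSucc (n + 1) + 1 = Int.negSucc n by omega]
        simp only
        rw [shifted_succ' δ _ _ (n + 1), mul_inv,
          show u - ((n + 1 + 1 : ℕ) : ℂ) * δ = u + (Int.negSucc (n + 1) : ℂ) * δ by push_cast; ring,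
          mul_inv_cancel_left₀ this]
        congr 2
        push_cast
        ring

namespace IsShiftGamma

variable {L g δ} {u v : ℂ} {G S D : ℤ → ℂ}

lemma br_eq (hG : IsShiftGamma L g δ u G) (k : ℤ) (h : v = u + k * δ) :
    br L g v = G (k + 1) / G k := by
  rw [h, hG.succ, mul_div_cancel_right₀ _ (hG.ne_zero k)]

lemma br_neg_eq (hG : IsShiftGamma L g δ u G) (k : ℤ) (h : v = -(u + k * δ)) :
    br L g v = -(G (k + 1) / G k) := by
  rw [h, br_neg, hG.br_eq k rfl]

lemma shifted_eq (hG : IsShiftGamma L g δ u G) (n : ℕ) (k : ℤ) (h : v = u + k * δ) :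
    shifted δ (br L g) v n = G (k + n) / G k := by
  have := hG.ne_zero
  induction n with
  | zero => simp [shifted, this]
  | succ n ih =>
    rw [shifted_succ, ih, hG.br_eq (k + n) (by rw [h]; push_cast; ring)]
    push_cast
    rw [← add_assoc]
    field_simp [this]

lemma shifted_neg_eq (hG : IsShiftGamma L g δ u G) (n : ℕ) (k : ℤ) (h : v = -(u + k * δ)) :
    shifted δ (br L g) v n = (-1) ^ n * (G (k + 1) / G (k + 1 - n)) := by
  have := hG.ne_zero
  induction n with
  | zero => simp [shifted, this]
  | succ n ih =>
    rw [shifted_succ, ih, hG.br_neg_eq (k - n) (by rw [h]; push_cast; ring)]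
    push_cast
    rw [show k - (n : ℤ) + 1 = k + 1 - n by ring, show k + 1 - ((n : ℤ) + 1) = k - n by ring]
    have h1 := this (k + 1 - n)
    field_simp
    ring

lemma brpm_eq {x x' w w' : ℂ} (hS : IsShiftGamma L g δ (x + x') S) (hD : IsShiftGamma L g δ (x - x') D)
    (p q : ℤ) (hw : w = x + p * δ) (hw' : w' = x' + q * δ) :
    brpm L g w w' = S (p + q + 1) / S (p + q) * (D (p - q + 1) / D (p - q)) := by
  rw [brpm, hS.br_eq (p + q) (by rw [hw, hw']; push_cast; ring),
    hD.br_eq (p - q) (by rw [hw, hw']; push_cast; ring)]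

lemma prod_map_strPts_right {x x' w : ℂ} (hS : IsShiftGamma L g δ (x + x') S)
    (hD : IsShiftGamma L g δ (x - x') D) (n : ℕ) (p : ℤ) (hw : w = x + p * δ) :
    ((strPts δ x' n).map (brpm L g w)).prod =
      S (p + n) / S p * (D (p + 1) / D (p + 1 - n)) := by
  have hS0 := hS.ne_zero
  have hD0 := hD.ne_zero
  induction n with
  | zero => simp [strPts, hS0, hD0]
  | succ n ih =>
    rw [strPts] at ih
    rw [strPts, List.range_succ, List.map_append, List.map_append, List.prod_append, ih]
    simp only [List.map_cons, List.map_nil, List.prod_singleton]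
    rw [hS.brpm_eq hD p n hw (by push_cast; ring)]
    push_cast
    rw [show p - (n : ℤ) + 1 = p + 1 - n by ring, show p + 1 - ((n : ℤ) + 1) = p - n by ring,
      ← add_assoc]
    have h1 := hS0 (p + n)
    have h2 := hD0 (p + 1 - n)
    field_simp

lemma prod_map_strPts_left {x x' w : ℂ} (hS : IsShiftGamma L g δ (x + x') S)
    (hD : IsShiftGamma L g δ (x - x') D) (n : ℕ) (p : ℤ) (hw : w = x' + p * δ) :
    ((strPts δ x n).map fun v => brpm L g v w).prod =
      S (p + n) / S p * (D (n - p) / D (-p)) := by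
  have hS0 := hS.ne_zero
  have hD0 := hD.ne_zero
  induction n with
  | zero => simp [strPts, hS0, hD0]
  | succ n ih =>
    rw [strPts] at ih
    rw [strPts, List.range_succ, List.map_append, List.map_append, List.prod_append, ih]
    simp only [List.map_cons, List.map_nil, List.prod_singleton]
    rw [hS.brpm_eq hD n p (by push_cast; ring) hw]
    push_cast
    rw [show (n : ℤ) - p + 1 = n + 1 - p by ring, show p + ((n : ℤ) + 1) = n + p + 1 by ring,
      add_comm p]
    have h1 := hS0 (n + p)
    have h2 := hD0 (n - p)
    field_simp

end IsShiftGamma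

lemma strPts_perm_aux (x : ℂ) {n p q : ℕ} (hpq : p ≤ q) (hq : q ≤ n) (φ : ℂ → ℂ) :
    ((winPts δ x n p q).map φ).prod * (φ (x + p * δ - δ) * φ (x + q * δ)) =
      ((List.range' 0 (n + 2)).map fun k : ℕ => φ (x + ((k : ℂ) - 1) * δ)).prod := by
  obtain ⟨d, rfl⟩ := Nat.exists_eq_add_of_le hpq
  obtain ⟨r, rfl⟩ := Nat.exists_eq_add_of_le hq
  rw [show p + d + r + 2 = p + (1 + (d + (1 + r))) by ring, ← List.range'_append_1,
    ← List.range'_append_1, ← List.range'_append_1, ← List.range'_append_1, winPts]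
  simp only [List.map_append, List.prod_append, List.map_map, List.range'_one, List.map_cons,
    List.map_nil, List.prod_singleton, Nat.add_sub_cancel_left, zero_add, Function.comp_def]
  rw [show x + ((p : ℂ) - 1) * δ = x + p * δ - δ by ring,
    show x + (((p + 1 + d : ℕ) : ℂ) - 1) * δ = x + ((p + d : ℕ) : ℂ) * δ by push_cast; ring,
    show p + d + 2 = p + 1 + d + 1 by ring]
  ring

lemma winPts_zero_self (x : ℂ) (n : ℕ) : winPts δ x n 0 n = strPts δ x n := by
  rw [winPts, strPts, Nat.sub_self, List.range'_zero, List.range'_zero, List.append_nil,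
    List.nil_append, Nat.sub_zero, zero_add, List.range'_eq_map_range, List.map_map]
  refine List.map_congr_left fun k _ => ?_
  simp only [Function.comp_apply]
  push_cast
  ring

/-- Passing from a string to a window exchanges two omitted points. -/
lemma prod_map_winPts (x : ℂ) {n p q : ℕ} (hpq : p ≤ q) (hq : q ≤ n) (φ : ℂ → ℂ) :
    ((winPts δ x n p q).map φ).prod * (φ (x + p * δ - δ) * φ (x + q * δ)) =
      ((strPts δ x n).map φ).prod * (φ (x - δ) * φ (x + n * δ)) := by
  rw [strPts_perm_aux δ x hpq hq, ← strPts_perm_aux δ x (Nat.zero_le n) le_rfl φ, winPts_zero_self]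
  simp

end EllipticBC

/-! ### Factors of a summand attached to pairs of variables. -/

namespace EllipticBC

variable (L : PeriodPair) (g δ : ℂ)

/-- The factor of a summand attached to one variable `x` and one variable `y`. -/
noncomputable def crossFactor (x y : ℂ) (n b p q : ℕ) : ℂ :=
  shifted δ (br L g) (x + y + ((b : ℂ) - 1) * δ) p / shifted δ (br L g) (x + y - δ) p *
    (shifted δ (br L g) (x - y) p / shifted δ (br L g) (x - y - b * δ) p) *
  (shifted δ (br L g) (-x - y - ((n : ℂ) - 1) * δ) (n - q) /
      shifted δ (br L g) (-x - y - ((n : ℂ) + b - 1) * δ) (n - q) *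
    (shifted δ (br L g) (-x + y - ((n : ℂ) - b) * δ) (n - q) /
      shifted δ (br L g) (-x + y - n * δ) (n - q)))

/-- The factor of a summand attached to an ordered pair of variables. -/
noncomputable def mixedFactor (x x' : ℂ) (n n' p q q' : ℕ) : ℂ :=
  brpm L g (x - δ) (x' + n' * δ) / brpm L g (x - δ) (x' + q' * δ) *
      (brpm L g (x + p * δ - δ) (x' + q' * δ) / brpm L g (x + p * δ - δ) (x' + n' * δ)) *
      (shifted δ (br L g) (x + x' - 2 * δ) p /
        shifted δ (br L g) (x + x' + ((n' : ℂ) - 1) * δ) p) *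
      (shifted δ (br L g) (x - x' - n' * δ) p / shifted δ (br L g) (x - x' + δ) p) *
  (shifted δ (br L g) (-x - x' - ((n : ℂ) + n') * δ) (n - q) /
        shifted δ (br L g) (-x - x' - ((n : ℂ) - 1) * δ) (n - q) *
      (shifted δ (br L g) (-x + x' - n * δ) (n - q) /
        shifted δ (br L g) (-x + x' + ((n' : ℂ) - n + 1) * δ) (n - q)))

/-- The factor of a summand attached to an unordered pair of distinct variables. -/
noncomputable def pairFactor (x x' : ℂ) (n n' p q p' q' : ℕ) : ℂ :=
  brpm L g (x + p * δ - δ) (x' + p' * δ - δ) / brpm L g (x - δ) (x' - δ) *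
    (brpm L g (x + q * δ) (x' + q' * δ) / brpm L g (x + n * δ) (x' + n' * δ))

/-- The factor of a summand attached to one variable. -/
noncomputable def selfFactor (x : ℂ) (n p q : ℕ) : ℂ :=
  br L g (2 * x + 2 * ((p : ℂ) - 1) * δ) / br L g (2 * x - 2 * δ) *
    (br L g (2 * x + 2 * q * δ) / br L g (2 * x + 2 * n * δ))

variable {L g δ} {x x' y : ℂ} {S D : ℤ → ℂ}

lemma IsShiftGamma.brpm_swap_eq {w w' : ℂ} (hS : IsShiftGamma L g δ (x + x') S)
    (hD : IsShiftGamma L g δ (x - x') D) (p q : ℤ) (hw : w = x + p * δ) (hw' : w' = x' + q * δ) :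
    brpm L g w' w = -(S (p + q + 1) / S (p + q) * (D (p - q + 1) / D (p - q))) := by
  rw [brpm_swap, hS.brpm_eq hD p q hw hw']

/-- The products along the `y`-string telescope. What remains compares the two points omitted by the
window with the two endpoints `x - δ` and `x + nδ` omitted by the string. -/
lemma crossFactor_eq (hS : IsShiftGamma L g δ (x + y) S) (hD : IsShiftGamma L g δ (x - y) D)
    {n b p q : ℕ} (hq : q ≤ n) :
    crossFactor L g δ x y n b p q =
      ((strPts δ y b).map (brpm L g (x + p * δ - δ))).prod *
        ((strPts δ y b).map (brpm L g (x + q * δ))).prod /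
      (((strPts δ y b).map (brpm L g (x - δ))).prod *
        ((strPts δ y b).map (brpm L g (x + n * δ))).prod) := by
  have hS0 := hS.ne_zero
  have hD0 := hD.ne_zero
  obtain ⟨r, rfl⟩ := Nat.exists_eq_add_of_le hq
  rw [hS.prod_map_strPts_right hD b (p - 1) (by push_cast; ring),
    hS.prod_map_strPts_right hD b q (by push_cast; ring),
    hS.prod_map_strPts_right hD b (-1) (by push_cast; ring),
    hS.prod_map_strPts_right hD b (q + r : ℕ) (by push_cast; ring), crossFactor,
    hS.shifted_eq p (b - 1) (by push_cast; ring), hS.shifted_eq p (-1) (by push_cast; ring),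
    hD.shifted_eq p 0 (by push_cast; ring), hD.shifted_eq p (-b) (by push_cast; ring),
    Nat.add_sub_cancel_left, hS.shifted_neg_eq r (q + r - 1) (by push_cast; ring),
    hS.shifted_neg_eq r (q + r + b - 1) (by push_cast; ring),
    hD.shifted_neg_eq r (q + r - b) (by push_cast; ring),
    hD.shifted_neg_eq r (q + r) (by push_cast; ring)]
  push_cast
  ring_nf
  field_simp [hS0, hD0]
  norm_num [pow_mul']

/-- `prod_map_winPts` is used once in each of the two strings. Both orders of `mixedFactor` occur
because the product in the summand runs over ordered pairs, while `crossProd` sees an unordered one.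
-/
lemma crossProd_winPts (hS : IsShiftGamma L g δ (x + x') S)
    (hD : IsShiftGamma L g δ (x - x') D) {n n' p q p' q' : ℕ} (hpq : p ≤ q) (hq : q ≤ n)
    (hpq' : p' ≤ q') (hq' : q' ≤ n') :
    crossProd L g (winPts δ x n p q) (winPts δ x' n' p' q') =
      crossProd L g (strPts δ x n) (strPts δ x' n') *
        (pairFactor L g δ x x' n n' p q p' q' * (mixedFactor L g δ x x' n n' p q q' *
          mixedFactor L g δ x' x n' n p' q' q)) := by
  have hS0 := hS.ne_zero
  have hD0 := hD.ne_zero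
  have e1 : ∀ (w : ℂ) (k : ℤ), w = x + k * δ → ((winPts δ x' n' p' q').map (brpm L g w)).prod =
      S (k + n') / S k * (D (k + 1) / D (k + 1 - n')) *
        (S (k + (-1) + 1) / S (k + (-1)) * (D (k - (-1) + 1) / D (k - (-1))) *
          (S (k + n' + 1) / S (k + n') * (D (k - n' + 1) / D (k - n')))) /
        (S (k + (p' - 1) + 1) / S (k + (p' - 1)) * (D (k - (p' - 1) + 1) / D (k - (p' - 1))) *
          (S (k + q' + 1) / S (k + q') * (D (k - q' + 1) / D (k - q')))) := fun w k hw => by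
    have h := prod_map_winPts δ x' hpq' hq' (brpm L g w)
    rw [hS.brpm_eq hD k (p' - 1) hw (by push_cast; ring),
      hS.brpm_eq hD k q' hw (by push_cast; ring), hS.brpm_eq hD k (-1) hw (by push_cast; ring),
      hS.brpm_eq hD k n' hw (by push_cast; ring), hS.prod_map_strPts_right hD n' k hw] at h
    exact eq_div_of_mul_eq (by simp [hS0, hD0]) h
  have e2 : crossProd L g (strPts δ x n) (winPts δ x' n' p' q') =
      crossProd L g (strPts δ x n) (strPts δ x' n') *
        (((strPts δ x n).map fun u => brpm L g u (x' - δ)).prod *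
          ((strPts δ x n).map fun u => brpm L g u (x' + n' * δ)).prod) /
        (((strPts δ x n).map fun u => brpm L g u (x' + p' * δ - δ)).prod *
          ((strPts δ x n).map fun u => brpm L g u (x' + q' * δ)).prod) := by
    refine eq_div_of_mul_eq ?_ ?_
    · rw [hS.prod_map_strPts_left hD n (p' - 1) (by push_cast; ring),
        hS.prod_map_strPts_left hD n q' (by push_cast; ring)]
      simp [hS0, hD0]
    · simp only [crossProd, ← List.prod_map_mul]
      simp only [prod_map_winPts δ x' hpq' hq']
  have e3 : crossProd L g (winPts δ x n p q) (winPts δ x' n' p' q') = _ := eq_div_of_mul_eq (by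
      rw [e1 _ (p - 1) (by push_cast; ring), e1 _ q (by push_cast; ring)]
      simp [hS0, hD0])
    (prod_map_winPts δ x hpq hq fun u => ((winPts δ x' n' p' q').map (brpm L g u)).prod)
  rw [crossProd] at e2
  rw [e3, e2, mul_div_assoc, mul_div_assoc, mul_assoc]
  congr 1
  rw [hS.prod_map_strPts_left hD n (-1) (by push_cast; ring),
    hS.prod_map_strPts_left hD n n' (by push_cast; ring),
    hS.prod_map_strPts_left hD n (p' - 1) (by push_cast; ring),
    hS.prod_map_strPts_left hD n q' (by push_cast; ring),
    e1 (x - δ) (-1) (by push_cast; ring), e1 (x + n * δ) n (by push_cast; ring),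
    e1 (x + p * δ - δ) (p - 1) (by push_cast; ring), e1 (x + q * δ) q (by push_cast; ring),
    pairFactor, mixedFactor, mixedFactor]
  obtain ⟨r, rfl⟩ := Nat.exists_eq_add_of_le hq
  obtain ⟨r', rfl⟩ := Nat.exists_eq_add_of_le hq'
  rw [Nat.add_sub_cancel_left, Nat.add_sub_cancel_left]
  rw [hS.brpm_eq hD (w := x + p * δ - δ) (w' := x' + p' * δ - δ) (p - 1) (p' - 1)
      (by push_cast; ring) (by push_cast; ring),
    hS.brpm_eq hD (w := x - δ) (w' := x' - δ) (-1) (-1) (by push_cast; ring) (by push_cast; ring),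
    hS.brpm_eq hD (w := x + q * δ) (w' := x' + q' * δ) q q' (by push_cast; ring) (by push_cast; ring),
    hS.brpm_eq hD (w := x + (q + r : ℕ) * δ) (w' := x' + (q' + r' : ℕ) * δ) (q + r : ℕ)
      (q' + r' : ℕ) (by push_cast; ring) (by push_cast; ring),
    hS.brpm_eq hD (w := x - δ) (w' := x' + (q' + r' : ℕ) * δ) (-1) (q' + r' : ℕ)
      (by push_cast; ring) (by push_cast; ring),
    hS.brpm_eq hD (w := x - δ) (w' := x' + q' * δ) (-1) q'
      (by push_cast; ring) (by push_cast; ring),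
    hS.brpm_eq hD (w := x + p * δ - δ) (w' := x' + q' * δ) (p - 1) q'
      (by push_cast; ring) (by push_cast; ring),
    hS.brpm_eq hD (w := x + p * δ - δ) (w' := x' + (q' + r' : ℕ) * δ) (p - 1) (q' + r' : ℕ)
      (by push_cast; ring) (by push_cast; ring),
    hS.brpm_swap_eq hD (w := x + (q + r : ℕ) * δ) (w' := x' - δ) (q + r : ℕ) (-1)
      (by push_cast; ring) (by push_cast; ring),
    hS.brpm_swap_eq hD (w := x + q * δ) (w' := x' - δ) q (-1)
      (by push_cast; ring) (by push_cast; ring),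
    hS.brpm_swap_eq hD (w := x + q * δ) (w' := x' + p' * δ - δ) q (p' - 1)
      (by push_cast; ring) (by push_cast; ring),
    hS.brpm_swap_eq hD (w := x + (q + r : ℕ) * δ) (w' := x' + p' * δ - δ) (q + r : ℕ) (p' - 1)
      (by push_cast; ring) (by push_cast; ring)]
  rw [hS.shifted_eq (v := x + x' - 2 * δ) p (-2) (by push_cast; ring),
    hS.shifted_eq (v := x + x' + (((q' + r' : ℕ) : ℂ) - 1) * δ) p (q' + r' - 1) (by push_cast; ring),
    hD.shifted_eq (v := x - x' - (q' + r' : ℕ) * δ) p (-(q' + r')) (by push_cast; ring),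
    hD.shifted_eq (v := x - x' + δ) p 1 (by push_cast; ring),
    hS.shifted_neg_eq (v := -x - x' - (((q + r : ℕ) : ℂ) + (q' + r' : ℕ)) * δ) r (q + r + q' + r')
      (by push_cast; ring),
    hS.shifted_neg_eq (v := -x - x' - (((q + r : ℕ) : ℂ) - 1) * δ) r (q + r - 1)
      (by push_cast; ring),
    hD.shifted_neg_eq (v := -x + x' - (q + r : ℕ) * δ) r (q + r) (by push_cast; ring),
    hD.shifted_neg_eq (v := -x + x' + (((q' + r' : ℕ) : ℂ) - (q + r : ℕ) + 1) * δ) r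
      (q + r - (q' + r') - 1) (by push_cast; ring)]
  rw [hS.shifted_eq (v := x' + x - 2 * δ) p' (-2) (by push_cast; ring),
    hS.shifted_eq (v := x' + x + (((q + r : ℕ) : ℂ) - 1) * δ) p' (q + r - 1) (by push_cast; ring),
    hD.shifted_neg_eq (v := x' - x - (q + r : ℕ) * δ) p' (q + r) (by push_cast; ring),
    hD.shifted_neg_eq (v := x' - x + δ) p' (-1) (by push_cast; ring),
    hS.shifted_neg_eq (v := -x' - x - (((q' + r' : ℕ) : ℂ) + (q + r : ℕ)) * δ) r' (q + r + q' + r')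
      (by push_cast; ring),
    hS.shifted_neg_eq (v := -x' - x - (((q' + r' : ℕ) : ℂ) - 1) * δ) r' (q' + r' - 1)
      (by push_cast; ring),
    hD.shifted_eq (v := -x' + x - (q' + r' : ℕ) * δ) r' (-(q' + r')) (by push_cast; ring),
    hD.shifted_eq (v := -x' + x + (((q + r : ℕ) : ℂ) - (q' + r' : ℕ) + 1) * δ) r'
      (q + r - (q' + r') + 1) (by push_cast; ring)]
  have hr : ((-1 : ℂ) ^ r) ≠ 0 := by simp
  have hr' : ((-1 : ℂ) ^ r') ≠ 0 := by simp
  have hp' : ((-1 : ℂ) ^ p') ≠ 0 := by simp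
  generalize (-1 : ℂ) ^ r = s1 at *
  generalize (-1 : ℂ) ^ r' = s2 at *
  generalize (-1 : ℂ) ^ p' = s3 at *
  clear e1 e2 e3 hS hD hpq hpq' hq hq'
  push_cast
  ring_nf
  field_simp [hS0, hD0]

end EllipticBC

/-! ### Factors of a summand attached to a single variable. -/

namespace EllipticBC

variable {L : PeriodPair} {g δ x : ℂ} {T : ℤ → ℂ}

section factorial

variable (hδ : ∀ k : ℤ, k ≠ 0 → (k : ℂ) * δ ∉ L.lattice)

include hδ

/-- Within one string the differences of points lie in `ℤδ`. Since `[0] = 0`, no `IsShiftGamma`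
exists on that progression, and the factorials `[δ]_k` take its place. -/
lemma shifted_self_ne_zero (n : ℕ) : shifted δ (br L g) δ n ≠ 0 := by
  refine Finset.prod_ne_zero_iff.mpr fun i _ => ?_
  have := br_ne_zero L g (hδ (i + 1) (by positivity))
  convert this using 2
  push_cast
  ring

lemma br_neg_mul_eq {v : ℂ} (k : ℕ) (h : v = -((k + 1) * δ)) :
    br L g v = -(shifted δ (br L g) δ (k + 1) / shifted δ (br L g) δ k) := by
  have := shifted_self_ne_zero (g := g) hδ k
  rw [h, br_neg, shifted_succ, mul_div_cancel_left₀ _ this]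
  ring_nf

lemma shifted_neg_mul_eq {v : ℂ} (k n : ℕ) (h : v = -((k + n) * δ)) :
    shifted δ (br L g) v n =
      (-1) ^ n * (shifted δ (br L g) δ (k + n) / shifted δ (br L g) δ k) := by
  have := shifted_self_ne_zero (g := g) hδ
  induction n generalizing v with
  | zero =>
    rw [add_zero, div_self (this k)]
    simp [shifted]
  | succ n ih =>
    rw [shifted_succ', ih (v := v + δ) (by rw [h]; push_cast; ring),
      br_neg_mul_eq hδ (k + n) (by rw [h]; push_cast; ring)]
    have h1 := this (k + n)
    rw [← add_assoc]
    field_simp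
    ring

/-- Here `e` counts the points skipped between `w` and the range; in `prod_map_range'_left` it does
so on the other side. -/
lemma prod_map_range'_right (hT : IsShiftGamma L g δ (2 * x) T) {w : ℂ} (i e n : ℕ)
    (hw : w = x + ((i : ℂ) - 1) * δ) :
    ((List.range' (i + 1 + e) n).map fun k : ℕ => brpm L g w (x + ((k : ℂ) - 1) * δ)).prod =
      T (2 * i + e - 1 + n) / T (2 * i + e - 1) *
        ((-1) ^ n * (shifted δ (br L g) δ (e + n) / shifted δ (br L g) δ e)) := by
  have hF := shifted_self_ne_zero (g := g) hδ
  have hT0 := hT.ne_zero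
  induction n with
  | zero => simp [hF, hT0]
  | succ n ih =>
    rw [List.range'_concat, List.map_append, List.prod_append, ih]
    simp only [List.map_cons, List.map_nil, List.prod_singleton]
    rw [brpm, hT.br_eq (2 * i + e - 1 + n) (by rw [hw]; push_cast; ring),
      br_neg_mul_eq hδ (e + n) (by rw [hw]; push_cast; ring)]
    push_cast
    have h1 := hF (e + n)
    rw [← add_assoc, ← add_assoc]
    field_simp [hT0]
    ring

lemma prod_map_range'_left (hT : IsShiftGamma L g δ (2 * x) T) {w : ℂ} (s e n : ℕ)
    (hw : w = x + ((s : ℂ) + n + e - 1) * δ) :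
    ((List.range' s n).map fun k : ℕ => brpm L g (x + ((k : ℂ) - 1) * δ) w).prod =
      T (2 * s + 2 * n + e - 2) / T (2 * s + n + e - 2) *
        ((-1) ^ n * (shifted δ (br L g) δ (e + n) / shifted δ (br L g) δ e)) := by
  have hF := shifted_self_ne_zero (g := g) hδ
  have hT0 := hT.ne_zero
  induction n generalizing e with
  | zero => simp [hF, hT0]
  | succ n ih =>
    rw [List.range'_concat, List.map_append, List.prod_append,
      ih (e + 1) (by rw [hw]; push_cast; ring)]
    simp only [List.map_cons, List.map_nil, List.prod_singleton]
    rw [brpm, hT.br_eq (2 * s + 2 * n + e - 1) (by rw [hw]; push_cast; ring),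
      br_neg_mul_eq hδ e (by rw [hw]; push_cast; ring)]
    push_cast
    rw [show e + 1 + n = e + (n + 1) by ring]
    ring_nf
    field_simp [hT0, hF]

/-- The Vandermonde type product of a window, in terms of that of the full set of points. -/
lemma pairProd_winPts_mul (hT : IsShiftGamma L g δ (2 * x) T) (p d r : ℕ) :
    pairProd L g (winPts δ x (p + d + r) p (p + d)) *
      (-(shifted δ (br L g) δ p * shifted δ (br L g) δ d * shifted δ (br L g) δ (d + 1 + r) *
          shifted δ (br L g) δ (p + d + 1) * shifted δ (br L g) δ r / shifted δ (br L g) δ (d + 1)) *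
        (T (2 * p - 2) / T (p - 2) * (T (2 * p + d - 1) / T (2 * p - 1)) *
          (T (2 * p + d + r) / T (2 * p + d)) * (T (2 * p + d - 1) / T (p + d - 1)) *
          (T (2 * p + 2 * d) / T (2 * p + d)) * (T (2 * p + 2 * d + r + 1) / T (2 * p + 2 * d + 1)) *
          (T (2 * p + d) / T (2 * p + d - 1)))) =
      pairProd L g ((List.range' 0 (p + d + r + 2)).map fun k : ℕ => x + ((k : ℂ) - 1) * δ) := by
  have hF := shifted_self_ne_zero (g := g) hδ
  have hT0 := hT.ne_zero
  rw [show p + d + r + 2 = p + (1 + (d + (1 + r))) by ring, ← List.range'_append_1,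
    ← List.range'_append_1, ← List.range'_append_1, ← List.range'_append_1, winPts]
  simp only [List.map_append, Nat.add_sub_cancel_left, zero_add, List.range'_one,
    pairProd_append, crossProd_append_left, crossProd_append_right, List.map_cons, List.map_nil]
  have h1 := prod_map_range'_left hδ hT (w := x + ((p : ℂ) - 1) * δ) 0 0 p (by push_cast; ring)
  have h2 := prod_map_range'_right hδ hT (w := x + ((p : ℂ) - 1) * δ) p 0 d rfl
  have h3 := prod_map_range'_right hδ hT (w := x + ((p : ℂ) - 1) * δ) p (d + 1) r rfl
  have h4 := prod_map_range'_left hδ hT (w := x + (((p + 1 + d : ℕ) : ℂ) - 1) * δ) 0 (d + 1) p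
    (by push_cast; ring)
  have h5 := prod_map_range'_left hδ hT (w := x + (((p + 1 + d : ℕ) : ℂ) - 1) * δ) (p + 1) 0 d
    (by push_cast; ring)
  have h6 := prod_map_range'_right hδ hT (w := x + (((p + 1 + d : ℕ) : ℂ) - 1) * δ) (p + 1 + d) 0 r
    rfl
  have h7 := prod_map_range'_right hδ hT (w := x + ((p : ℂ) - 1) * δ) p d 1 rfl
  rw [List.range'_one, List.map_cons, List.map_nil, List.prod_singleton] at h7
  rw [show p + 1 + (d + 1) = p + d + 2 by ring] at h3
  rw [add_zero] at h2 h6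
  have hl : ∀ (l : List ℂ) (v : ℂ), crossProd L g l [v] = (l.map fun u => brpm L g u v).prod :=
    fun l v => by simp [crossProd]
  have hr : ∀ (l : List ℂ) (v : ℂ), crossProd L g [v] l = (l.map (brpm L g v)).prod :=
    fun l v => by simp [crossProd]
  simp only [hl, hr, List.map_map, Function.comp_def, List.map_cons, List.map_nil,
    List.prod_singleton, pairProd, List.prod_nil, mul_one, one_mul] at *
  rw [show p + 1 + d + 1 = p + d + 2 by ring] at *
  generalize crossProd L g _ _ = c1
  generalize crossProd L g _ _ = c2
  generalize crossProd L g _ _ = c3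
  generalize pairProd L g _ = c4
  generalize pairProd L g _ = c5
  generalize pairProd L g _ = c6
  rw [h1, h2, h3, h4, h5, h6, h7]
  have e1 : ((-1 : ℂ) ^ p) * (-1) ^ p = 1 := by rw [← mul_pow]; simp
  have e2 : ((-1 : ℂ) ^ d) * (-1) ^ d = 1 := by rw [← mul_pow]; simp
  have e3 : ((-1 : ℂ) ^ r) * (-1) ^ r = 1 := by rw [← mul_pow]; simp
  generalize (-1 : ℂ) ^ p = s1 at *
  generalize (-1 : ℂ) ^ d = s2 at *
  generalize (-1 : ℂ) ^ r = s3 at *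
  have z1 : s1 ≠ 0 := left_ne_zero_of_mul_eq_one e1
  have z2 : s2 ≠ 0 := left_ne_zero_of_mul_eq_one e2
  have z3 : s3 ≠ 0 := left_ne_zero_of_mul_eq_one e3
  clear h1 h2 h3 h4 h5 h6 h7
  have hF0 : shifted δ (br L g) δ 0 = 1 := by simp [shifted]
  push_cast
  generalize shifted δ (br L g) δ = F at *
  ring_nf
  field_simp [hT0, hF]
  rw [hF0, pow_two, pow_two, pow_two, e1, e2, e3]
  ring

/-- Window and string are both compared with the full set of `n + 2` points, the string being the
window `(0, n)`. The explicit sign offsets the one that `[-nδ]_p` and `[-nδ]_{n-q}` bring into the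
diagonal `mixedFactor`. -/
lemma pairProd_winPts (hT : IsShiftGamma L g δ (2 * x) T) {n p q : ℕ} (hpq : p ≤ q) (hq : q ≤ n) :
    pairProd L g (winPts δ x n p q) = pairProd L g (strPts δ x n) *
      ((-1) ^ (p + (n - q)) * selfFactor L g δ x n p q * mixedFactor L g δ x x n n p q q) := by
  have hF := shifted_self_ne_zero (g := g) hδ
  have hT0 := hT.ne_zero
  obtain ⟨d, rfl⟩ := Nat.exists_eq_add_of_le hpq
  obtain ⟨r, rfl⟩ := Nat.exists_eq_add_of_le hq
  have h1 := pairProd_winPts_mul hδ hT p d r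
  have h2 := pairProd_winPts_mul hδ hT 0 (p + d + r) 0
  simp only [zero_add, add_zero, winPts_zero_self] at h2
  rw [← h2] at h1
  rw [eq_div_of_mul_eq (by simp [hT0, hF]) h1, mul_div_assoc]
  congr 1
  rw [Nat.add_sub_cancel_left, selfFactor, mixedFactor, Nat.add_sub_cancel_left]
  have hF0 : shifted δ (br L g) δ 0 = 1 := by simp [shifted]
  rw [hT.br_eq (v := 2 * x + 2 * ((p : ℂ) - 1) * δ) (2 * p - 2) (by push_cast; ring),
    hT.br_eq (v := 2 * x - 2 * δ) (-2) (by push_cast; ring),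
    hT.br_eq (v := 2 * x + 2 * (p + d : ℕ) * δ) (2 * (p + d)) (by push_cast; ring),
    hT.br_eq (v := 2 * x + 2 * (p + d + r : ℕ) * δ) (2 * (p + d + r)) (by push_cast; ring)]
  simp only [brpm]
  rw [hT.br_eq (v := x - δ + (x + (p + d + r : ℕ) * δ)) (p + d + r - 1) (by push_cast; ring),
    hT.br_eq (v := x - δ + (x + (p + d : ℕ) * δ)) (p + d - 1) (by push_cast; ring),
    hT.br_eq (v := x + p * δ - δ + (x + (p + d : ℕ) * δ)) (2 * p + d - 1) (by push_cast; ring),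
    hT.br_eq (v := x + p * δ - δ + (x + (p + d + r : ℕ) * δ)) (2 * p + d + r - 1)
      (by push_cast; ring),
    br_neg_mul_eq hδ (v := x - δ - (x + (p + d + r : ℕ) * δ)) (p + d + r) (by push_cast; ring),
    br_neg_mul_eq hδ (v := x - δ - (x + (p + d : ℕ) * δ)) (p + d) (by push_cast; ring),
    br_neg_mul_eq hδ (v := x + p * δ - δ - (x + (p + d : ℕ) * δ)) d (by push_cast; ring),
    br_neg_mul_eq hδ (v := x + p * δ - δ - (x + (p + d + r : ℕ) * δ)) (d + r) (by push_cast; ring)]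
  rw [hT.shifted_eq (v := x + x - 2 * δ) p (-2) (by push_cast; ring),
    hT.shifted_eq (v := x + x + (((p + d + r : ℕ) : ℂ) - 1) * δ) p (p + d + r - 1)
      (by push_cast; ring),
    shifted_neg_mul_eq hδ (v := x - x - (p + d + r : ℕ) * δ) (d + r) p (by push_cast; ring),
    show x - x + δ = δ by ring,
    hT.shifted_neg_eq (v := -x - x - (((p + d + r : ℕ) : ℂ) + (p + d + r : ℕ)) * δ) r
      (2 * (p + d + r)) (by push_cast; ring),
    hT.shifted_neg_eq (v := -x - x - (((p + d + r : ℕ) : ℂ) - 1) * δ) r (p + d + r - 1)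
      (by push_cast; ring),
    shifted_neg_mul_eq hδ (v := -x + x - (p + d + r : ℕ) * δ) (p + d) r (by push_cast; ring),
    show -x + x + (((p + d + r : ℕ) : ℂ) - (p + d + r : ℕ) + 1) * δ = δ by ring, pow_add]
  have e1 : ((-1 : ℂ) ^ p) * (-1) ^ p = 1 := by rw [← mul_pow]; simp
  have e3 : ((-1 : ℂ) ^ r) * (-1) ^ r = 1 := by rw [← mul_pow]; simp
  generalize (-1 : ℂ) ^ p = s1 at *
  generalize (-1 : ℂ) ^ r = s3 at *
  have z1 : s1 ≠ 0 := left_ne_zero_of_mul_eq_one e1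
  have z3 : s3 ≠ 0 := left_ne_zero_of_mul_eq_one e3
  clear h1 h2
  push_cast
  generalize shifted δ (br L g) δ = F at *
  ring_nf
  field_simp [hT0, hF]
  simp only [hF0, pow_two, e1, e3]

end factorial

end EllipticBC

/-! ### Summands as ratios of Cauchy determinants at generic points. -/

namespace EllipticBC

variable (L : PeriodPair) (g δ : ℂ)

/-- No integer combination of the kind occurring in the denominators lies in the lattice. -/
structure IsGeneric {m n : ℕ} (x : Fin m → ℂ) (y : Fin n → ℂ) : Prop where
  step : ∀ k : ℤ, k ≠ 0 → (k : ℂ) * δ ∉ L.lattice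
  add_left : ∀ i j, ∀ k : ℤ, x i + x j + k * δ ∉ L.lattice
  sub_left : ∀ i j, i ≠ j → ∀ k : ℤ, x i - x j + k * δ ∉ L.lattice
  add_right : ∀ i j, ∀ k : ℤ, y i + y j + k * δ ∉ L.lattice
  sub_right : ∀ i j, i ≠ j → ∀ k : ℤ, y i - y j + k * δ ∉ L.lattice
  add_cross : ∀ i j, ∀ k : ℤ, x i + y j + k * δ ∉ L.lattice
  sub_cross : ∀ i j, ∀ k : ℤ, x i - y j + k * δ ∉ L.lattice

/-- The concatenation of the strings starting at the coordinates of `x`. -/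
noncomputable def strAll {m : ℕ} (x : Fin m → ℂ) (α : Fin m → ℕ) : List ℂ :=
  (List.ofFn fun i => strPts δ (x i) (α i)).flatten

/-- The concatenation of the windows attached to the coordinates of `x`. -/
noncomputable def winAll {m : ℕ} (x : Fin m → ℂ) (α ν μ : Fin m → ℕ) : List ℂ :=
  (List.ofFn fun i => winPts δ (x i) (α i) (ν i) (μ i)).flatten

variable {m n : ℕ} {x : Fin m → ℂ} {y : Fin n → ℂ}

variable {L δ} in
lemma IsGeneric.symm (h : IsGeneric L δ x y) : IsGeneric L δ y x where
  step := h.step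
  add_left := h.add_right
  sub_left := h.sub_right
  add_right := h.add_left
  sub_right := h.sub_left
  add_cross i j k := by
    rw [add_comm (y i)]
    exact h.add_cross j i k
  sub_cross i j k := by
    have := h.sub_cross j i (-k)
    rw [← neg_mem_iff] at this
    convert this using 2
    push_cast
    ring

lemma mem_strPts {u z : ℂ} {k : ℕ} (h : u ∈ strPts δ z k) : ∃ l : ℤ, u = z + l * δ := by
  obtain ⟨l, -, rfl⟩ := List.mem_map.mp h
  exact ⟨l, by simp⟩

lemma mem_winPts {u z : ℂ} {k p q : ℕ} (h : u ∈ winPts δ z k p q) : ∃ l : ℤ, u = z + l * δ := by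
  obtain ⟨l, -, rfl⟩ := List.mem_map.mp h
  exact ⟨l - 1, by push_cast; ring⟩

lemma mem_strAll {u : ℂ} {α : Fin m → ℕ} (h : u ∈ strAll δ x α) :
    ∃ i, ∃ l : ℤ, u = x i + l * δ := by
  obtain ⟨l, hl, hu⟩ := List.mem_flatten.mp h
  obtain ⟨i, rfl⟩ := List.mem_ofFn.mp hl
  exact ⟨i, mem_strPts δ hu⟩

lemma mem_winAll {u : ℂ} {α ν μ : Fin m → ℕ} (h : u ∈ winAll δ x α ν μ) :
    ∃ i, ∃ l : ℤ, u = x i + l * δ := by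
  obtain ⟨l, hl, hu⟩ := List.mem_flatten.mp h
  obtain ⟨i, rfl⟩ := List.mem_ofFn.mp hl
  exact ⟨i, mem_winPts δ hu⟩

lemma length_strAll (x : Fin m → ℂ) (α : Fin m → ℕ) : (strAll δ x α).length = ∑ i, α i := by
  rw [strAll, List.length_flatten, List.map_ofFn, List.sum_ofFn]
  simp [strPts]

lemma length_winAll (x : Fin m → ℂ) {α ν μ : Fin m → ℕ} (hν : ν ≤ μ) (hμ : μ ≤ α) :
    (winAll δ x α ν μ).length = ∑ i, α i := by
  rw [winAll, List.length_flatten, List.map_ofFn, List.sum_ofFn]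
  refine Finset.sum_congr rfl fun i _ => ?_
  have h1 : ν i ≤ μ i := hν i
  have h2 : μ i ≤ α i := hμ i
  simp only [winPts, Function.comp_apply, List.length_map, List.length_append, List.length_range']
  omega

/-- The reciprocal of the product of `[u ± v]` over the points `v` of all strings. -/
noncomputable def weight (y : Fin n → ℂ) (β : Fin n → ℕ) (u : ℂ) : ℂ :=
  (∏ k, ((strPts δ (y k) (β k)).map (brpm L g u)).prod)⁻¹

/-- `prod_map_winPts` for the function `weight`. As `weight` is a reciprocal, the omitted points
contribute to the numerator, as in `crossFactor_eq`. -/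
lemma prod_map_winPts_weight {z : ℂ} (β : Fin n → ℕ)
    (hadd : ∀ j, ∀ k : ℤ, z + y j + k * δ ∉ L.lattice)
    (hsub : ∀ j, ∀ k : ℤ, z - y j + k * δ ∉ L.lattice) {a p q : ℕ} (hpq : p ≤ q) (hq : q ≤ a) :
    ((winPts δ z a p q).map (weight L g δ y β)).prod =
      ((strPts δ z a).map (weight L g δ y β)).prod *
        ∏ k, crossFactor L g δ z (y k) a (β k) p q := by
  choose S hS using fun j => exists_isShiftGamma L g δ _ fun k => br_ne_zero L g (hadd j k)
  choose D hD using fun j => exists_isShiftGamma L g δ _ fun k => br_ne_zero L g (hsub j k)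
  have hne : ∀ (k : Fin n) (l : ℤ) (w : ℂ), w = z + l * δ →
      ((strPts δ (y k) (β k)).map (brpm L g w)).prod ≠ 0 := fun k l w hw => by
    rw [(hS k).prod_map_strPts_right (hD k) _ l hw]
    simp [(hS k).ne_zero, (hD k).ne_zero]
  have h := prod_map_winPts δ z hpq hq (weight L g δ y β)
  simp only [fun k => crossFactor_eq (hS k) (hD k) (b := β k) (p := p) hq,
    Finset.prod_div_distrib, Finset.prod_mul_distrib]
  have h1 := Finset.prod_ne_zero_iff.mpr fun k (_ : k ∈ Finset.univ) =>
    hne k (p - 1) (z + p * δ - δ) (by push_cast; ring)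
  have h2 := Finset.prod_ne_zero_iff.mpr fun k (_ : k ∈ Finset.univ) =>
    hne k q (z + q * δ) (by push_cast; ring)
  have h3 := Finset.prod_ne_zero_iff.mpr fun k (_ : k ∈ Finset.univ) =>
    hne k (-1) (z - δ) (by push_cast; ring)
  have h4 := Finset.prod_ne_zero_iff.mpr fun k (_ : k ∈ Finset.univ) =>
    hne k a (z + a * δ) (by push_cast; ring)
  rw [weight, weight, weight, weight] at h
  generalize ∏ k, ((strPts δ (y k) (β k)).map (brpm L g (z + p * δ - δ))).prod = A1 at *
  generalize ∏ k, ((strPts δ (y k) (β k)).map (brpm L g (z + q * δ))).prod = A2 at *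
  generalize ∏ k, ((strPts δ (y k) (β k)).map (brpm L g (z - δ))).prod = A3 at *
  generalize ∏ k, ((strPts δ (y k) (β k)).map (brpm L g (z + a * δ))).prod = A4 at *
  field_simp at h ⊢
  linear_combination h

lemma bcTerm_eq (a : Fin 8 → ℂ) (c : Fin 4 → ℂ) (α : Fin m → ℕ) (β : Fin n → ℕ)
    (x : Fin m → ℂ) (y : Fin n → ℂ) (ν μ : Fin m → ℕ) :
    bcTerm L g δ a c α β x y ν μ =
      (∏ i, strCoeff L g δ a c (x i) (α i) (ν i) (μ i)) *
      (∏ i, (-1) ^ (ν i + (α i - μ i)) * selfFactor L g δ (x i) (α i) (ν i) (μ i)) *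
      (∏ i, ∏ j ∈ Finset.Ioi i, pairFactor L g δ (x i) (x j) (α i) (α j) (ν i) (μ i) (ν j) (μ j)) *
      (∏ i, ∏ j, mixedFactor L g δ (x i) (x j) (α i) (α j) (ν i) (μ i) (μ j)) *
      ∏ i, ∏ k, crossFactor L g δ (x i) (y k) (α i) (β k) (ν i) (μ i) := by
  simp only [strCoeff, selfFactor, pairFactor, mixedFactor, crossFactor]
  rw [bcTerm, Finset.prod_mul_distrib (f := fun i => (-1 : ℂ) ^ (ν i + (α i - μ i))),
    Finset.prod_pow_eq_pow_sum, Finset.sum_add_distrib]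
  simp only [Finset.prod_mul_distrib]
  ring

/-- The summands as ratios of values of the Cauchy determinant. -/
lemma strCoeff_mul_winAll (a : Fin 8 → ℂ) (c : Fin 4 → ℂ) (hg : IsGeneric L δ x y)
    {α ν μ : Fin m → ℕ} (β : Fin n → ℕ) (hν : ν ≤ μ) (hμ : μ ≤ α) :
    (∏ i, strCoeff L g δ a c (x i) (α i) (ν i) (μ i)) *
        (pairProd L g (winAll δ x α ν μ) * ((winAll δ x α ν μ).map (weight L g δ y β)).prod) =
      bcTerm L g δ a c α β x y ν μ *
        (pairProd L g (strAll δ x α) * ((strAll δ x α).map (weight L g δ y β)).prod) := by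
  have h1 : ∀ i, pairProd L g (winPts δ (x i) (α i) (ν i) (μ i)) = _ := fun i => by
    obtain ⟨T, hT⟩ := exists_isShiftGamma L g δ (2 * x i) fun k => by
      rw [two_mul]
      exact br_ne_zero L g (hg.add_left i i k)
    exact pairProd_winPts hg.step hT (hν i) (hμ i)
  have h2 : ∀ i, ∀ j ∈ Finset.Ioi i, crossProd L g (winPts δ (x i) (α i) (ν i) (μ i))
      (winPts δ (x j) (α j) (ν j) (μ j)) = _ := fun i j hj => by
    obtain ⟨S, hS⟩ := exists_isShiftGamma L g δ _ fun k => br_ne_zero L g (hg.add_left i j k)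
    obtain ⟨D, hD⟩ := exists_isShiftGamma L g δ _ fun k =>
      br_ne_zero L g (hg.sub_left i j (Finset.mem_Ioi.mp hj).ne k)
    exact crossProd_winPts hS hD (hν i) (hμ i) (hν j) (hμ j)
  -- The diagonal factors belong to the single strings, and the two orders of each off-diagonal pair
  -- to `crossProd_winPts`.
  have h3 : ∏ i, ∏ j, mixedFactor L g δ (x i) (x j) (α i) (α j) (ν i) (μ i) (μ j) =
      (∏ i, mixedFactor L g δ (x i) (x i) (α i) (α i) (ν i) (μ i) (μ i)) *
        ∏ i, ∏ j ∈ Finset.Ioi i, mixedFactor L g δ (x i) (x j) (α i) (α j) (ν i) (μ i) (μ j) *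
          mixedFactor L g δ (x j) (x i) (α j) (α i) (ν j) (μ j) (μ i) := by
    rw [Finset.prod_prod_Ioi_mul_eq_prod_prod_off_diag
      (f := fun j i => mixedFactor L g δ (x i) (x j) (α i) (α j) (ν i) (μ i) (μ j)),
      ← Finset.prod_mul_distrib]
    refine Finset.prod_congr rfl fun i _ => ?_
    rw [Fintype.prod_eq_mul_prod_compl i]
  rw [winAll, strAll, pairProd_flatten, pairProd_flatten, prod_map_flatten, prod_map_flatten,
    bcTerm_eq, h3]
  simp only [h1, fun i => prod_map_winPts_weight L g δ β (hg.add_cross i) (hg.sub_cross i)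
    (hν i) (hμ i)]
  rw [Finset.prod_congr rfl fun i _ => Finset.prod_congr rfl (h2 i)]
  simp only [Finset.prod_mul_distrib]
  ring

end EllipticBC

/-! ### Duality for generic variables. -/

namespace EllipticBC

variable (L : PeriodPair) (g δ : ℂ)

variable {m n : ℕ} {x : Fin m → ℂ} {y : Fin n → ℂ}

lemma pairwise_strAll (hg : IsGeneric L δ x y) (α : Fin m → ℕ) :
    (strAll δ x α).Pairwise fun u v => brpm L g u v ≠ 0 := by
  rw [strAll, List.pairwise_flatten]
  refine ⟨fun l hl => ?_, ?_⟩
  · obtain ⟨i, rfl⟩ := List.mem_ofFn.mp hl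
    rw [strPts, List.pairwise_map]
    refine List.pairwise_lt_range.imp fun {k l} hkl => brpm_ne_zero L g ?_ ?_
    · have := hg.add_left i i (k + l)
      convert this using 2
      push_cast
      ring
    · have := hg.step (k - l) (by omega)
      convert this using 2
      push_cast
      ring
  · rw [List.pairwise_ofFn]
    intro i j hij u hu v hv
    obtain ⟨k, rfl⟩ := mem_strPts δ hu
    obtain ⟨l, rfl⟩ := mem_strPts δ hv
    refine brpm_ne_zero L g ?_ ?_
    · have := hg.add_left i j (k + l)
      convert this using 2
      push_cast
      ring
    · have := hg.sub_left i j hij.ne (k - l)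
      convert this using 2
      push_cast
      ring

lemma pairProd_ne_zero {l : List ℂ} (hl : l.Pairwise fun u v => brpm L g u v ≠ 0) :
    pairProd L g l ≠ 0 := by
  induction l with
  | nil => exact one_ne_zero
  | cons u l ih =>
    rw [List.pairwise_cons] at hl
    refine mul_ne_zero (List.prod_ne_zero fun h => ?_) (ih hl.2)
    obtain ⟨v, hv, hv0⟩ := List.mem_map.mp h
    exact hl.1 v hv hv0

variable {L g δ} in
lemma IsGeneric.brpm_ne_zero (hg : IsGeneric L δ x y) {u v : ℂ} {i : Fin m} {k : Fin n}
    (hu : ∃ l : ℤ, u = x i + l * δ) (hv : ∃ l : ℤ, v = y k + l * δ) : brpm L g u v ≠ 0 := by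
  obtain ⟨s, rfl⟩ := hu
  obtain ⟨t, rfl⟩ := hv
  refine EllipticBC.brpm_ne_zero L g ?_ ?_
  · have := hg.add_cross i k (s + t)
    convert this using 2
    push_cast
    ring
  · have := hg.sub_cross i k (s - t)
    convert this using 2
    push_cast
    ring

/-- The product of the difference operators multiplies the Cauchy determinant by the multiple
sum. -/
theorem exists_det_diffRow (a : Fin 8 → ℂ) (c : Fin 4 → ℂ) (hg : IsGeneric L δ x y) {N : ℕ}
    {α : Fin m → ℕ} {β : Fin n → ℕ} {X Y : Fin N → ℂ} (hX : List.ofFn X = strAll δ x α)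
    (hY : List.ofFn Y = strAll δ y β) :
    (Matrix.of fun i => cauchyRow L g Y (X i)).det ≠ 0 ∧
      (Matrix.of fun i => diffRow L g δ a c Y (X i)).det =
        bcSum L g δ a c α β x y * (Matrix.of fun i => cauchyRow L g Y (X i)).det := by
  have hN : ∑ i, α i = N := by rw [← length_strAll δ x α, ← hX, List.length_ofFn]
  have hYmem : ∀ j, ∃ k, ∃ l : ℤ, Y j = y k + l * δ := fun j =>
    mem_strAll δ (hY ▸ List.mem_ofFn.mpr ⟨j, rfl⟩)
  obtain ⟨K, hK0, hK⟩ := exists_detFunctional_cauchyRow L g Y fun i j hij => by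
    have h := pairwise_strAll L g δ hg.symm β
    rw [← hY, List.pairwise_ofFn] at h
    rcases lt_or_gt_of_ne hij with hlt | hlt
    · exact h hlt
    · rw [brpm_swap]
      exact neg_ne_zero.mpr (h hlt)
  have hw : ∀ u, ∏ j, (brpm L g u (Y j))⁻¹ = weight L g δ y β u := fun u => by
    rw [Finset.prod_inv_distrib, weight, ← prod_map_flatten, ← strAll, ← hY, List.map_ofFn,
      List.prod_ofFn]
    rfl
  simp only [hw] at hK
  have hdet : ∀ F : ℂ → Fin N → ℂ, (Matrix.of fun i => F (X i)).det =
      detFunctional N ((strAll δ x α).map fun u => ExteriorAlgebra.ι ℂ (F u)).prod := fun F => by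
    rw [← detFunctional_ofFn, ← hX, List.map_ofFn, List.map_ofFn]
    rfl
  have hbase := hK (strAll δ x α) (by rw [length_strAll, hN]) fun u hu j => by
    obtain ⟨i, hi⟩ := mem_strAll δ hu
    obtain ⟨k, hk⟩ := hYmem j
    exact hg.brpm_ne_zero hi hk
  constructor
  · rw [hdet, hbase]
    refine mul_ne_zero (mul_ne_zero hK0 (pairProd_ne_zero L g (pairwise_strAll L g δ hg α)))
      (List.prod_ne_zero fun h => ?_)
    obtain ⟨u, hu, hu0⟩ := List.mem_map.mp h
    obtain ⟨i, hi⟩ := mem_strAll δ hu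
    rw [← hw, Finset.prod_eq_zero_iff] at hu0
    obtain ⟨j, -, hj⟩ := hu0
    obtain ⟨k, hk⟩ := hYmem j
    exact hg.brpm_ne_zero hi hk (inv_eq_zero.mp hj)
  -- Both determinants carry the same factor `K`, so the expansion can be compared summand by
  -- summand through `strCoeff_mul_winAll`.
  · rw [hdet, hdet, strAll, detFunctional_diffRow, ← strAll, hbase, bcSum, Finset.sum_mul]
    refine Finset.sum_congr rfl fun μ hμ => ?_
    rw [Finset.sum_mul]
    refine Finset.sum_congr rfl fun ν hν => ?_
    have h1 := (Finset.mem_Icc.mp hμ).2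
    have h2 := (Finset.mem_Icc.mp hν).2
    rw [← winAll, hK _ (by rw [length_winAll δ x h2 h1, hN]) fun u hu j => by
      obtain ⟨i, hi⟩ := mem_winAll δ hu
      obtain ⟨k, hk⟩ := hYmem j
      exact hg.brpm_ne_zero hi hk]
    linear_combination K * strCoeff_mul_winAll L g δ a c hg β h2 h1

lemma diffRow_apply (a : Fin 8 → ℂ) (c : Fin 4 → ℂ) {N : ℕ} {Y : Fin N → ℂ} {u : ℂ} {j : Fin N}
    (h : brpm L g u (Y j) ≠ 0) :
    diffRow L g δ a c Y u j = (brpm L g u (Y j))⁻¹ * kernelSum L g δ a c u (Y j) := by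
  simp only [diffRow, cauchyRow, Pi.add_apply, Pi.smul_apply, smul_eq_mul, kernelSum]
  field_simp
  ring

lemma exists_ofFn {l : List ℂ} {N : ℕ} (h : l.length = N) : ∃ X : Fin N → ℂ, List.ofFn X = l := by
  subst h
  exact ⟨l.get, List.ofFn_get l⟩

lemma det_of_eq_neg {N : ℕ} {A B : Matrix (Fin N) (Fin N) ℂ} (h : ∀ i j, A i j = -B j i) :
    A.det = (-1) ^ N * B.det := by
  rw [show A = -B.transpose from Matrix.ext h, Matrix.det_neg, Matrix.det_transpose, Fintype.card_fin]

/-- The duality transformation for generic variables. -/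
theorem bcSum_eq_of_isGeneric {a b : Fin 8 → ℂ} (ha : ∑ p, a p = 4 * δ) (hb : ∀ p, b p = δ - a p)
    {c : Fin 4 → ℂ} (hc : ∀ r, brpm L g ((om L r - δ) / 2) (c r) ≠ 0) {α : Fin m → ℕ}
    {β : Fin n → ℕ} (hαβ : ∑ i, α i = ∑ k, β k) (hg : IsGeneric L δ x y) :
    bcSum L g δ a c α β x y = bcSum L g δ b c β α y x := by
  obtain ⟨X, hX⟩ := exists_ofFn (length_strAll δ x α)
  obtain ⟨Y, hY⟩ := exists_ofFn ((length_strAll δ y β).trans hαβ.symm)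
  obtain ⟨h0, h1⟩ := exists_det_diffRow L g δ a c hg hX hY
  obtain ⟨-, h2⟩ := exists_det_diffRow L g δ b c hg.symm hY hX
  have hbase : (Matrix.of fun i => cauchyRow L g Y (X i)).det =
      (-1) ^ (∑ i, α i) * (Matrix.of fun j => cauchyRow L g X (Y j)).det :=
    det_of_eq_neg fun i j => by
      simp only [Matrix.of_apply, cauchyRow]
      rw [brpm_swap, inv_neg]
  -- The kernel identity matches the entries up to transposition and the sign of `[x ± y] = -[y ±
  -- x]`. The same factor `(-1)^N` appears in `hbase`, so it cancels.
  have hdiff : (Matrix.of fun i => diffRow L g δ a c Y (X i)).det =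
      (-1) ^ (∑ i, α i) * (Matrix.of fun j => diffRow L g δ b c X (Y j)).det :=
    det_of_eq_neg fun i j => by
      obtain ⟨i', s, hs⟩ := mem_strAll δ (hX ▸ List.mem_ofFn.mpr ⟨i, rfl⟩)
      obtain ⟨j', t, ht⟩ := mem_strAll δ (hY ▸ List.mem_ofFn.mpr ⟨j, rfl⟩)
      have hne : brpm L g (X i) (Y j) ≠ 0 := hg.brpm_ne_zero ⟨s, hs⟩ ⟨t, ht⟩
      have hk := kernelSum_eq (L := L) (g := g) (a := a) (b := b) (c := c) (x := X i) (y := Y j)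
        hg.step hc
        (fun k => by
          have := hg.add_right j' j' (2 * t + k)
          convert this using 2
          rw [ht]
          push_cast
          ring) ha hb
        (fun k => by
          have := hg.add_left i' i' (2 * s + k)
          convert this using 2
          rw [hs]
          push_cast
          ring)
        (fun k => by
          have := hg.add_cross i' j' (s + t + k)
          convert this using 2
          rw [hs, ht]
          push_cast
          ring)
        (fun k => by
          have := hg.sub_cross i' j' (s - t + k)
          convert this using 2
          rw [hs, ht]
          push_cast
          ring)
      have hne' : brpm L g (Y j) (X i) ≠ 0 := hg.symm.brpm_ne_zero ⟨t, ht⟩ ⟨s, hs⟩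
      rw [Matrix.of_apply, Matrix.of_apply, diffRow_apply L g δ a c hne,
        diffRow_apply L g δ b c hne', hk, brpm_swap L g (Y j) (X i), inv_neg, neg_mul]
  rw [h1, h2, hbase] at hdiff
  rw [hbase] at h0
  refine mul_right_cancel₀ h0 ?_
  linear_combination hdiff

end EllipticBC

/-! ### Continuity of the multiple sum at regular points. -/

namespace EllipticBC

variable (L : PeriodPair) (g δ : ℂ)

section continuity

variable {P : Type*} [TopologicalSpace P]

@[fun_prop]
lemma Continuous.brpm {φ ψ : P → ℂ} (hφ : Continuous φ) (hψ : Continuous ψ) :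
    Continuous fun u => brpm L g (φ u) (ψ u) := by unfold EllipticBC.brpm; fun_prop

@[fun_prop]
lemma Continuous.shifted_br {φ : P → ℂ} (hφ : Continuous φ) (k : ℕ) :
    Continuous fun u => shifted δ (br L g) (φ u) k := by unfold shifted; fun_prop

lemma continuousAt_prod {ι : Type*} (s : Finset ι) {f : ι → P → ℂ} {p : P}
    (h : ∀ i ∈ s, ContinuousAt (f i) p) : ContinuousAt (fun u => ∏ i ∈ s, f i u) p :=
  tendsto_finsetProd s h

lemma continuousAt_sum {ι : Type*} (s : Finset ι) {f : ι → P → ℂ} {p : P}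
    (h : ∀ i ∈ s, ContinuousAt (f i) p) : ContinuousAt (fun u => ∑ i ∈ s, f i u) p :=
  tendsto_finsetSum s h

lemma continuousAt_shifted {f : ℂ → ℂ} {φ : P → ℂ} (hφ : Continuous φ) {k : ℕ} {p : P}
    (h : ∀ l < k, ContinuousAt f (φ p + l * δ)) : ContinuousAt (fun u => shifted δ f (φ u) k) p :=
  continuousAt_prod _ fun l hl =>
    (h l (Finset.mem_range.mp hl)).comp (f := fun u => φ u + l * δ) (by fun_prop)

end continuity

variable {L g} in
lemma notMem_of_br_ne_zero {u : ℂ} (h : br L g u ≠ 0) : u ∉ L.lattice :=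
  fun hu => h ((br_eq_zero_iff L g).mpr hu)

lemma shifted_ne_zero {u : ℂ} {k : ℕ} (h : ∀ l < k, br L g (u + l * δ) ≠ 0) :
    shifted δ (br L g) u k ≠ 0 :=
  Finset.prod_ne_zero_iff.mpr fun l hl => h l (Finset.mem_range.mp hl)

/-- The extreme shifts `-1` and `2s - 1` come from the brackets `[2z + (2k ± 1)δ]` governing `A⁰(z +
kδ)` at `k = 0` and `k = s - 1`; the poles of `A⁺` and `A⁻` lie within that range. -/
lemma continuousAt_C (a : Fin 8 → ℂ) {c : Fin 4 → ℂ}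
    (hc : ∀ r, brpm L g ((om L r - δ) / 2) (c r) ≠ 0) {z : ℂ} {s : ℕ}
    (hz : ∀ k : ℤ, -1 ≤ k → k ≤ 2 * s - 1 → br L g (2 * z + k * δ) ≠ 0) :
    ContinuousAt (C L g δ a c s) z := by
  have hmem : ∀ k : ℤ, -1 ≤ k → k ≤ 2 * s - 1 → ∀ v, v = 2 * z + k * δ → v ∉ L.lattice :=
    fun k h1 h2 v hv => hv ▸ notMem_of_br_ne_zero (hz k h1 h2)
  unfold C
  refine continuousAt_sum _ fun r _ => continuousAt_const.mul (continuousAt_sum _ fun S hS => ?_)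
  obtain ⟨hS, -⟩ := Finset.mem_filter.mp hS
  obtain ⟨hS, -⟩ := Finset.mem_powersetCard.mp hS
  refine (continuousAt_prod _ fun ξ hξ => ?_).mul (continuousAt_prod _ fun k hk => ?_)
  · have h1 := Finset.mem_Ioo.mp (hS hξ)
    refine ContinuousAt.mul ?_ ?_
    · refine ContinuousAt.comp (g := Aplus L g δ a) (f := fun z => z + ((ξ : ℂ) - 1) * δ)
        (continuousAt_Aplus L g δ a ?_ ?_) (by fun_prop)
      · exact hmem (2 * ξ - 2) (by omega) (by omega) _ (by push_cast; ring)
      · exact hmem (2 * ξ - 1) (by omega) (by omega) _ (by push_cast; ring)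
    · refine ContinuousAt.comp (g := Aminus L g δ a) (f := fun z => z + (ξ : ℂ) * δ)
        (continuousAt_Aminus L g δ a ?_ ?_) (by fun_prop)
      · exact hmem (2 * ξ) (by omega) (by omega) _ (by push_cast; ring)
      · exact hmem (2 * ξ - 1) (by omega) (by omega) _ (by push_cast; ring)
  · have h1 := Finset.mem_range.mp (Finset.mem_filter.mp hk).1
    refine ContinuousAt.comp (g := Azero L g δ a c) (f := fun z => z + (k : ℂ) * δ)
      (continuousAt_Azero L g δ a c hc ?_ ?_) (by fun_prop)
    · exact hmem (2 * k + 1) (by omega) (by omega) _ (by push_cast; ring)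
    · exact hmem (2 * k - 1) (by omega) (by omega) _ (by push_cast; ring)

variable {m n : ℕ} {x : Fin m → ℂ} {y : Fin n → ℂ} {α : Fin m → ℕ} {β : Fin n → ℕ}

variable {L g δ}

namespace Regular

variable (hR : Regular L g δ α β x y)

include hR

lemma br_add_ne_zero {u : ℂ} (i j : Fin m) (k : ℤ) (hk : -2 ≤ k ∧ k ≤ α i + α j)
    (hu : u = x i + x j + k * δ ∨ u = -(x i + x j + k * δ)) : br L g u ≠ 0 := by
  have h := hR.add i j k hk.1 hk.2
  rcases hu with rfl | rfl
  · exact h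
  · rw [br_neg]
    exact neg_ne_zero.mpr h

lemma br_sub_ne_zero (hδ : ∀ k : ℤ, k ≠ 0 → (k : ℂ) * δ ∉ L.lattice) {u : ℂ} (i j : Fin m) (k : ℤ)
    (hk : -(α j + 1 : ℤ) ≤ k ∧ k ≤ α i + 1) (h0 : i = j → k ≠ 0)
    (hu : u = x i - x j + k * δ ∨ u = -(x i - x j + k * δ)) : br L g u ≠ 0 := by
  have h : br L g (x i - x j + k * δ) ≠ 0 := by
    by_cases hij : i = j
    · have := br_ne_zero L g (hδ k (h0 hij))
      rwa [hij, sub_self, zero_add]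
    · exact hR.sub i j hij k hk.1 hk.2
  rcases hu with rfl | rfl
  · exact h
  · rw [br_neg]
    exact neg_ne_zero.mpr h

lemma brpm_ne_zero (hδ : ∀ k : ℤ, k ≠ 0 → (k : ℂ) * δ ∉ L.lattice) {u v : ℂ} (i j : Fin m)
    (k l : ℤ) (hu : u = x i + k * δ) (hv : v = x j + l * δ) (hkl : -2 ≤ k + l ∧ k + l ≤ α i + α j)
    (hkl' : -(α j + 1 : ℤ) ≤ k - l ∧ k - l ≤ α i + 1) (h0 : i = j → k ≠ l) : brpm L g u v ≠ 0 :=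
  mul_ne_zero
    (hR.br_add_ne_zero i j (k + l) hkl (Or.inl (by rw [hu, hv]; push_cast; ring)))
    (hR.br_sub_ne_zero hδ i j (k - l) hkl' (fun h => sub_ne_zero.mpr (h0 h))
      (Or.inl (by rw [hu, hv]; push_cast; ring)))

lemma continuousAt_strCoeff (a : Fin 8 → ℂ) {c : Fin 4 → ℂ}
    (hc : ∀ r, brpm L g ((om L r - δ) / 2) (c r) ≠ 0) (i : Fin m) {p q : ℕ} (hpq : p ≤ q)
    (hq : q ≤ α i) : ContinuousAt (fun z => strCoeff L g δ a c z (α i) p q) (x i) := by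
  have hmem : ∀ k : ℤ, -2 ≤ k ∧ k ≤ α i + α i → ∀ v, v = 2 * x i + k * δ → v ∉ L.lattice :=
    fun k hk v hv => notMem_of_br_ne_zero (hR.br_add_ne_zero i i k hk (Or.inl (by rw [hv]; ring)))
  unfold strCoeff
  refine ((continuousAt_shifted δ continuous_id fun l hl => ?_).mul
    (continuousAt_shifted δ (by fun_prop) fun l hl => ?_)).mul
    (ContinuousAt.comp (g := C L g δ a c (q - p)) (f := fun z => z + (p : ℂ) * δ)
      (continuousAt_C L g δ a hc fun k h1 h2 => ?_) (by fun_prop))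
  · refine continuousAt_Aminus L g δ a ?_ ?_
    · exact hmem (2 * l) (by omega) _ (by push_cast; simp only [id]; ring)
    · exact hmem (2 * l - 1) (by omega) _ (by push_cast; simp only [id]; ring)
  · refine continuousAt_Aplus L g δ a ?_ ?_
    · exact hmem (2 * (q + l)) (by omega) _ (by push_cast; ring)
    · exact hmem (2 * (q + l) + 1) (by omega) _ (by push_cast; ring)
  · exact br_ne_zero L g (hmem (k + 2 * p) (by omega) _ (by push_cast; ring))

lemma continuousAt_selfFactor (i : Fin m) (p q : ℕ) :
    ContinuousAt (fun z => selfFactor L g δ z (α i) p q) (x i) := by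
  unfold selfFactor
  refine (ContinuousAt.div (by fun_prop) (by fun_prop) ?_).mul
    (ContinuousAt.div (by fun_prop) (by fun_prop) ?_)
  · exact hR.br_add_ne_zero i i (-2) (by omega) (Or.inl (by push_cast; ring))
  · exact hR.br_add_ne_zero i i (2 * α i) (by omega) (Or.inl (by push_cast; ring))

lemma continuousAt_pairFactor (hδ : ∀ k : ℤ, k ≠ 0 → (k : ℂ) * δ ∉ L.lattice) {i j : Fin m}
    (hij : i ≠ j) (p q p' q' : ℕ) :
    ContinuousAt (fun z : Fin m → ℂ => pairFactor L g δ (z i) (z j) (α i) (α j) p q p' q') x := by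
  unfold pairFactor
  refine (ContinuousAt.div (by fun_prop) (by fun_prop) ?_).mul
    (ContinuousAt.div (by fun_prop) (by fun_prop) ?_)
  · exact hR.brpm_ne_zero hδ i j (-1) (-1) (by push_cast; ring) (by push_cast; ring) (by omega)
      (by omega) (fun h => absurd h hij)
  · exact hR.brpm_ne_zero hδ i j (α i) (α j) (by push_cast; ring) (by push_cast; ring) (by omega)
      (by omega) (fun h => absurd h hij)

lemma continuousAt_mixedFactor (hδ : ∀ k : ℤ, k ≠ 0 → (k : ℂ) * δ ∉ L.lattice) (i j : Fin m)
    {p q q' : ℕ} (hpq : p ≤ q) (hq : q ≤ α i) (hq' : q' ≤ α j) :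
    ContinuousAt
      (fun z : Fin m → ℂ => mixedFactor L g δ (z i) (z j) (α i) (α j) p q q') x := by
  unfold mixedFactor
  -- For `i = j` the differences are multiples of `δ`; this bound gives `p - 1 ≠ α j`, so that the
  -- difference in `h2` is a nonzero multiple.
  have hp : i = j → p ≤ α j := fun h => h ▸ hpq.trans hq
  have h1 : brpm L g (x i - δ) (x j + q' * δ) ≠ 0 :=
    hR.brpm_ne_zero hδ i j (-1) q' (by push_cast; ring) (by push_cast; ring) (by omega)
      (by omega) (by omega)
  have h2 : brpm L g (x i + p * δ - δ) (x j + α j * δ) ≠ 0 :=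
    hR.brpm_ne_zero hδ i j (p - 1) (α j) (by push_cast; ring) (by push_cast; ring) (by omega)
      (by omega) (fun h => by have := hp h; omega)
  have h3 : shifted δ (br L g) (x i + x j + ((α j : ℂ) - 1) * δ) p ≠ 0 :=
    shifted_ne_zero L g δ fun l hl =>
      hR.br_add_ne_zero i j (α j - 1 + l) (by omega) (Or.inl (by push_cast; ring))
  have h4 : shifted δ (br L g) (x i - x j + δ) p ≠ 0 :=
    shifted_ne_zero L g δ fun l hl =>
      hR.br_sub_ne_zero hδ i j (1 + l) (by omega) (by omega) (Or.inl (by push_cast; ring))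
  have h5 : shifted δ (br L g) (-x i - x j - ((α i : ℂ) - 1) * δ) (α i - q) ≠ 0 :=
    shifted_ne_zero L g δ fun l hl =>
      hR.br_add_ne_zero i j (α i - 1 - l) (by omega) (Or.inr (by push_cast; ring))
  have h6 : shifted δ (br L g) (-x i + x j + ((α j : ℂ) - α i + 1) * δ) (α i - q) ≠ 0 :=
    shifted_ne_zero L g δ fun l hl =>
      hR.br_sub_ne_zero hδ i j (α i - α j - 1 - l) (by omega)
        (fun h => by rw [h]; omega) (Or.inr (by push_cast; ring))
  have hdiv : ∀ {f h : (Fin m → ℂ) → ℂ}, Continuous f → Continuous h → h x ≠ 0 →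
      ContinuousAt (fun z => f z / h z) x := fun hf hh h0 =>
    hf.continuousAt.div hh.continuousAt h0
  exact ((((hdiv (by fun_prop) (by fun_prop) h1).mul (hdiv (by fun_prop) (by fun_prop) h2)).mul
    (hdiv (by fun_prop) (by fun_prop) h3)).mul (hdiv (by fun_prop) (by fun_prop) h4)).mul
    ((hdiv (by fun_prop) (by fun_prop) h5).mul (hdiv (by fun_prop) (by fun_prop) h6))

lemma continuousAt_crossFactor (i : Fin m) (k : Fin n) {p q : ℕ} (hpq : p ≤ q) (hq : q ≤ α i) :
    ContinuousAt (fun z : (Fin m → ℂ) × (Fin n → ℂ) =>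
      crossFactor L g δ (z.1 i) (z.2 k) (α i) (β k) p q) (x, y) := by
  unfold crossFactor
  have h1 : shifted δ (br L g) (x i + y k - δ) p ≠ 0 := shifted_ne_zero L g δ fun l hl => by
    have h := (hR.cross_add i k l (by omega)).1
    convert h using 2
    ring
  have h2 : shifted δ (br L g) (x i - y k - β k * δ) p ≠ 0 := shifted_ne_zero L g δ fun l hl => by
    have h := (hR.cross_sub i k l (by omega)).1
    convert h using 2
    ring
  have h3 : shifted δ (br L g) (-x i - y k - ((α i : ℂ) + β k - 1) * δ) (α i - q) ≠ 0 :=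
    shifted_ne_zero L g δ fun l hl => by
      obtain ⟨s, hs⟩ := Nat.exists_eq_add_of_le (show l + 1 ≤ α i by omega)
      have h := (hR.cross_add i k s (by omega)).2
      rw [← neg_ne_zero, ← br_neg] at h
      convert h using 2
      rw [hs]
      push_cast
      ring
  have h4 : shifted δ (br L g) (-x i + y k - α i * δ) (α i - q) ≠ 0 :=
    shifted_ne_zero L g δ fun l hl => by
      obtain ⟨s, hs⟩ := Nat.exists_eq_add_of_le (show l + 1 ≤ α i by omega)
      have h := (hR.cross_sub i k s (by omega)).2
      rw [← neg_ne_zero, ← br_neg] at h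
      convert h using 2
      rw [hs]
      push_cast
      ring
  have hdiv : ∀ {f h : (Fin m → ℂ) × (Fin n → ℂ) → ℂ}, Continuous f → Continuous h →
      h (x, y) ≠ 0 → ContinuousAt (fun z => f z / h z) (x, y) := fun hf hh h0 =>
    hf.continuousAt.div hh.continuousAt h0
  exact ((hdiv (by fun_prop) (by fun_prop) h1).mul (hdiv (by fun_prop) (by fun_prop) h2)).mul
    ((hdiv (by fun_prop) (by fun_prop) h3).mul (hdiv (by fun_prop) (by fun_prop) h4))

/-- The multiple sum is continuous where no denominator vanishes. -/
theorem continuousAt_bcSum (hδ : ∀ k : ℤ, k ≠ 0 → (k : ℂ) * δ ∉ L.lattice) (a : Fin 8 → ℂ)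
    {c : Fin 4 → ℂ} (hc : ∀ r, EllipticBC.brpm L g ((om L r - δ) / 2) (c r) ≠ 0) :
    ContinuousAt (fun z : (Fin m → ℂ) × (Fin n → ℂ) => bcSum L g δ a c α β z.1 z.2) (x, y) := by
  unfold bcSum
  refine continuousAt_sum _ fun μ hμ => continuousAt_sum _ fun ν hν => ?_
  have h1 : ∀ i, μ i ≤ α i := (Finset.mem_Icc.mp hμ).2
  have h2 : ∀ i, ν i ≤ μ i := (Finset.mem_Icc.mp hν).2
  simp only [bcTerm_eq]
  have hfst : ContinuousAt (Prod.fst : (Fin m → ℂ) × (Fin n → ℂ) → Fin m → ℂ) (x, y) :=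
    continuousAt_fst
  have hproj : ∀ i, ContinuousAt (fun z : (Fin m → ℂ) × (Fin n → ℂ) => z.1 i) (x, y) :=
    fun i => by fun_prop
  refine ((((continuousAt_prod _ fun i _ => ?_).mul (continuousAt_prod _ fun i _ => ?_)).mul
    (continuousAt_prod _ fun i _ => continuousAt_prod _ fun j hj => ?_)).mul
    (continuousAt_prod _ fun i _ => continuousAt_prod _ fun j _ => ?_)).mul
    (continuousAt_prod _ fun i _ => continuousAt_prod _ fun k _ => ?_)
  · exact ContinuousAt.comp (x := (x, y)) (hR.continuousAt_strCoeff a hc i (h2 i) (h1 i))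
      (hproj i)
  · exact continuousAt_const.mul (ContinuousAt.comp (x := (x, y))
      (g := fun z => selfFactor L g δ z (α i) (ν i) (μ i))
      (hR.continuousAt_selfFactor i (ν i) (μ i)) (hproj i))
  · exact ContinuousAt.comp (hR.continuousAt_pairFactor hδ (Finset.mem_Ioi.mp hj).ne (ν i) (μ i)
      (ν j) (μ j)) hfst
  · exact ContinuousAt.comp (hR.continuousAt_mixedFactor hδ i j (h2 i) (h1 i) (h1 j)) hfst
  · exact hR.continuousAt_crossFactor i k (h2 i) (h1 i)

end Regular

end EllipticBC

/-! ### Density of generic points, and the general case. -/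

namespace EllipticBC

variable {L : PeriodPair} {g δ : ℂ} {m n : ℕ}

/-- A line through `(x, y)` meeting the generic locus in a dense set. -/
lemma dense_isGeneric (hδ : ∀ k : ℤ, k ≠ 0 → (k : ℂ) * δ ∉ L.lattice) (x : Fin m → ℂ)
    (y : Fin n → ℂ) :
    Dense {t : ℂ | IsGeneric L δ (fun i => x i + ((i : ℂ) + 1) * t)
      (fun k => y k + ((m : ℂ) + k + 1) * t)} := by
  let z : Fin m ⊕ Fin n → ℂ := Sum.elim x y
  -- The slopes `1, …, m + n` are positive and distinct, so sums of two slopes and differences of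
  -- distinct ones are nonzero. Each forbidden condition is then a nonconstant affine condition on
  -- `t`, excluding only countably many values.
  let w : Fin m ⊕ Fin n → ℕ := Sum.elim (fun i => i + 1) fun k => m + k + 1
  have hw : Function.Injective w := by
    rintro (i | k) (j | l) h <;> simp only [w, Sum.elim_inl, Sum.elim_inr] at h
    · exact congrArg _ (Fin.ext (by omega))
    · omega
    · omega
    · exact congrArg _ (Fin.ext (by omega))
  have hpos : ∀ v, 0 < w v := by rintro (i | k) <;> simp [w]
  refine (dense_affine_notMem_lattice L
    (ι := ((Fin m ⊕ Fin n) × (Fin m ⊕ Fin n) × ℤ) ⊕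
      ({p : (Fin m ⊕ Fin n) × (Fin m ⊕ Fin n) // p.1 ≠ p.2} × ℤ))
    (Sum.elim (fun s => z s.1 + z s.2.1 + s.2.2 * δ) fun s => z s.1.1.1 - z s.1.1.2 + s.2 * δ)
    (Sum.elim (fun s => (w s.1 : ℂ) + w s.2.1) fun s => (w s.1.1.1 : ℂ) - w s.1.1.2) ?_).mono
    fun t ht => ?_
  · rintro (s | s)
    · have := hpos s.1
      simp only [Sum.elim_inl]
      exact_mod_cast (by omega : w s.1 + w s.2.1 ≠ 0)
    · simp only [Sum.elim_inr]
      exact sub_ne_zero.mpr (Nat.cast_injective.ne (hw.ne s.1.2))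
  · have hadd : ∀ u v, ∀ k : ℤ, (z u + w u * t) + (z v + w v * t) + k * δ ∉ L.lattice :=
      fun u v k => by
        have h := ht (Sum.inl (u, v, k))
        simp only [Sum.elim_inl] at h
        convert h using 2
        ring
    have hsub : ∀ u v, u ≠ v → ∀ k : ℤ, (z u + w u * t) - (z v + w v * t) + k * δ ∉ L.lattice :=
      fun u v huv k => by
        have h := ht (Sum.inr (⟨(u, v), huv⟩, k))
        simp only [Sum.elim_inr] at h
        convert h using 2
        ring
    have hl : ∀ i : Fin m, z (Sum.inl i) + w (Sum.inl i) * t = x i + ((i : ℂ) + 1) * t :=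
      fun i => by simp [z, w]
    have hr : ∀ k : Fin n, z (Sum.inr k) + w (Sum.inr k) * t = y k + ((m : ℂ) + k + 1) * t :=
      fun i => by simp [z, w]
    refine ⟨hδ, fun i j => ?_, fun i j hij => ?_, fun i j => ?_, fun i j hij => ?_, fun i j => ?_,
      fun i j => ?_⟩
    · simpa only [hl] using hadd (Sum.inl i) (Sum.inl j)
    · simpa only [hl] using hsub (Sum.inl i) (Sum.inl j) (by simpa using hij)
    · simpa only [hr] using hadd (Sum.inr i) (Sum.inr j)
    · simpa only [hr] using hsub (Sum.inr i) (Sum.inr j) (by simpa using hij)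
    · simpa only [hl, hr] using hadd (Sum.inl i) (Sum.inr j)
    · simpa only [hl, hr] using hsub (Sum.inl i) (Sum.inr j) (by simp)

end EllipticBC

theorem mainTheorem2 (L : PeriodPair) (g δ : ℂ) (hδ : δ ≠ 0)
    (hδL : ∀ k : ℤ, (k : ℂ) * δ ∈ L.lattice → (k : ℂ) * δ = 0)
    (a b : Fin 8 → ℂ) (hb : ∀ p, b p = δ - a p) (hbal : ∑ p, a p = 4 * δ)
    (c : Fin 4 → ℂ)
    (hc : ∀ r, EllipticBC.brpm L g ((EllipticBC.om L r - δ) / 2) (c r) ≠ 0)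
    {m n : ℕ} (α : Fin m → ℕ) (β : Fin n → ℕ) (hαβ : ∑ i, α i = ∑ k, β k)
    (x : Fin m → ℂ) (y : Fin n → ℂ)
    (hx : EllipticBC.Regular L g δ α β x y) (hy : EllipticBC.Regular L g δ β α y x) :
    EllipticBC.bcSum L g δ a c α β x y = EllipticBC.bcSum L g δ b c β α y x := by
  have hstep : ∀ k : ℤ, k ≠ 0 → (k : ℂ) * δ ∉ L.lattice := fun k hk h =>
    mul_ne_zero (Int.cast_ne_zero.mpr hk) hδ (hδL k h)
  let X : ℂ → Fin m → ℂ := fun t i => x i + ((i : ℂ) + 1) * t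
  let Y : ℂ → Fin n → ℂ := fun t k => y k + ((m : ℂ) + k + 1) * t
  have hX : Continuous X := by fun_prop
  have hY : Continuous Y := by fun_prop
  have hX0 : X 0 = x := by simp [X]
  have hY0 : Y 0 = y := by simp [Y]
  have h1 : ContinuousAt (fun t => EllipticBC.bcSum L g δ a c α β (X t) (Y t)) 0 :=
    ContinuousAt.comp (g := fun z : (Fin m → ℂ) × (Fin n → ℂ) =>
      EllipticBC.bcSum L g δ a c α β z.1 z.2) (f := fun t => (X t, Y t))
      (by rw [hX0, hY0]; exact hx.continuousAt_bcSum hstep a hc) (by fun_prop)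
  have h2 : ContinuousAt (fun t => EllipticBC.bcSum L g δ b c β α (Y t) (X t)) 0 :=
    ContinuousAt.comp (g := fun z : (Fin n → ℂ) × (Fin m → ℂ) =>
      EllipticBC.bcSum L g δ b c β α z.1 z.2) (f := fun t => (Y t, X t))
      (by rw [hX0, hY0]; exact hy.continuousAt_bcSum hstep b hc) (by fun_prop)
  have hd := EllipticBC.dense_isGeneric (L := L) hstep x y
  -- Generic parameters accumulate at `t = 0`, where both sides are continuous, so their equality at
  -- generic `t` passes to the limit.
  have : (𝓝[{t | EllipticBC.IsGeneric L δ (X t) (Y t)}] (0 : ℂ)).NeBot :=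
    mem_closure_iff_nhdsWithin_neBot.mp (hd 0)
  have h := tendsto_nhds_unique_of_eventuallyEq (h1.tendsto.mono_left nhdsWithin_le_nhds)
    (h2.tendsto.mono_left nhdsWithin_le_nhds)
    (eventually_nhdsWithin_of_forall (s := {t | EllipticBC.IsGeneric L δ (X t) (Y t)})
      fun t ht => EllipticBC.bcSum_eq_of_isGeneric L g δ hbal hb hc hαβ ht)
  rwa [hX0, hY0] at h
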